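/- Let $\mathbb{K}$ be a field of characteristic $0$, let $n\in\mathbb{Z}$, and let $\mathfrak{g}$ be a bounded, degree-wise finite-dimensional cochain complex over $\mathbb{K}$, with differential $\mathrm{d}$ of degree $+1$. The dual complex $\mathfrak{g}^*=\underline{\mathrm{hom}}(\mathfrak{g},\mathbb{K})$ has $(\mathfrak{g}^*)^i=(\mathfrak{g}^{-i})^*$ and $\mathrm{d}\theta=-(-1)^{|\theta|}\theta\circ\mathrm{d}$; $V[p]$ denotes the shift $V[p]^i=V^{i+p}$ with differential $(-1)^p\mathrm{d}$, and $s^{-p}:V\to V[p]$ is the identity map regarded as a map of degree $-p$. Let $A=\mathrm{Sym}(\mathfrak{g}^*[-1])$ be the free graded-commutative dg-algebra. *Algebraic side.* For a commutative dg-algebra $B$ let $\mathbb{T}_B$ be the graded $B$-module of derivations, with $[D,D']=DD'-(-1)^{|D||D'|}D'D$ and $\partial D=[\mathrm{d},D]$. The $n$-shifted polyvectors are $\mathrm{Pol}(B,n)=\mathrm{Sym}_B(\mathbb{T}_B[-n-1])$, with weight $m$ given by the number of factors from $\mathbb{T}_B[-n-1]$. They carry the Schouten–Nijenhuis bracket,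 i.e. the degree $0$ Lie bracket on $\mathrm{Pol}(B,n)[n+1]$ that is a biderivation and is given on generators by $\{s^{-n-1}a,s^{-n-1}a'\}=0$, $\{s^{-n-1}s^{n+1}D,s^{-n-1}a\}=(-1)^{|D|(n+1)}s^{-n-1}D(a)$, $\{s^{-n-1}s^{n+1}D,s^{-n-1}s^{n+1}D'\}=s^{-n-1}s^{n+1}[D,D']$. An $n$-shifted Poisson structure on $B$ is a formal sum $\pi=\sum_{m\ge2}\pi^{(m)}$ of elements $\pi^{(m)}\in\mathrm{Pol}(B,n)$ of weight $m$ and degree $n+2$ with $\partial(s^{-n-1}\pi)+\tfrac12\{s^{-n-1}\pi,s^{-n-1}\pi\}=0$. A semi-free deformation of $A$ is a derivation $\alpha\in\mathbb{T}_A$ of degree $1$ with $\partial\alpha+\tfrac12[\alpha,\alpha]=0$; then $A_\alpha$ denotes $A$ with the differential $\mathrm{d}+\alpha$. *Maps.* For $\sigma\in S_l$ let $\gamma_\sigma:\mathfrak{g}^{\otimes l}\to\mathfrak{g}^{\otimes l}$ be $y_1\otimes\cdots\otimes y_l\mapsto\pm\,y_{\sigma(1)}\otimes\cdots\otimes y_{\sigma(l)}$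 with the Koszul sign, and let $(-1)^{|\sigma|}$ be the signature. Let $\underline{\mathrm{hom}}^-_\pm(\mathfrak{g}^{\otimes l},\mathfrak{g}^{\otimes m})$ be the complex of linear maps $L:\mathfrak{g}^{\otimes l}\to\mathfrak{g}^{\otimes m}$ with $L\circ\gamma_\sigma=(-1)^{|\sigma|}L$ for $\sigma\in S_l$ and $\gamma_\rho\circ L=(-1)^{|\rho|n}L$ for $\rho\in S_m$, with the differential $\partial L=\mathrm{d}\circ L-(-1)^{|L|}L\circ\mathrm{d}$. For homogeneous $x\in\mathfrak{g}$ write $s^nx=s^{n+1}\partial_x\in\mathbb{T}_A[-n-1]$, where $\partial_x$ is the derivation of $A$ of degree $|x|-1$ with $\partial_x(s\theta)=\langle\theta,x\rangle$. **Transfer.** For every $m\ge0$ there is a (unique) linear isomorphism $\Psi_m$ from the weight $m$ part of $\mathrm{Pol}(A,n)$ to $\bigoplus_{l\ge0}\underline{\mathrm{hom}}^-_\pm(\mathfrak{g}^{\otimes l},\mathfrak{g}^{\otimes m})$ which sends $s^nx_1\cdots s^nx_m\,s\theta_1\cdots s\theta_l$ ($x_k,\theta_j$ homogeneous) to the element $L$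 of the $l$-th summand given on homogeneous $y_1,\dots,y_l\in\mathfrak{g}$ by $$L(y_1,\dots,y_l)=(-1)^{\sum_{k=1}^m|x_k|((m-k)n+l)+\sum_{j=1}^l|\theta_j|(l-j)}\sum_{\sigma\in S_l,\ \rho\in S_m}\varepsilon_\rho\,\varepsilon_\sigma\,(-1)^{\sum_{i<j}|y_i||y_j|}\;\Big(\prod_{j=1}^l\langle\theta_{\sigma(j)},y_j\rangle\Big)\;x_{\rho(1)}\otimes\cdots\otimes x_{\rho(m)},$$ where $\varepsilon_\rho$ is $(-1)^{|\rho|n}$ times the Koszul sign of $x_1\cdots x_m\mapsto x_{\rho(1)}\cdots x_{\rho(m)}$, and $\varepsilon_\sigma$ is $(-1)^{|\sigma|}$ times the Koszul sign of $\theta_1\cdots\theta_l\mapsto\theta_{\sigma(1)}\cdots\theta_{\sigma(l)}$. **Equivalence.** The assignment which sends a pair $(\alpha,\pi)$, consisting of a semi-free deformation $\alpha$ of $A$ and an $n$-shifted Poisson structure $\pi$ on $A_\alpha$, to the components $\pi^{(1,l)}=\Psi_1(s^{n+1}\alpha)_l$ and $\pi^{(m,l)}=\Psi_m(\pi^{(m)})_l$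 for $m\ge2$ is a bijection onto the set of all families of maps $$\Big\{\pi^{(m,l)}\in\underline{\mathrm{hom}}^-_\pm(\mathfrak{g}^{\otimes l},\mathfrak{g}^{\otimes m})\ \text{ of degree }(1-m)n+2-l\ :\ m\ge1,\ l\ge0\Big\}$$ such that for every $m\ge1$ only finitely many of the maps $\pi^{(m,l)}$, $l\ge0$, are non-zero, and such that for all $m\ge1$ and $l\ge0$ $$(-1)^{(m-1)n+l-1}\,\partial\pi^{(m,l)}+\sum_{m_1+m_2-1=m}\ \sum_{l_1+l_2-1=l}(-1)^{((1-m_1)n+2-l_1)((m_2-1)n+l_2-1)}\,(-1)^{n(m_2-1)(l_1-1)}\,C^{m_1,l_1}_{m_2,l_2}=0,$$ where $m_1,m_2,l_1\ge1$, $l_2\ge0$, and $$C^{m_1,l_1}_{m_2,l_2}=\sum_{\substack{\sigma\in\mathrm{Sh}(l_1-1,l_2)\\ \rho\in\mathrm{Sh}(m_1,m_2-1)}}(-1)^{|\sigma|}(-1)^{|\rho|n}\ \gamma_{\rho^{-1}}\circ\big(\pi^{(m_1,l_1)}\otimes\mathrm{id}^{\otimes(m_2-1)}\big)\circ\big(\mathrm{id}^{\otimes(l_1-1)}\otimes\pi^{(m_2,l_2)}\big)\circ\gamma_\sigma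 .$$ Here $\mathrm{Sh}(a,b)\subseteq S_{a+b}$ is the set of permutations that are increasing on $\{1,\dots,a\}$ and on $\{a+1,\dots,a+b\}$, tensor products of maps follow the Koszul rule $(f\otimes h)(y\otimes z)=(-1)^{|h||y|}f(y)\otimes h(z)$, the first output of $\pi^{(m_2,l_2)}$ is the last input of $\pi^{(m_1,l_1)}$, and $\gamma_{\rho^{-1}}$ moves the $k$-th tensor factor to position $\rho(k)$. -/

import Mathlib

universe u v w

/-! ### Koszul signs -/

/-- The sign `(-1)^k` as a scalar. -/
def sg (K : Type u) [Field K] (k : ℤ) : K := ((k.negOnePow : ℤˣ) : ℤ)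

section Signs
variable (K : Type u) [Field K]

theorem sg_add (a b : ℤ) : sg K (a + b) = sg K a * sg K b := by
  simp [sg, Int.negOnePow_add]

theorem sg_congr {a b : ℤ} (h : Even (a - b)) : sg K a = sg K b := by
  have : a.negOnePow = b.negOnePow := (Int.negOnePow_eq_iff a b).2 h
  simp [sg, this]

theorem sg_even {a : ℤ} (h : Even a) : sg K a = 1 := by
  simp [sg, Int.negOnePow_even a h]

theorem sg_odd {a : ℤ} (h : Odd a) : sg K a = -1 := by
  simp [sg, Int.negOnePow_odd a h]

theorem sg_zero : sg K 0 = 1 := sg_even K (by simp)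

theorem neg_sg (a : ℤ) : -sg K a = sg K (a + 1) := by
  rw [sg_add, sg_odd K odd_one, mul_neg_one]

end Signs

/-! ### Graded-commutative algebras given by homogeneous generators and relations -/

/-- The span of the words of total degree `i` in the free associative algebra. -/
def freeDeg (K : Type u) [Field K] {X : Type w} (dg : X → ℤ) (i : ℤ) :
    Submodule K (FreeAlgebra K X) :=
  Submodule.span K
    {a | ∃ l : List X, (l.map dg).sum = i ∧ a = (l.map (FreeAlgebra.ι K)).prod}

/-- Homogeneous generators and homogeneous relations. -/
structure GradedPres (K : Type u) [Field K] where
  Gen : Type w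
  dg : Gen → ℤ
  rel : FreeAlgebra K Gen → FreeAlgebra K Gen → Prop
  homog : ∀ x y, rel x y → ∃ i, x ∈ freeDeg K dg i ∧ y ∈ freeDeg K dg i

namespace GradedPres

variable {K : Type u} [Field K] (P : GradedPres.{u, w} K)

/-- The given relations together with graded commutativity of the generators. -/
inductive fullRel : FreeAlgebra K P.Gen → FreeAlgebra K P.Gen → Prop
  | of {x y : FreeAlgebra K P.Gen} (h : P.rel x y) : fullRel x y
  | comm (x y : P.Gen) : fullRel (FreeAlgebra.ι K x * FreeAlgebra.ι K y)
      (sg K (P.dg x * P.dg y) • (FreeAlgebra.ι K y * FreeAlgebra.ι K x))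

/-- The graded-commutative algebra with the given generators and relations. -/
def Alg : Type (max u w) := RingQuot P.fullRel

instance : Ring P.Alg := inferInstanceAs (Ring (RingQuot P.fullRel))
instance : Algebra K P.Alg := inferInstanceAs (Algebra K (RingQuot P.fullRel))

/-- The quotient map from the free associative algebra. -/
def toAlg : FreeAlgebra K P.Gen →ₐ[K] P.Alg := RingQuot.mkAlgHom K P.fullRel

/-- The class of a generator. -/
def gen (x : P.Gen) : P.Alg := P.toAlg (FreeAlgebra.ι K x)

/-- Algebra maps out of the quotient. -/
def lift {B : Type*} [Semiring B] [Algebra K B] (f : FreeAlgebra K P.Gen →ₐ[K] B)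
    (h : ∀ x y, P.fullRel x y → f x = f y) : P.Alg →ₐ[K] B :=
  RingQuot.liftAlgHom K ⟨f, fun x y hxy => h x y hxy⟩

/-- The homogeneous part of degree `i`. -/
def degPart (i : ℤ) : Submodule K P.Alg := (freeDeg K P.dg i).map P.toAlg.toLinearMap

variable {P}

theorem lift_mk {B : Type*} [Semiring B] [Algebra K B] (f : FreeAlgebra K P.Gen →ₐ[K] B)
    (h : ∀ x y, P.fullRel x y → f x = f y) (x : FreeAlgebra K P.Gen) :
    P.lift f h (P.toAlg x) = f x :=
  RingQuot.liftAlgHom_mkAlgHom_apply K f (fun x y hxy => h x y hxy) x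

theorem mk_surjective : Function.Surjective P.toAlg := RingQuot.mkAlgHom_surjective K P.fullRel

theorem mk_rel {x y : FreeAlgebra K P.Gen} (h : P.fullRel x y) : P.toAlg x = P.toAlg y :=
  RingQuot.mkAlgHom_rel K h

theorem gen_mul_gen (x y : P.Gen) :
    P.gen x * P.gen y = sg K (P.dg x * P.dg y) • (P.gen y * P.gen x) := by
  have := mk_rel (fullRel.comm x y)
  simpa [gen] using this

theorem ind {p : P.Alg → Prop} (one : p 1) (gen_mul : ∀ x a, p a → p (P.gen x * a))
    (add : ∀ a b, p a → p b → p (a + b)) (smul : ∀ (c : K) a, p a → p (c • a)) (a : P.Alg) :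
    p a := by
  have key : ∀ x : FreeAlgebra K P.Gen, ∀ b, p b → p (P.toAlg x * b) := by
    intro x
    induction x using FreeAlgebra.induction with
    | grade0 r =>
      intro b hb
      rw [AlgHom.commutes, ← Algebra.smul_def]
      exact smul r b hb
    | grade1 x => intro b hb; exact gen_mul x b hb
    | mul x y hx hy => intro b hb; rw [map_mul, mul_assoc]; exact hx _ (hy _ hb)
    | add x y hx hy => intro b hb; rw [map_add, add_mul]; exact add _ _ (hx _ hb) (hy _ hb)
  obtain ⟨x, rfl⟩ := mk_surjective a
  simpa using key x 1 one

theorem freeDeg_one : (1 : FreeAlgebra K P.Gen) ∈ freeDeg K P.dg 0 :=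
  Submodule.subset_span ⟨[], by simp⟩

theorem freeDeg_ι (x : P.Gen) : FreeAlgebra.ι K x ∈ freeDeg K P.dg (P.dg x) :=
  Submodule.subset_span ⟨[x], by simp⟩

theorem freeDeg_mul {i j : ℤ} {a b : FreeAlgebra K P.Gen} (ha : a ∈ freeDeg K P.dg i)
    (hb : b ∈ freeDeg K P.dg j) : a * b ∈ freeDeg K P.dg (i + j) := by
  have h := Submodule.mul_mem_mul ha hb
  rw [freeDeg, freeDeg, Submodule.span_mul_span] at h
  refine Submodule.span_mono ?_ h
  rintro _ ⟨_, ⟨l, hl, rfl⟩, _, ⟨l', hl', rfl⟩, rfl⟩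
  exact ⟨l ++ l', by simp [hl, hl'], by simp⟩

theorem fullRel_homog {x y : FreeAlgebra K P.Gen} (h : P.fullRel x y) :
    ∃ i, x ∈ freeDeg K P.dg i ∧ y ∈ freeDeg K P.dg i := by
  cases h with
  | of h => exact P.homog _ _ h
  | comm x y =>
    refine ⟨_, freeDeg_mul (freeDeg_ι x) (freeDeg_ι y), Submodule.smul_mem _ _ ?_⟩
    rw [add_comm]
    exact freeDeg_mul (freeDeg_ι y) (freeDeg_ι x)

theorem mk_mem {i : ℤ} {a : FreeAlgebra K P.Gen} (ha : a ∈ freeDeg K P.dg i) :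
    P.toAlg a ∈ P.degPart i := ⟨a, ha, rfl⟩

theorem one_mem : (1 : P.Alg) ∈ P.degPart 0 := ⟨1, freeDeg_one, by simp⟩

theorem gen_mem (x : P.Gen) : P.gen x ∈ P.degPart (P.dg x) := mk_mem (freeDeg_ι x)

theorem mul_mem {i j : ℤ} {a b : P.Alg} (ha : a ∈ P.degPart i) (hb : b ∈ P.degPart j) :
    a * b ∈ P.degPart (i + j) := by
  obtain ⟨a, ha, rfl⟩ := ha
  obtain ⟨b, hb, rfl⟩ := hb
  exact ⟨a * b, freeDeg_mul ha hb, by simp⟩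

/-- Induction on homogeneous elements of the quotient. -/
theorem degInd {p : ℤ → P.Alg → Prop} (zero : ∀ i, p i 0) (one : p 0 1)
    (gen_mul : ∀ x i a, a ∈ P.degPart i → p i a → p (P.dg x + i) (P.gen x * a))
    (add : ∀ i a b, p i a → p i b → p i (a + b))
    (smul : ∀ i (c : K) a, p i a → p i (c • a)) {i : ℤ} {a : P.Alg} (ha : a ∈ P.degPart i) :
    p i a := by
  obtain ⟨a, ha, rfl⟩ := ha
  change p i (P.toAlg a)
  induction ha using Submodule.span_induction with
  | mem x h =>
    obtain ⟨l, rfl, rfl⟩ := h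
    induction l with
    | nil => simpa using one
    | cons x l ih =>
      simp only [List.map_cons, List.sum_cons, List.prod_cons, map_mul]
      exact gen_mul x _ _ (mk_mem (Submodule.subset_span ⟨l, rfl, rfl⟩)) ih
  | zero => simpa using zero i
  | add x y _ _ hx hy => rw [map_add]; exact add _ _ _ hx hy
  | smul c x _ hx => rw [map_smul]; exact smul _ _ _ hx

theorem gen_mul_comm (x : P.Gen) {i : ℤ} {a : P.Alg} (ha : a ∈ P.degPart i) :
    P.gen x * a = sg K (P.dg x * i) • (a * P.gen x) := by
  refine degInd (p := fun i a => P.gen x * a = sg K (P.dg x * i) • (a * P.gen x))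
    ?_ ?_ ?_ ?_ ?_ ha
  · intro i; simp
  · simp [sg_zero]
  · intro y i a _ ih
    rw [← mul_assoc, gen_mul_gen, smul_mul_assoc, mul_assoc, ih, mul_smul_comm, smul_smul,
      mul_assoc, mul_add, sg_add]
  · intro i a b ha hb; rw [mul_add, add_mul, ha, hb, smul_add]
  · intro i c a ha; rw [mul_smul_comm, ha, smul_mul_assoc, smul_comm]

theorem mul_comm' {i j : ℤ} {a b : P.Alg} (ha : a ∈ P.degPart i) (hb : b ∈ P.degPart j) :
    a * b = sg K (i * j) • (b * a) := by
  refine degInd (p := fun i a => a * b = sg K (i * j) • (b * a)) ?_ ?_ ?_ ?_ ?_ ha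
  · intro i; simp
  · simp [sg_zero]
  · intro x i a _ ih
    rw [mul_assoc, ih, mul_smul_comm, ← mul_assoc, gen_mul_comm x hb, smul_mul_assoc, smul_smul,
      mul_assoc, add_mul, sg_add, mul_comm (sg K _)]
  · intro i a b ha hb; rw [mul_add, add_mul, ha, hb, smul_add]
  · intro i c a ha; rw [smul_mul_assoc, ha, mul_smul_comm, smul_comm]

instance : SetLike.GradedMonoid P.degPart where
  one_mem := one_mem
  mul_mem _ _ _ _ := mul_mem

/-- The map to the direct sum of the homogeneous parts, on the free algebra. -/
noncomputable def toSum :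
    FreeAlgebra K P.Gen →ₐ[K] DirectSum ℤ (fun i => P.degPart i) :=
  FreeAlgebra.lift K fun x => DirectSum.of (fun i => P.degPart i) (P.dg x) ⟨P.gen x, gen_mem x⟩

theorem toSum_apply {i : ℤ} {a : FreeAlgebra K P.Gen} (ha : a ∈ freeDeg K P.dg i) :
    toSum a = DirectSum.of (fun i => P.degPart i) i ⟨P.toAlg a, mk_mem ha⟩ := by
  induction ha using Submodule.span_induction with
  | mem x h =>
    obtain ⟨l, rfl, rfl⟩ := h
    induction l with
    | nil =>
      simp only [List.map_nil, List.prod_nil, map_one]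
      rfl
    | cons x l ih =>
      simp only [List.map_cons, List.prod_cons, map_mul]
      rw [ih]
      simp only [toSum, FreeAlgebra.lift_ι_apply]
      rw [DirectSum.of_mul_of]
      rfl
  | zero =>
    rw [map_zero]
    symm
    convert (DirectSum.of (fun i => P.degPart i) i).map_zero using 2
    ext; simp
  | add x y hx hy ihx ihy =>
    rw [map_add, ihx, ihy, ← map_add]
    congr 1; ext; simp
  | smul c x hx ihx =>
    rw [map_smul, ihx]
    change c • DirectSum.lof K ℤ (fun i => P.degPart i) i _ = DirectSum.lof K ℤ _ i _
    rw [← map_smul]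
    congr 1; ext; simp

/-- The map to the direct sum of the homogeneous parts. -/
noncomputable def decomp : P.Alg →ₐ[K] DirectSum ℤ (fun i => P.degPart i) :=
  P.lift toSum (by
    intro x y h
    obtain ⟨i, hx, hy⟩ := fullRel_homog h
    rw [toSum_apply hx, toSum_apply hy]
    congr 2
    exact mk_rel h)

noncomputable instance gradedAlgebra : GradedAlgebra P.degPart :=
  GradedAlgebra.ofAlgHom P.degPart decomp
    (by
      ext a
      obtain ⟨a, rfl⟩ := mk_surjective a
      rw [AlgHom.comp_apply, decomp, lift_mk, AlgHom.id_apply]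
      induction a using FreeAlgebra.induction with
      | grade0 r => simp
      | grade1 x => simp [toSum, gen]
      | mul x y hx hy => rw [map_mul, map_mul, hx, hy, map_mul]
      | add x y hx hy => rw [map_add, map_add, hx, hy, map_add])
    (by
      rintro i ⟨_, ⟨a, ha, rfl⟩⟩
      exact (lift_mk toSum _ a).trans (toSum_apply ha))

/-! #### Derivations out of prescribed values on generators -/

/-- `a ↦ (-1)^{e|a|} a` on the free algebra. -/
noncomputable def freeTwist (P : GradedPres.{u, w} K) (e : ℤ) : FreeAlgebra K P.Gen →ₐ[K] P.Alg :=
  FreeAlgebra.lift K fun x => sg K (e * P.dg x) • P.gen x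

theorem freeTwist_apply (e : ℤ) {i : ℤ} {a : FreeAlgebra K P.Gen} (ha : a ∈ freeDeg K P.dg i) :
    P.freeTwist e a = sg K (e * i) • P.toAlg a := by
  induction ha using Submodule.span_induction with
  | mem x h =>
    obtain ⟨l, rfl, rfl⟩ := h
    induction l with
    | nil => simp [sg_zero]
    | cons x l ih =>
      simp only [List.map_cons, List.prod_cons, map_mul, List.sum_cons]
      rw [ih, freeTwist, FreeAlgebra.lift_ι_apply, mul_add, sg_add, smul_mul_smul_comm]
      rfl
  | zero => simp
  | add x y _ _ hx hy => rw [map_add, hx, hy, map_add, smul_add]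
  | smul c x _ hx => rw [map_smul, hx, map_smul, smul_comm]

/-- `a ↦ (-1)^{e|a|} a`. -/
noncomputable def twist (P : GradedPres.{u, w} K) (e : ℤ) : P.Alg →ₐ[K] P.Alg :=
  P.lift (P.freeTwist e) (by
    intro x y h
    obtain ⟨i, hx, hy⟩ := fullRel_homog h
    rw [freeTwist_apply e hx, freeTwist_apply e hy, mk_rel h])

theorem twist_apply (e : ℤ) {i : ℤ} {a : P.Alg} (ha : a ∈ P.degPart i) :
    P.twist e a = sg K (e * i) • a := by
  obtain ⟨a, ha, rfl⟩ := ha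
  exact (lift_mk _ _ _).trans (freeTwist_apply e ha)

/-- The triangular matrix `[(-1)^{e|a|} a, D a; 0, a]`. -/
noncomputable def freeMat (P : GradedPres.{u, w} K) (e : ℤ) (f : P.Gen → P.Alg) :
    FreeAlgebra K P.Gen →ₐ[K] Matrix (Fin 2) (Fin 2) P.Alg :=
  FreeAlgebra.lift K fun x => !![sg K (e * P.dg x) • P.gen x, f x; 0, P.gen x]

/-- The extension of `f` to the free algebra by the graded Leibniz rule. -/
noncomputable def freeDer (P : GradedPres.{u, w} K) (e : ℤ) (f : P.Gen → P.Alg)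
    (a : FreeAlgebra K P.Gen) : P.Alg := P.freeMat e f a 0 1

theorem freeMat_apply (e : ℤ) (f : P.Gen → P.Alg) (a : FreeAlgebra K P.Gen) :
    P.freeMat e f a = !![P.freeTwist e a, P.freeDer e f a; 0, P.toAlg a] := by
  have h : P.freeMat e f a 0 0 = P.freeTwist e a ∧ P.freeMat e f a 1 0 = 0 ∧
      P.freeMat e f a 1 1 = P.toAlg a := by
    induction a using FreeAlgebra.induction with
    | grade0 r =>
      simp only [AlgHom.commutes]
      simp [Matrix.algebraMap_matrix_apply]
    | grade1 x => simp [freeMat, freeTwist, gen]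
    | mul x y hx hy => simp [Matrix.mul_apply, Fin.sum_univ_two, hx, hy]
    | add x y hx hy => simp [hx, hy]
  ext i j
  fin_cases i <;> fin_cases j <;> simp [h, freeDer]

theorem freeDer_mul (e : ℤ) (f : P.Gen → P.Alg) (a b : FreeAlgebra K P.Gen) :
    P.freeDer e f (a * b) = P.freeTwist e a * P.freeDer e f b + P.freeDer e f a * P.toAlg b := by
  rw [freeDer, map_mul, freeMat_apply, freeMat_apply]
  simp [Matrix.mul_apply, Fin.sum_univ_two]

theorem freeDer_ι (e : ℤ) (f : P.Gen → P.Alg) (x : P.Gen) :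
    P.freeDer e f (FreeAlgebra.ι K x) = f x := by simp [freeDer, freeMat]

theorem freeDer_add (e : ℤ) (f : P.Gen → P.Alg) (a b : FreeAlgebra K P.Gen) :
    P.freeDer e f (a + b) = P.freeDer e f a + P.freeDer e f b := by simp [freeDer]

theorem freeDer_smul (e : ℤ) (f : P.Gen → P.Alg) (c : K) (a : FreeAlgebra K P.Gen) :
    P.freeDer e f (c • a) = c • P.freeDer e f a := by simp [freeDer]

theorem freeDer_one (e : ℤ) (f : P.Gen → P.Alg) : P.freeDer e f 1 = 0 := by simp [freeDer]

theorem freeDer_ι_mul_ι (e : ℤ) (f : P.Gen → P.Alg) (x y : P.Gen) :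
    P.freeDer e f (FreeAlgebra.ι K x * FreeAlgebra.ι K y) =
      sg K (e * P.dg x) • (P.gen x * f y) + f x * P.gen y := by
  rw [freeDer_mul, freeDer_ι, freeDer_ι, freeTwist, FreeAlgebra.lift_ι_apply, smul_mul_assoc]
  rfl

/-- Values on generators that extend to a derivation of degree `e`. -/
structure DerData (P : GradedPres.{u, w} K) (e : ℤ) where
  f : P.Gen → P.Alg
  f_mem : ∀ x, f x ∈ P.degPart (P.dg x + e)
  f_rel : ∀ x y, P.rel x y → P.freeDer e f x = P.freeDer e f y

namespace DerData

variable {e : ℤ} (F : P.DerData e)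

/-- The associated algebra map to triangular matrices. -/
noncomputable def mat : P.Alg →ₐ[K] Matrix (Fin 2) (Fin 2) P.Alg :=
  P.lift (P.freeMat e F.f) (by
    intro x y h
    have h1 : P.freeTwist e x = P.freeTwist e y := by
      obtain ⟨i, hx, hy⟩ := fullRel_homog h
      rw [freeTwist_apply e hx, freeTwist_apply e hy, mk_rel h]
    have h2 : P.freeDer e F.f x = P.freeDer e F.f y := by
      cases h with
      | of h => exact F.f_rel _ _ h
      | comm x y =>
        rw [freeDer_smul, freeDer_ι_mul_ι, freeDer_ι_mul_ι, smul_add, add_comm,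
          gen_mul_comm x (F.f_mem y), mul_comm' (F.f_mem x) (gen_mem y), smul_smul, smul_smul,
          ← sg_add, ← sg_add]
        congr 2
        · exact sg_congr K ⟨0, by ring⟩
        · exact sg_congr K ⟨e * P.dg x, by ring⟩
    rw [freeMat_apply, freeMat_apply, h1, h2, mk_rel h])

/-- The derivation of degree `e` with the prescribed values on generators. -/
noncomputable def der : P.Alg →ₗ[K] P.Alg where
  toFun a := F.mat a 0 1
  map_add' a b := by simp
  map_smul' c a := by simp

theorem mat_mk (a : FreeAlgebra K P.Gen) : F.mat (P.toAlg a) = P.freeMat e F.f a := lift_mk _ _ a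

theorem der_mk (a : FreeAlgebra K P.Gen) : F.der (P.toAlg a) = P.freeDer e F.f a := by
  change F.mat (P.toAlg a) 0 1 = _
  rw [mat_mk]; rfl

theorem der_one : F.der 1 = 0 := by
  rw [← map_one P.toAlg, der_mk, freeDer_one]

theorem der_gen (x : P.Gen) : F.der (P.gen x) = F.f x := by
  rw [gen, der_mk, freeDer_ι]

theorem der_mul {i : ℤ} {a : P.Alg} (ha : a ∈ P.degPart i) (b : P.Alg) :
    F.der (a * b) = F.der a * b + sg K (e * i) • (a * F.der b) := by
  obtain ⟨a, ha, rfl⟩ := ha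
  obtain ⟨b, rfl⟩ := mk_surjective b
  change F.der (P.toAlg a * P.toAlg b) = F.der (P.toAlg a) * P.toAlg b +
    sg K (e * i) • (P.toAlg a * F.der (P.toAlg b))
  rw [← map_mul, der_mk, der_mk, der_mk, freeDer_mul, freeTwist_apply e ha, add_comm,
    smul_mul_assoc]

theorem der_mem {i : ℤ} {a : P.Alg} (ha : a ∈ P.degPart i) : F.der a ∈ P.degPart (i + e) := by
  refine degInd (p := fun i a => F.der a ∈ P.degPart (i + e)) ?_ ?_ ?_ ?_ ?_ ha
  · intro i; simp
  · rw [der_one]; exact Submodule.zero_mem _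
  · intro x i a ha ih
    rw [der_mul F (gen_mem x), der_gen]
    refine Submodule.add_mem _ ?_ (Submodule.smul_mem _ _ ?_)
    · have := mul_mem (F.f_mem x) ha
      rwa [show P.dg x + e + i = P.dg x + i + e by ring] at this
    · have := mul_mem (gen_mem x) ih
      rwa [← add_assoc] at this
  · intro i a b ha hb; rw [map_add]; exact Submodule.add_mem _ ha hb
  · intro i c a ha; rw [map_smul]; exact Submodule.smul_mem _ _ ha

end DerData

/-- Two linear maps with the same Leibniz rule that agree on generators are equal. -/
theorem der_ext {e : ℤ} {D D' : P.Alg → P.Alg} (hD : IsLinearMap K D) (hD' : IsLinearMap K D')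
    (h1 : D 1 = 0) (h1' : D' 1 = 0)
    (hm : ∀ x a, D (P.gen x * a) = D (P.gen x) * a + sg K (e * P.dg x) • (P.gen x * D a))
    (hm' : ∀ x a, D' (P.gen x * a) = D' (P.gen x) * a + sg K (e * P.dg x) • (P.gen x * D' a))
    (h : ∀ x, D (P.gen x) = D' (P.gen x)) (a : P.Alg) : D a = D' a := by
  induction a using ind with
  | one => rw [h1, h1']
  | gen_mul x a ih => rw [hm, hm', ih, h]
  | add a b ha hb => rw [hD.map_add, hD'.map_add, ha, hb]
  | smul c a ha => rw [hD.map_smul, hD'.map_smul, ha]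

end GradedPres

/-! ### Commutative dg-algebras and their derivations -/

/-- A `ℤ`-graded algebra that is commutative up to Koszul signs. -/
structure GCA (K : Type u) [Field K] where
  carrier : Type w
  [ring : Ring carrier]
  [algebra : Algebra K carrier]
  deg : ℤ → Submodule K carrier
  [graded : GradedAlgebra deg]
  comm : ∀ i j a b, a ∈ deg i → b ∈ deg j → a * b = sg K (i * j) • (b * a)

attribute [instance] GCA.ring GCA.algebra GCA.graded

namespace GCA

variable {K : Type u} [Field K] (A : GCA.{u, w} K)

theorem mul_mem {i j : ℤ} {a b : A.carrier} (ha : a ∈ A.deg i) (hb : b ∈ A.deg j) :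
    a * b ∈ A.deg (i + j) := SetLike.GradedMul.mul_mem ha hb

/-- The derivations of degree `k`. -/
def Der (k : ℤ) : Submodule K (A.carrier →ₗ[K] A.carrier) where
  carrier := {D | (∀ i, ∀ a ∈ A.deg i, D a ∈ A.deg (i + k)) ∧
    ∀ i, ∀ a ∈ A.deg i, ∀ b, D (a * b) = D a * b + sg K (k * i) • (a * D b)}
  zero_mem' := ⟨fun i a _ => by simp, fun i a _ b => by simp⟩
  add_mem' := by
    rintro D D' ⟨h1, h2⟩ ⟨h1', h2'⟩
    refine ⟨fun i a ha => Submodule.add_mem _ (h1 i a ha) (h1' i a ha), fun i a ha b => ?_⟩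
    simp only [LinearMap.add_apply, h2 i a ha, h2' i a ha, add_mul, mul_add, smul_add]
    abel
  smul_mem' := by
    rintro c D ⟨h1, h2⟩
    refine ⟨fun i a ha => Submodule.smul_mem _ _ (h1 i a ha), fun i a ha b => ?_⟩
    simp only [LinearMap.smul_apply, h2 i a ha, smul_mul_assoc, mul_smul_comm, smul_add]
    rw [smul_comm]

variable {A}

theorem Der.one {k : ℤ} {D : A.carrier →ₗ[K] A.carrier} (hD : D ∈ A.Der k) : D 1 = 0 := by
  have := hD.2 0 1 SetLike.GradedOne.one_mem 1
  simpa [sg_zero] using this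

theorem bracket_mem {i j : ℤ} {D D' : A.carrier →ₗ[K] A.carrier} (hD : D ∈ A.Der i)
    (hD' : D' ∈ A.Der j) : D ∘ₗ D' - sg K (i * j) • (D' ∘ₗ D) ∈ A.Der (i + j) := by
  refine ⟨fun l a ha => ?_, fun l a ha b => ?_⟩
  · refine Submodule.sub_mem _ ?_ (Submodule.smul_mem _ _ ?_)
    · have := hD.1 _ _ (hD'.1 _ _ ha)
      rwa [show l + j + i = l + (i + j) by ring] at this
    · have := hD'.1 _ _ (hD.1 _ _ ha)
      rwa [add_assoc] at this
  · simp only [LinearMap.sub_apply, LinearMap.smul_apply, LinearMap.comp_apply]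
    rw [hD'.2 l a ha, hD.2 l a ha, map_add, map_add, map_smul, map_smul,
      hD.2 _ _ (hD'.1 _ _ ha), hD.2 l a ha, hD'.2 _ _ (hD.1 _ _ ha), hD'.2 l a ha]
    have e1 : sg K (i * (l + j)) = sg K (i * j) * sg K (i * l) := by
      rw [← sg_add]; exact sg_congr K ⟨0, by ring⟩
    have e2 : sg K (j * (l + i)) = sg K (i * j) * sg K (j * l) := by
      rw [← sg_add]; exact sg_congr K ⟨0, by ring⟩
    have e3 : sg K ((i + j) * l) = sg K (i * l) * sg K (j * l) := by
      rw [← sg_add]; exact sg_congr K ⟨0, by ring⟩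
    have e4 : sg K (i * j) * sg K (i * j) = 1 := by
      rw [← sg_add]; exact sg_even K ⟨i * j, by ring⟩
    have e5 : sg K (i * j) * (sg K (i * j) * sg K (j * l)) = sg K (j * l) := by
      rw [← mul_assoc, e4, one_mul]
    simp only [e1, e2, e3, sub_mul, mul_sub, smul_add, smul_sub, smul_mul_assoc, mul_smul_comm,
      smul_smul, e5]
    module

/-- The graded commutator `[D, D'] = D D' - (-1)^{|D||D'|} D' D`. -/
def bracket {i j : ℤ} (D : A.Der i) (D' : A.Der j) : A.Der (i + j) :=
  ⟨D.1 ∘ₗ D'.1 - sg K (i * j) • (D'.1 ∘ₗ D.1), bracket_mem D.2 D'.2⟩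

theorem act_mem {j k : ℤ} {a : A.carrier} (ha : a ∈ A.deg j) {D : A.carrier →ₗ[K] A.carrier}
    (hD : D ∈ A.Der k) : LinearMap.mulLeft K a ∘ₗ D ∈ A.Der (j + k) := by
  refine ⟨fun l b hb => ?_, fun l b hb c => ?_⟩
  · have := A.mul_mem ha (hD.1 l b hb)
    rwa [show j + (l + k) = l + (j + k) by ring] at this
  · simp only [LinearMap.comp_apply, LinearMap.mulLeft_apply]
    rw [hD.2 l b hb, mul_add, mul_smul_comm, ← mul_assoc, ← mul_assoc, A.comm j l a b ha hb,
      smul_mul_assoc, smul_smul, ← sg_add, ← mul_assoc, mul_assoc b, add_mul, add_comm (k * l)]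

/-- The action `(a D)(b) = a D(b)` of the algebra on its derivations. -/
def act {j k : ℤ} (a : A.deg j) (D : A.Der k) : A.Der (j + k) :=
  ⟨LinearMap.mulLeft K a.1 ∘ₗ D.1, act_mem a.2 D.2⟩

end GCA

/-- A commutative dg-algebra. -/
structure CDGA (K : Type u) [Field K] extends GCA.{u, w} K where
  d : toGCA.Der 1
  d_d : ∀ a, d.1 (d.1 a) = 0

namespace CDGA

variable {K : Type u} [Field K]

/-- A degree `1` derivation `α` with `∂α + ½[α,α] = 0`, where `∂D = [d, D]`. -/
structure MaurerCartan (A : CDGA.{u, w} K) where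
  α : A.Der 1
  mc : GCA.bracket A.d α + (1 / 2 : K) • GCA.bracket α α = 0

/-- The deformed algebra, with differential `d + α`. -/
def deform [CharZero K] (A : CDGA.{u, w} K) (α : A.MaurerCartan) : CDGA.{u, w} K where
  toGCA := A.toGCA
  d := A.d + α.α
  d_d a := by
    have h := congrArg (fun D : A.Der (1 + 1) => D.1 a) α.mc
    have h1 : sg K (1 * 1) = -1 := sg_odd K (by decide)
    simp only [GCA.bracket, Submodule.coe_add, Submodule.coe_smul, LinearMap.add_apply,
      LinearMap.sub_apply, LinearMap.smul_apply, LinearMap.comp_apply, h1, Submodule.coe_zero,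
      LinearMap.zero_apply, neg_smul, one_smul, sub_neg_eq_add, smul_add] at h
    rw [← add_smul, add_halves, one_smul] at h
    simp only [Submodule.coe_add, LinearMap.add_apply, map_add, A.d_d, zero_add]
    rw [← h]; abel

end CDGA

/-! ### Shifted polyvectors -/

/-- Homogeneous generators: functions `a` and shifted vector fields `s^{n+1} D`. -/
inductive PolGen {K : Type u} [Field K] (A : GCA.{u, w} K) : Type w
  | fn (j : ℤ) (a : A.deg j)
  | vf (k : ℤ) (D : A.Der k)

namespace PolGen

variable {K : Type u} [Field K] {A : GCA.{u, w} K}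

/-- The degree of `a` is `|a|`, that of `s^{n+1} D` is `|D| + n + 1`. -/
def dg (n : ℤ) : PolGen A → ℤ
  | fn j _ => j
  | vf k _ => k + (n + 1)

/-- The weight: the number of vector fields. -/
def wt : PolGen A → ℕ
  | fn _ _ => 0
  | vf _ _ => 1

end PolGen

/-- The relations of the relative symmetric algebra `Sym_A(T_A[-n-1])`: functions multiply as in
`A`, vector fields are linear, and `a · s^{n+1} D = (-1)^{|a|(n+1)} s^{n+1} (a D)`. -/
inductive PolRel {K : Type u} [Field K] (A : GCA.{u, w} K) (n : ℤ) :
    FreeAlgebra K (PolGen A) → FreeAlgebra K (PolGen A) → Prop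
  | fn_add (j : ℤ) (a b : A.deg j) :
      PolRel A n (FreeAlgebra.ι K (.fn j (a + b))) (FreeAlgebra.ι K (.fn j a) + FreeAlgebra.ι K (.fn j b))
  | fn_smul (j : ℤ) (c : K) (a : A.deg j) :
      PolRel A n (FreeAlgebra.ι K (.fn j (c • a))) (c • FreeAlgebra.ι K (.fn j a))
  | fn_one : PolRel A n (FreeAlgebra.ι K (.fn 0 ⟨1, SetLike.GradedOne.one_mem⟩)) 1
  | fn_mul (i j : ℤ) (a : A.deg i) (b : A.deg j) :
      PolRel A n (FreeAlgebra.ι K (.fn (i + j) ⟨a.1 * b.1, A.mul_mem a.2 b.2⟩))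
        (FreeAlgebra.ι K (.fn i a) * FreeAlgebra.ι K (.fn j b))
  | vf_add (k : ℤ) (D D' : A.Der k) :
      PolRel A n (FreeAlgebra.ι K (.vf k (D + D'))) (FreeAlgebra.ι K (.vf k D) + FreeAlgebra.ι K (.vf k D'))
  | vf_smul (k : ℤ) (c : K) (D : A.Der k) :
      PolRel A n (FreeAlgebra.ι K (.vf k (c • D))) (c • FreeAlgebra.ι K (.vf k D))
  | vf_act (j k : ℤ) (a : A.deg j) (D : A.Der k) :
      PolRel A n (FreeAlgebra.ι K (.vf (j + k) (GCA.act a D)))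
        (sg K (j * (n + 1)) • (FreeAlgebra.ι K (.fn j a) * FreeAlgebra.ι K (.vf k D)))

section Pol

variable {K : Type u} [Field K] (A : GCA.{u, w} K) (n : ℤ)

theorem freeDeg_ι' {X : Type w} (dg : X → ℤ) {i : ℤ} (x : X) (h : dg x = i) :
    FreeAlgebra.ι K x ∈ freeDeg K dg i := Submodule.subset_span ⟨[x], by simp [h], by simp⟩

theorem freeDeg_ι_mul {X : Type w} (dg : X → ℤ) {i : ℤ} (x y : X) (h : dg x + dg y = i) :
    FreeAlgebra.ι K x * FreeAlgebra.ι K y ∈ freeDeg K dg i :=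
  Submodule.subset_span ⟨[x, y], by simp [h], by simp⟩

/-- The presentation of the algebra of `n`-shifted polyvectors. -/
@[reducible]
def polPres : GradedPres.{u, w} K where
  Gen := PolGen A
  dg := PolGen.dg n
  rel := PolRel A n
  homog := by
    intro x y h
    cases h with
    | fn_add j a b =>
      exact ⟨j, freeDeg_ι' _ _ rfl,
        Submodule.add_mem _ (freeDeg_ι' _ _ rfl) (freeDeg_ι' _ _ rfl)⟩
    | fn_smul j c a =>
      exact ⟨j, freeDeg_ι' _ _ rfl, Submodule.smul_mem _ _ (freeDeg_ι' _ _ rfl)⟩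
    | fn_one => exact ⟨0, freeDeg_ι' _ _ rfl, Submodule.subset_span ⟨[], by simp⟩⟩
    | fn_mul i j a b => exact ⟨i + j, freeDeg_ι' _ _ rfl, freeDeg_ι_mul _ _ _ rfl⟩
    | vf_add k D D' =>
      exact ⟨k + (n + 1), freeDeg_ι' _ _ rfl,
        Submodule.add_mem _ (freeDeg_ι' _ _ rfl) (freeDeg_ι' _ _ rfl)⟩
    | vf_smul k c D =>
      exact ⟨k + (n + 1), freeDeg_ι' _ _ rfl, Submodule.smul_mem _ _ (freeDeg_ι' _ _ rfl)⟩
    | vf_act j k a D =>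
      exact ⟨j + k + (n + 1), freeDeg_ι' _ _ rfl,
        Submodule.smul_mem _ _ (freeDeg_ι_mul _ _ _ (by simp [PolGen.dg]; ring))⟩

/-- The `n`-shifted polyvectors `Sym_A(T_A[-n-1])`. -/
abbrev Pol : Type (max u w) := (polPres A n).Alg

end Pol

namespace Pol

variable {K : Type u} [Field K] {A : GCA.{u, w} K} {n : ℤ}

/-- The class of a function. -/
def fn (n : ℤ) {j : ℤ} (a : A.deg j) : Pol A n := (polPres A n).gen (.fn j a)

/-- The class of a shifted vector field `s^{n+1} D`. -/
def vf (n : ℤ) {k : ℤ} (D : A.Der k) : Pol A n := (polPres A n).gen (.vf k D)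

theorem fn_add {j : ℤ} (a b : A.deg j) : fn n (a + b) = fn n a + fn n b := by
  exact (GradedPres.mk_rel (P := polPres A n) (.of (PolRel.fn_add j a b))).trans
    (map_add (polPres A n).toAlg _ _)

theorem fn_smul {j : ℤ} (c : K) (a : A.deg j) : fn n (c • a) = c • fn n a := by
  exact (GradedPres.mk_rel (P := polPres A n) (.of (PolRel.fn_smul j c a))).trans
    (map_smul (polPres A n).toAlg _ _)

theorem fn_zero {j : ℤ} : fn n (0 : A.deg j) = 0 := by
  rw [← zero_smul K (0 : A.deg j), fn_smul, zero_smul]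

theorem fn_one : fn n (⟨1, SetLike.GradedOne.one_mem⟩ : A.deg 0) = 1 := by
  exact (GradedPres.mk_rel (P := polPres A n) (.of (PolRel.fn_one))).trans (map_one (polPres A n).toAlg)

theorem fn_mul {i j : ℤ} (a : A.deg i) (b : A.deg j) :
    fn n a * fn n b = fn n (⟨a.1 * b.1, A.mul_mem a.2 b.2⟩ : A.deg (i + j)) := by
  exact ((GradedPres.mk_rel (P := polPres A n) (.of (PolRel.fn_mul i j a b))).trans
    (map_mul (polPres A n).toAlg _ _)).symm

theorem vf_add {k : ℤ} (D D' : A.Der k) : vf n (D + D') = vf n D + vf n D' := by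
  exact (GradedPres.mk_rel (P := polPres A n) (.of (PolRel.vf_add k D D'))).trans
    (map_add (polPres A n).toAlg _ _)

theorem vf_smul {k : ℤ} (c : K) (D : A.Der k) : vf n (c • D) = c • vf n D := by
  exact (GradedPres.mk_rel (P := polPres A n) (.of (PolRel.vf_smul k c D))).trans
    (map_smul (polPres A n).toAlg _ _)

theorem vf_zero {k : ℤ} : vf n (0 : A.Der k) = 0 := by
  rw [← zero_smul K (0 : A.Der k), vf_smul, zero_smul]

theorem vf_act {j k : ℤ} (a : A.deg j) (D : A.Der k) :
    vf n (GCA.act a D) = sg K (j * (n + 1)) • (fn n a * vf n D) := by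
  exact (GradedPres.mk_rel (P := polPres A n) (.of (PolRel.vf_act j k a D))).trans
    ((map_smul (polPres A n).toAlg _ _).trans
      (congrArg _ (map_mul (polPres A n).toAlg _ _)))

theorem fn_congr {i j : ℤ} (h : i = j) {a : A.deg i} {b : A.deg j} (hab : a.1 = b.1) :
    fn n a = fn n b := by
  subst h
  rw [Subtype.ext hab]

theorem vf_congr {i j : ℤ} (h : i = j) {D : A.Der i} {D' : A.Der j} (hD : D.1 = D'.1) :
    vf n D = vf n D' := by
  subst h
  rw [Subtype.ext hD]

theorem fn_mem {j : ℤ} (a : A.deg j) : fn n a ∈ (polPres A n).degPart j :=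
  GradedPres.gen_mem (P := polPres A n) (.fn j a)

theorem vf_mem {k : ℤ} (D : A.Der k) : vf n D ∈ (polPres A n).degPart (k + (n + 1)) :=
  GradedPres.gen_mem (P := polPres A n) (.vf k D)

/-- Evaluation of a derivation on a homogeneous element. -/
def ev {j k : ℤ} (D : A.Der k) (a : A.deg j) : A.deg (j + k) := ⟨D.1 a.1, D.2.1 j a.1 a.2⟩

/-- The Schouten–Nijenhuis bracket of two generators, with all shifts removed:
`{s^{-n-1} g, s^{-n-1} h} = s^{-n-1} (genBracket n g h)`. -/
def genBracket (n : ℤ) : PolGen A → PolGen A → Pol A n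
  | .fn _ _, .fn _ _ => 0
  | .vf k D, .fn _ b => sg K (k * (n + 1)) • fn n (ev D b)
  | .fn i a, .vf k D => -(sg K (i * k) • fn n (ev D a))
  | .vf _ D, .vf _ D' => vf n (GCA.bracket D D')

end Pol

namespace Pol

variable {K : Type u} [Field K] {A : GCA.{u, w} K} {n : ℤ}

theorem mem_congr {M : Type*} [AddCommMonoid M] [Module K M] {S : ℤ → Submodule K M} {i j : ℤ}
    (h : i = j) {x : M} (hx : x ∈ S i) : x ∈ S j := h ▸ hx

theorem freeDer_rel (e : ℤ) (f : PolGen A → Pol A n)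
    (h1 : ∀ j a b, f (.fn j (a + b)) = f (.fn j a) + f (.fn j b))
    (h2 : ∀ j (c : K) a, f (.fn j (c • a)) = c • f (.fn j a))
    (h3 : f (.fn 0 ⟨1, SetLike.GradedOne.one_mem⟩) = 0)
    (h4 : ∀ i j (a : A.deg i) (b : A.deg j), f (.fn (i + j) ⟨a.1 * b.1, A.mul_mem a.2 b.2⟩) =
      sg K (e * i) • (fn n a * f (.fn j b)) + f (.fn i a) * fn n b)
    (h5 : ∀ k D D', f (.vf k (D + D')) = f (.vf k D) + f (.vf k D'))
    (h6 : ∀ k (c : K) D, f (.vf k (c • D)) = c • f (.vf k D))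
    (h7 : ∀ j k (a : A.deg j) (D : A.Der k), f (.vf (j + k) (GCA.act a D)) =
      sg K (j * (n + 1)) • (sg K (e * j) • (fn n a * f (.vf k D)) + f (.fn j a) * vf n D))
    (x y : FreeAlgebra K (PolGen A)) (h : PolRel A n x y) :
    (polPres A n).freeDer e f x = (polPres A n).freeDer e f y := by
  have hι := GradedPres.freeDer_ι (P := polPres A n) e f
  have hιι := GradedPres.freeDer_ι_mul_ι (P := polPres A n) e f
  have hadd := GradedPres.freeDer_add (P := polPres A n) e f
  have hsmul := GradedPres.freeDer_smul (P := polPres A n) e f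
  have hone := GradedPres.freeDer_one (P := polPres A n) e f
  cases h with
  | fn_add j a b =>
    refine (hι _).trans ((h1 j a b).trans ?_)
    refine Eq.symm ((hadd _ _).trans ?_)
    exact congrArg₂ (fun z z' => z + z') (hι _) (hι _)
  | fn_smul j c a =>
    refine (hι _).trans ((h2 j c a).trans ?_)
    refine Eq.symm ((hsmul c _).trans ?_)
    exact congrArg (fun z => c • z) (hι _)
  | fn_one => exact (hι _).trans (h3.trans hone.symm)
  | fn_mul i j a b => exact (hι _).trans ((h4 i j a b).trans (hιι (.fn i a) (.fn j b)).symm)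
  | vf_add k D D' =>
    refine (hι _).trans ((h5 k D D').trans ?_)
    refine Eq.symm ((hadd _ _).trans ?_)
    exact congrArg₂ (fun z z' => z + z') (hι _) (hι _)
  | vf_smul k c D =>
    refine (hι _).trans ((h6 k c D).trans ?_)
    refine Eq.symm ((hsmul c _).trans ?_)
    exact congrArg (fun z => c • z) (hι _)
  | vf_act j k a D =>
    refine (hι _).trans ((h7 j k a D).trans ?_)
    refine Eq.symm ((hsmul (sg K (j * (n + 1))) _).trans ?_)
    exact congrArg (fun z => sg K (j * (n + 1)) • z)
      (hιι (.fn j a) (.vf k D))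

theorem mul_comm' {i j : ℤ} {a b : Pol A n} (ha : a ∈ (polPres A n).degPart i)
    (hb : b ∈ (polPres A n).degPart j) : a * b = sg K (i * j) • (b * a) :=
  GradedPres.mul_comm' ha hb

theorem genBracket_mem (g h : PolGen A) : genBracket n g h ∈
    (polPres A n).degPart (PolGen.dg n h + (PolGen.dg n g - (n + 1))) := by
  match g, h with
  | .fn i a, .fn j b => exact Submodule.zero_mem _
  | .vf k D, .fn j b =>
    refine Submodule.smul_mem _ _ ?_
    exact mem_congr (S := (polPres A n).degPart) (by simp [PolGen.dg]) (fn_mem (n := n) (ev D b))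
  | .fn i a, .vf k D =>
    refine Submodule.neg_mem _ (Submodule.smul_mem _ _ ?_)
    exact mem_congr (S := (polPres A n).degPart) (by simp [PolGen.dg]; ring)
      (fn_mem (n := n) (ev D a))
  | .vf k D, .vf k' D' =>
    exact mem_congr (S := (polPres A n).degPart) (by simp [PolGen.dg]; ring)
      (vf_mem (n := n) (GCA.bracket D D'))

theorem bracket_act (i j k : ℤ) (D : A.Der i) (a : A.deg j) (D' : A.Der k) :
    vf n (GCA.bracket D (GCA.act a D')) =
      sg K ((j + i) * (n + 1)) • (fn n (ev D a) * vf n D') +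
        sg K (i * j + j * (n + 1)) • (fn n a * vf n (GCA.bracket D D')) := by
  have e : vf n (GCA.bracket D (GCA.act a D')) =
      vf n ((⟨(GCA.act (ev D a) D').1, mem_congr (S := A.Der) (by ring) (GCA.act (ev D a) D').2⟩ : A.Der (i + (j + k))) +
        sg K (i * j) • ⟨(GCA.act a (GCA.bracket D D')).1, mem_congr (S := A.Der) (by ring) (GCA.act a (GCA.bracket D D')).2⟩) := by
    congr 1
    ext b
    have h := D.2.2 j a.1 a.2 (D'.1 b)
    simp only [GCA.bracket, GCA.act, ev, LinearMap.sub_apply, LinearMap.comp_apply,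
      LinearMap.mulLeft_apply, LinearMap.smul_apply, Submodule.coe_add, Submodule.coe_smul,
      LinearMap.add_apply, h, mul_sub, smul_sub, mul_smul_comm, smul_smul]
    rw [show sg K (i * (j + k)) = sg K (i * j) * sg K (i * k) by rw [← sg_add, mul_add]]
    abel
  rw [e, vf_add, vf_smul, sg_add K (i * j), mul_smul, ← vf_act, ← vf_act]
  congr 1
  · exact vf_congr (by ring) rfl
  · exact congrArg _ (vf_congr (by ring) rfl)

/-- The data of the derivation `{s^{-n-1} g, ·}` for a generator `g`. -/
def adData (n : ℤ) (g : PolGen A) : (polPres A n).DerData (PolGen.dg n g - (n + 1)) where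
  f := genBracket n g
  f_mem := genBracket_mem g
  f_rel := by
    apply freeDer_rel
    · intro j a b
      cases g with
      | fn i c => exact (add_zero 0).symm
      | vf k D =>
        simp only [genBracket]
        rw [← smul_add, ← fn_add]
        congr 2
        exact Subtype.ext (map_add D.1 _ _)
    · intro j c a
      cases g with
      | fn i c => exact (smul_zero _).symm
      | vf k D =>
        simp only [genBracket]
        rw [smul_comm, ← fn_smul c]
        congr 2
        exact Subtype.ext (map_smul D.1 c a.1)
    · cases g with
      | fn i c => rfl
      | vf k D =>
        simp only [genBracket]
        rw [show ev D ⟨1, SetLike.GradedOne.one_mem⟩ = 0 from Subtype.ext (GCA.Der.one D.2),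
          fn_zero, smul_zero]
    · intro i j a b
      cases g with
      | fn l c => simp [genBracket]
      | vf k D =>
        simp only [genBracket, mul_smul_comm, smul_mul_assoc, fn_mul]
        rw [show PolGen.dg n (.vf k D) - (n + 1) = k by simp [PolGen.dg], smul_comm, ← smul_add]
        refine congrArg _ ?_
        rw [add_comm (sg K _ • _), fn_congr (a := (⟨(ev D a).1 * b.1, A.mul_mem (ev D a).2 b.2⟩ :
            A.deg (i + k + j))) (b := (⟨(ev D a).1 * b.1, mem_congr (S := A.deg) (by ring)
              (A.mul_mem (ev D a).2 b.2)⟩ : A.deg (i + (j + k)))) (by ring) rfl,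
          ← fn_smul, ← fn_add]
        exact fn_congr (a := ev D ⟨a.1 * b.1, A.mul_mem a.2 b.2⟩) (add_assoc i j k) (D.2.2 i a.1 a.2 b.1)
    · intro k D D'
      cases g with
      | fn i a =>
        simp only [genBracket]
        rw [← neg_add, ← smul_add, ← fn_add]
        rfl
      | vf i D₀ =>
        simp only [genBracket]
        rw [← vf_add]
        congr 1
        ext b
        simp only [GCA.bracket, LinearMap.sub_apply, LinearMap.comp_apply, map_add,
          LinearMap.smul_apply, Submodule.coe_add, LinearMap.add_apply, smul_add]
        abel
    · intro k c D
      cases g with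
      | fn i a =>
        simp only [genBracket]
        rw [smul_neg, smul_comm c, ← fn_smul c]
        rfl
      | vf i D₀ =>
        simp only [genBracket]
        rw [← vf_smul]
        congr 1
        ext b
        simp only [GCA.bracket, LinearMap.sub_apply, LinearMap.comp_apply, map_smul,
          LinearMap.smul_apply, Submodule.coe_smul, smul_sub]
        rw [smul_comm]
    · intro j k b D
      cases g with
      | fn i a =>
        simp only [genBracket, zero_mul, add_zero, PolGen.dg]
        rw [mul_neg, mul_smul_comm, fn_mul, smul_neg, smul_neg, smul_smul, smul_smul, ← sg_add,
          ← sg_add]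
        rw [sg_congr K (a := i * (j + k)) (b := j * (n + 1) + (i - (n + 1)) * j + i * k)
          ⟨0, by ring⟩]
        congr 2
        exact fn_congr (by ring) rfl
      | vf i D₀ =>
        simp only [genBracket]
        rw [bracket_act, show PolGen.dg n (.vf i D₀) - (n + 1) = i by simp [PolGen.dg],
          smul_mul_assoc, smul_add, smul_smul, smul_smul, ← sg_add, ← sg_add, add_comm]
        congr 2
        · exact sg_congr K ⟨0, by ring⟩
        · exact sg_congr K ⟨0, by ring⟩

/-- The derivation `{s^{-n-1} g, ·}`, of degree `|g| - n - 1`, for a generator `g`. -/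
noncomputable def ad (n : ℤ) (g : PolGen A) : Pol A n →ₗ[K] Pol A n := (adData n g).der

theorem ad_one (g : PolGen A) : ad n g 1 = 0 := (adData n g).der_one

theorem ad_gen (g h : PolGen A) : ad n g ((polPres A n).gen h) = genBracket n g h :=
  (adData n g).der_gen h

theorem ad_fn (g : PolGen A) {j : ℤ} (a : A.deg j) : ad n g (fn n a) = genBracket n g (.fn j a) :=
  ad_gen g _

theorem ad_vf (g : PolGen A) {k : ℤ} (D : A.Der k) : ad n g (vf n D) = genBracket n g (.vf k D) :=
  ad_gen g _

theorem ad_gen_mul (g x : PolGen A) (a : Pol A n) :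
    ad n g ((polPres A n).gen x * a) = ad n g ((polPres A n).gen x) * a +
      sg K ((PolGen.dg n g - (n + 1)) * PolGen.dg n x) • ((polPres A n).gen x * ad n g a) :=
  (adData n g).der_mul (GradedPres.gen_mem (P := polPres A n) x) a

theorem ad_mem (g : PolGen A) {i : ℤ} {a : Pol A n} (ha : a ∈ (polPres A n).degPart i) :
    ad n g a ∈ (polPres A n).degPart (i + (PolGen.dg n g - (n + 1))) :=
  (adData n g).der_mem ha

/-- Two expressions with the Leibniz rule of degree `e` that agree on generators are equal. -/
theorem lin_ext {e : ℤ} {D D' : Pol A n →ₗ[K] Pol A n} (h1 : D 1 = 0) (h1' : D' 1 = 0)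
    (hm : ∀ (x : PolGen A) a, D ((polPres A n).gen x * a) = D ((polPres A n).gen x) * a +
      sg K (e * PolGen.dg n x) • ((polPres A n).gen x * D a))
    (hm' : ∀ (x : PolGen A) a, D' ((polPres A n).gen x * a) = D' ((polPres A n).gen x) * a +
      sg K (e * PolGen.dg n x) • ((polPres A n).gen x * D' a))
    (h : ∀ x : PolGen A, D ((polPres A n).gen x) = D' ((polPres A n).gen x)) (a : Pol A n) :
    D a = D' a :=
  GradedPres.der_ext (P := polPres A n) (e := e) D.isLinear D'.isLinear h1 h1' hm hm' h a

theorem ad_add {g g₁ g₂ : PolGen A} (h₁ : PolGen.dg n g₁ = PolGen.dg n g)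
    (h₂ : PolGen.dg n g₂ = PolGen.dg n g)
    (h : ∀ x, genBracket n g x = genBracket n g₁ x + genBracket n g₂ x) (a : Pol A n) :
    ad n g a = ad n g₁ a + ad n g₂ a := by
  refine lin_ext (D' := ad n g₁ + ad n g₂) (e := PolGen.dg n g - (n + 1)) (ad_one g)
    (by simp [ad_one]) (ad_gen_mul g) ?_ ?_ a
  · intro x a
    simp only [LinearMap.add_apply, ad_gen_mul, h₁, h₂, add_mul, mul_add, smul_add]
    abel
  · intro x
    simp only [LinearMap.add_apply, ad_gen, h]

theorem ad_smul {g g₁ : PolGen A} (c : K) (h₁ : PolGen.dg n g₁ = PolGen.dg n g)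
    (h : ∀ x, genBracket n g x = c • genBracket n g₁ x) (a : Pol A n) :
    ad n g a = c • ad n g₁ a := by
  refine lin_ext (D' := c • ad n g₁) (e := PolGen.dg n g - (n + 1)) (ad_one g)
    (by simp [ad_one]) (ad_gen_mul g) ?_ ?_ a
  · intro x a
    simp only [LinearMap.smul_apply, ad_gen_mul, h₁, smul_mul_assoc, mul_smul_comm, smul_add]
    rw [smul_comm]
  · intro x
    simp only [LinearMap.smul_apply, ad_gen, h]

theorem ad_mul {g g₁ g₂ : PolGen A} (c : K) (hg : PolGen.dg n g = PolGen.dg n g₁ + PolGen.dg n g₂)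
    (h : ∀ x, genBracket n g x = c • ((polPres A n).gen g₁ * genBracket n g₂ x +
      sg K (PolGen.dg n g₁ * PolGen.dg n g₂) • ((polPres A n).gen g₂ * genBracket n g₁ x)))
    (a : Pol A n) :
    ad n g a = c • ((polPres A n).gen g₁ * ad n g₂ a +
      sg K (PolGen.dg n g₁ * PolGen.dg n g₂) • ((polPres A n).gen g₂ * ad n g₁ a)) := by
  refine lin_ext (D' := c • (LinearMap.mulLeft K ((polPres A n).gen g₁) ∘ₗ ad n g₂ +
      sg K (PolGen.dg n g₁ * PolGen.dg n g₂) •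
        (LinearMap.mulLeft K ((polPres A n).gen g₂) ∘ₗ ad n g₁)))
    (e := PolGen.dg n g - (n + 1)) (ad_one g) (by simp [ad_one]) (ad_gen_mul g) ?_ ?_ a
  · intro x a
    have c1 : ∀ b : Pol A n, (polPres A n).gen g₁ * ((polPres A n).gen x * b) =
        sg K (PolGen.dg n g₁ * PolGen.dg n x) •
          ((polPres A n).gen x * ((polPres A n).gen g₁ * b)) := by
      intro b
      rw [← mul_assoc, GradedPres.gen_mul_gen, smul_mul_assoc, mul_assoc]
    have c2 : ∀ b : Pol A n, (polPres A n).gen g₂ * ((polPres A n).gen x * b) =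
        sg K (PolGen.dg n g₂ * PolGen.dg n x) •
          ((polPres A n).gen x * ((polPres A n).gen g₂ * b)) := by
      intro b
      rw [← mul_assoc, GradedPres.gen_mul_gen, smul_mul_assoc, mul_assoc]
    simp only [LinearMap.smul_apply, LinearMap.add_apply, LinearMap.comp_apply,
      LinearMap.mulLeft_apply, ad_gen_mul, mul_add, add_mul, smul_mul_assoc, mul_smul_comm,
      smul_add, c1, c2, mul_assoc, smul_smul, ← sg_add]
    rw [sg_congr K (a := (PolGen.dg n g₂ - (n + 1)) * PolGen.dg n x +
        PolGen.dg n g₁ * PolGen.dg n x) (b := (PolGen.dg n g - (n + 1)) * PolGen.dg n x)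
        ⟨0, by rw [hg]; ring⟩,
      sg_congr K (a := PolGen.dg n g₁ * PolGen.dg n g₂ +
        ((PolGen.dg n g₁ - (n + 1)) * PolGen.dg n x + PolGen.dg n g₂ * PolGen.dg n x))
        (b := (PolGen.dg n g - (n + 1)) * PolGen.dg n x + PolGen.dg n g₁ * PolGen.dg n g₂)
        ⟨0, by rw [hg]; ring⟩]
    simp only [sg_add]
    module
  · intro x
    simp only [LinearMap.smul_apply, LinearMap.add_apply, LinearMap.comp_apply,
      LinearMap.mulLeft_apply, ad_gen, h]

theorem ad_one_gen (a : Pol A n) : ad n (.fn 0 ⟨1, SetLike.GradedOne.one_mem⟩ : PolGen A) a = 0 := by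
  refine lin_ext (D' := 0) (e := PolGen.dg n (.fn 0 ⟨1, SetLike.GradedOne.one_mem⟩ : PolGen A)
    - (n + 1)) (ad_one _) rfl (ad_gen_mul _) (by intro x a; simp) ?_ a
  intro x
  rw [ad_gen]
  cases x with
  | fn i c => rfl
  | vf k D =>
    simp only [genBracket]
    rw [show ev D ⟨1, SetLike.GradedOne.one_mem⟩ = 0 from Subtype.ext (GCA.Der.one D.2),
      fn_zero, smul_zero, neg_zero]
    rfl

end Pol

namespace Pol

variable {K : Type u} [Field K] {A : GCA.{u, w} K} {n : ℤ}

theorem sch_rel (g g₁ g₂ : PolGen A) (c : K) (hg : PolGen.dg n g = PolGen.dg n g₁ + PolGen.dg n g₂)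
    (h : ∀ x, genBracket n g x = c • ((polPres A n).gen g₁ * genBracket n g₂ x +
      sg K (PolGen.dg n g₁ * PolGen.dg n g₂) • ((polPres A n).gen g₂ * genBracket n g₁ x)))
    {p : ℤ} {P : Pol A n} (hP : P ∈ (polPres A n).degPart p) :
    -(sg K ((p - (n + 1)) * (PolGen.dg n g - (n + 1))) • ad n g P) =
      c • (sg K ((p - (n + 1)) * PolGen.dg n g₁) • ((polPres A n).gen g₁ *
        -(sg K ((p - (n + 1)) * (PolGen.dg n g₂ - (n + 1))) • ad n g₂ P)) +
        -(sg K ((p - (n + 1)) * (PolGen.dg n g₁ - (n + 1))) • ad n g₁ P) *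
          (polPres A n).gen g₂) := by
  rw [ad_mul c hg h, neg_mul, smul_mul_assoc,
    mul_comm' (ad_mem g₁ hP) (GradedPres.gen_mem (P := polPres A n) g₂)]
  simp only [mul_neg, mul_smul_comm, smul_smul, smul_add, smul_neg, ← sg_add]
  rw [sg_congr K (a := (p - (n + 1)) * PolGen.dg n g₁ + (p - (n + 1)) * (PolGen.dg n g₂ - (n + 1)))
      (b := (p - (n + 1)) * (PolGen.dg n g - (n + 1))) ⟨0, by rw [hg]; ring⟩,
    sg_congr K (a := (p - (n + 1)) * (PolGen.dg n g₁ - (n + 1)) +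
        (p + (PolGen.dg n g₁ - (n + 1))) * PolGen.dg n g₂)
      (b := (p - (n + 1)) * (PolGen.dg n g - (n + 1)) + PolGen.dg n g₁ * PolGen.dg n g₂)
      ⟨0, by rw [hg]; ring⟩]
  simp only [sg_add]
  module

/-- The data of the derivation `{s^{-n-1} P, ·}` for homogeneous `P`; its values on generators are
fixed by antisymmetry, `{P, h} = -(-1)^{(|P|-n-1)(|h|-n-1)} {h, P}`. -/
noncomputable def schData {p : ℤ} (P : (polPres A n).degPart p) :
    (polPres A n).DerData (p - (n + 1)) where
  f h := -(sg K ((p - (n + 1)) * (PolGen.dg n h - (n + 1))) • ad n h P.1)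
  f_mem h := by
    refine Submodule.neg_mem _ (Submodule.smul_mem _ _ ?_)
    exact mem_congr (S := (polPres A n).degPart) (by ring) (ad_mem h P.2)
  f_rel := by
    apply freeDer_rel
    · intro j a b
      rw [ad_add (g := .fn j (a + b)) (g₁ := .fn j a) (g₂ := .fn j b) rfl rfl, smul_add, neg_add]
      · rfl
      · intro x
        cases x with
        | fn i c => exact (add_zero 0).symm
        | vf k D =>
          simp only [genBracket]
          rw [← neg_add, ← smul_add, ← fn_add]
          congr 3
          exact Subtype.ext (map_add D.1 a.1 b.1)
    · intro j c a
      rw [ad_smul (g := .fn j (c • a)) (g₁ := .fn j a) c rfl, smul_neg, smul_comm]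
      · rfl
      · intro x
        cases x with
        | fn i c => exact (smul_zero _).symm
        | vf k D =>
          simp only [genBracket]
          rw [smul_neg, smul_comm c, ← fn_smul c]
          congr 3
          exact Subtype.ext (map_smul D.1 c a.1)
    · rw [ad_one_gen, smul_zero, neg_zero]
    · intro i j a b
      have := sch_rel (n := n) (.fn (i + j) ⟨a.1 * b.1, A.mul_mem a.2 b.2⟩) (.fn i a) (.fn j b) 1 rfl
        (by
          intro x
          cases x with
          | fn l c => simp [genBracket]
          | vf k D =>
            simp only [genBracket, PolGen.dg]
            change _ = (1 : K) • (fn n a * -(sg K (j * k) • fn n (ev D b)) +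
              sg K (i * j) • (fn n b * -(sg K (i * k) • fn n (ev D a))))
            rw [mul_neg, mul_neg, mul_smul_comm, mul_smul_comm, mul_comm' (fn_mem b) (fn_mem (ev D a)),
              fn_mul, fn_mul, fn_congr (a := ev D ⟨a.1 * b.1, A.mul_mem a.2 b.2⟩)
                (b := (⟨(ev D a).1 * b.1, mem_congr (S := A.deg) (by ring)
                    (A.mul_mem (ev D a).2 b.2)⟩ : A.deg (i + (j + k))) +
                  sg K (k * i) • (⟨a.1 * (ev D b).1, A.mul_mem a.2 (ev D b).2⟩ :
                    A.deg (i + (j + k)))) (add_assoc i j k) (D.2.2 i a.1 a.2 b.1),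
              fn_add, fn_smul,
              fn_congr (a := (⟨(ev D a).1 * b.1, mem_congr (S := A.deg) (by ring)
                    (A.mul_mem (ev D a).2 b.2)⟩ : A.deg (i + (j + k))))
                  (b := (⟨(ev D a).1 * b.1, A.mul_mem (ev D a).2 b.2⟩ : A.deg (i + k + j)))
                  (by ring) rfl]
            simp only [smul_add, smul_neg, smul_smul, ← sg_add]
            rw [sg_congr K (a := i * j + (i * k + j * (i + k))) (b := (i + j) * k)
                ⟨i * j, by ring⟩,
              sg_congr K (a := (i + j) * k + k * i) (b := j * k) ⟨k * i, by ring⟩]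
            module)
        P.2
      rw [one_smul] at this
      exact this
    · intro k D D'
      rw [ad_add (g := .vf k (D + D')) (g₁ := .vf k D) (g₂ := .vf k D') rfl rfl, smul_add, neg_add]
      · rfl
      · intro x
        cases x with
        | fn i c =>
          simp only [genBracket]
          rw [← smul_add, ← fn_add]
          rfl
        | vf i D₀ =>
          simp only [genBracket]
          rw [← vf_add]
          congr 1
          ext b
          simp only [GCA.bracket, LinearMap.sub_apply, LinearMap.comp_apply, map_add,
            LinearMap.smul_apply, Submodule.coe_add, LinearMap.add_apply, smul_add]
          abel
    · intro k c D
      rw [ad_smul (g := .vf k (c • D)) (g₁ := .vf k D) c rfl, smul_neg, smul_comm]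
      · rfl
      · intro x
        cases x with
        | fn i a =>
          simp only [genBracket]
          rw [smul_comm c, ← fn_smul c]
          rfl
        | vf i D₀ =>
          simp only [genBracket]
          rw [← vf_smul]
          congr 1
          ext b
          simp only [GCA.bracket, LinearMap.sub_apply, LinearMap.comp_apply, map_smul,
            LinearMap.smul_apply, Submodule.coe_smul, smul_sub]
          rw [smul_comm]
    · intro j k a D
      exact sch_rel (n := n) (.vf (j + k) (GCA.act a D)) (.fn j a) (.vf k D) (sg K (j * (n + 1)))
        (by simp only [PolGen.dg]; ring)
        (by
          intro x
          cases x with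
          | fn i b =>
            simp only [genBracket, PolGen.dg]
            change _ = sg K (j * (n + 1)) • (fn n a * (sg K (k * (n + 1)) • fn n (ev D b)) +
              sg K (j * (k + (n + 1))) • (vf n D * 0))
            rw [mul_zero, smul_zero, add_zero, mul_smul_comm, fn_mul, smul_smul, ← sg_add,
              ← add_mul]
            congr 1
            exact fn_congr (by ring) rfl
          | vf i D' =>
            simp only [genBracket, PolGen.dg]
            change _ = sg K (j * (n + 1)) • (fn n a * vf n (GCA.bracket D D') +
              sg K (j * (k + (n + 1))) • (vf n D * -(sg K (j * i) • fn n (ev D' a))))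
            rw [mul_neg, mul_smul_comm, mul_comm' (vf_mem D) (fn_mem (ev D' a))]
            have e : vf n (GCA.bracket (GCA.act a D) D') =
                vf n ((⟨(GCA.act a (GCA.bracket D D')).1, mem_congr (S := A.Der) (by ring)
                  (GCA.act a (GCA.bracket D D')).2⟩ : A.Der (j + k + i)) +
                  (-sg K ((j + k) * i)) • ⟨(GCA.act (ev D' a) D).1, mem_congr (S := A.Der) (by ring)
                    (GCA.act (ev D' a) D).2⟩) := by
              congr 1
              ext b
              have h := D'.2.2 j a.1 a.2 (D.1 b)
              simp only [GCA.bracket, GCA.act, ev, LinearMap.sub_apply, LinearMap.comp_apply,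
                LinearMap.mulLeft_apply, LinearMap.smul_apply, Submodule.coe_add,
                LinearMap.add_apply, neg_smul, LinearMap.neg_apply,
                Submodule.coe_smul, h, mul_sub, smul_add, mul_smul_comm, smul_smul, ← sg_add]
              rw [sg_congr K (a := (j + k) * i + i * j) (b := k * i) ⟨i * j, by ring⟩]
              abel
            have e1 : vf n (⟨(GCA.act a (GCA.bracket D D')).1, mem_congr (S := A.Der) (by ring)
                (GCA.act a (GCA.bracket D D')).2⟩ : A.Der (j + k + i)) =
                vf n (GCA.act a (GCA.bracket D D')) := vf_congr (by ring) rfl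
            have e2 : vf n (⟨(GCA.act (ev D' a) D).1, mem_congr (S := A.Der) (by ring)
                (GCA.act (ev D' a) D).2⟩ : A.Der (j + k + i)) = vf n (GCA.act (ev D' a) D) :=
              vf_congr (by ring) rfl
            rw [e, vf_add, vf_smul, e1, e2, vf_act, vf_act]
            simp only [smul_add, smul_neg, smul_smul, neg_mul, ← sg_add, neg_smul]
            congr 3
            exact sg_congr K ⟨-(j * k + j * (n + 1)), by ring⟩)
        P.2

/-- The Schouten–Nijenhuis bracket with all shifts removed:
`{s^{-n-1} P, s^{-n-1} Q} = s^{-n-1} (schouten P Q)`, for homogeneous `P`. It is the biderivation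
given on generators by `genBracket`. -/
noncomputable def schouten {p : ℤ} (P : (polPres A n).degPart p) : Pol A n →ₗ[K] Pol A n :=
  (schData P).der

end Pol

namespace Pol

variable {K : Type u} [Field K]

section Weight

variable (A : GCA.{u, w} K) (n : ℤ)

/-- The polyvectors of weight `m`, i.e. `Sym^m_A(T_A[-n-1])`. -/
def weight (m : ℕ) : Submodule K (Pol A n) :=
  Submodule.span K {P | ∃ l : List (PolGen A), (l.map PolGen.wt).sum = m ∧
    P = (l.map (polPres A n).gen).prod}

/-- The polyvectors of weight `m` and degree `i`. -/
def piece (m : ℕ) (i : ℤ) : Submodule K (Pol A n) :=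
  Submodule.span K {P | ∃ l : List (PolGen A), (l.map PolGen.wt).sum = m ∧
    (l.map (PolGen.dg n)).sum = i ∧ P = (l.map (polPres A n).gen).prod}

theorem piece_le_weight (m : ℕ) (i : ℤ) : piece A n m i ≤ weight A n m := by
  refine Submodule.span_mono ?_
  rintro _ ⟨l, hm, _, rfl⟩
  exact ⟨l, hm, rfl⟩

theorem piece_le_degPart (m : ℕ) (i : ℤ) : piece A n m i ≤ (polPres A n).degPart i := by
  refine Submodule.span_le.2 ?_
  rintro _ ⟨l, _, rfl, rfl⟩
  refine ⟨(l.map (FreeAlgebra.ι K)).prod, Submodule.subset_span ⟨l, rfl, rfl⟩, ?_⟩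
  change (polPres A n).toAlg _ = _
  rw [map_list_prod, List.map_map]
  rfl

end Weight

section Bracket

variable {A : GCA.{u, w} K} {n : ℤ}

theorem schouten_gen {p : ℤ} (P : (polPres A n).degPart p) (h : PolGen A) :
    schouten P ((polPres A n).gen h) =
      -(sg K ((p - (n + 1)) * (PolGen.dg n h - (n + 1))) • ad n h P.1) :=
  (schData P).der_gen h

/-- The derivation property in the second argument. -/
theorem schouten_mul {p i : ℤ} (P : (polPres A n).degPart p) {Q : Pol A n}
    (hQ : Q ∈ (polPres A n).degPart i) (R : Pol A n) :
    schouten P (Q * R) =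
      schouten P Q * R + sg K ((p - (n + 1)) * i) • (Q * schouten P R) :=
  (schData P).der_mul hQ R

/-- On generators the bracket is the one prescribed. -/
theorem schouten_gen_gen (g h : PolGen A) :
    schouten ⟨(polPres A n).gen g, GradedPres.gen_mem (P := polPres A n) g⟩
      ((polPres A n).gen h) = genBracket n g h := by
  rw [schouten_gen, ad_gen]
  cases g with
  | fn i a =>
    cases h with
    | fn j b => simp [genBracket]
    | vf k D =>
      simp only [genBracket, PolGen.dg, smul_smul, ← sg_add]
      rw [sg_congr K ⟨0, by ring⟩ (b := i * k + 2 * 0)]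
      · simp
  | vf k D =>
    cases h with
    | fn j b =>
      simp only [genBracket, PolGen.dg, smul_neg, smul_smul, ← sg_add, neg_neg]
      rw [sg_congr K (b := k * (n + 1)) ⟨k * j - k * (n + 1), by ring⟩]
    | vf k' D' =>
      simp only [genBracket, PolGen.dg]
      rw [← neg_smul, ← vf_smul]
      refine vf_congr (add_comm _ _) ?_
      ext b
      simp only [GCA.bracket, Submodule.coe_smul, LinearMap.smul_apply, LinearMap.sub_apply,
        LinearMap.comp_apply, smul_sub, smul_smul, neg_mul, ← sg_add, neg_smul]
      rw [sg_congr K (a := (k + (n + 1) - (n + 1)) * (k' + (n + 1) - (n + 1)) + k' * k) (b := 0)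
          ⟨k * k', by ring⟩, sg_zero,
        sg_congr K (a := (k + (n + 1) - (n + 1)) * (k' + (n + 1) - (n + 1))) (b := k * k')
          ⟨0, by ring⟩]
      simp only [LinearMap.neg_apply, LinearMap.smul_apply, LinearMap.comp_apply]
      module

end Bracket

section Differential

variable (A : CDGA.{u, w} K) (n : ℤ)

/-- The differential of the polyvectors: the derivation of degree `1` with `∂a = da` and
`∂(s^{n+1} D) = (-1)^{n+1} s^{n+1} [d, D]`. -/
noncomputable def polD : Pol A.toGCA n →ₗ[K] Pol A.toGCA n := sg K (n + 1) • ad n (.vf 1 A.d)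

theorem polD_fn {j : ℤ} (a : A.deg j) : polD A n (fn n a) = fn n (ev A.d a) := by
  rw [polD, LinearMap.smul_apply, ad_fn]
  simp only [genBracket, smul_smul, ← sg_add]
  rw [sg_even K ⟨n + 1, by ring⟩, one_smul]

theorem polD_vf {k : ℤ} (D : A.Der k) :
    polD A n (vf n D) = sg K (n + 1) • vf n (GCA.bracket A.d D) := by
  rw [polD, LinearMap.smul_apply, ad_vf]
  rfl

theorem polD_mul {i : ℤ} {Q : Pol A.toGCA n} (hQ : Q ∈ (polPres A.toGCA n).degPart i)
    (R : Pol A.toGCA n) : polD A n (Q * R) = polD A n Q * R + sg K i • (Q * polD A n R) := by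
  have h := (adData n (PolGen.vf 1 A.d)).der_mul hQ R
  rw [sg_congr K (b := i) ⟨0, by simp only [PolGen.dg]; ring⟩] at h
  simp only [polD, LinearMap.smul_apply]
  rw [ad, h, smul_add, smul_mul_assoc, mul_smul_comm, smul_comm]

end Differential

end Pol

/-! ### Shifted Poisson structures -/

/-- An `n`-shifted Poisson structure: a formal sum `π = ∑_{m ≥ 2} π^{(m)}` of polyvectors `π^{(m)}` of
weight `m` and degree `n + 2` with `∂(s^{-n-1}π) + ½ {s^{-n-1}π, s^{-n-1}π} = 0`, where
`∂(s^{-n-1}π) = (-1)^{n+1} s^{-n-1} ∂π`. The field `mc` is the part of weight `m` of this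
equation. -/
structure ShiftedPoisson {K : Type u} [Field K] (A : CDGA.{u, w} K) (n : ℤ) where
  π : ∀ m : ℕ, Pol.piece A.toGCA n m (n + 2)
  π_zero : π 0 = 0
  π_one : π 1 = 0
  mc : ∀ m : ℕ, sg K (n + 1) • Pol.polD A n (π m).1 +
    (1 / 2 : K) • ∑ kl ∈ Finset.HasAntidiagonal.antidiagonal (m + 1),
      Pol.schouten ⟨(π kl.1).1, Pol.piece_le_degPart A.toGCA n _ _ (π kl.1).2⟩ (π kl.2).1 = 0

/-! ### Free commutative dg-algebras -/

section Sym

variable {K : Type u} [Field K]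

/-- Linearity of the generators. -/
inductive SymRel (V : CochainComplex (ModuleCat.{w} K) ℤ) :
    FreeAlgebra K (Σ i : ℤ, V.X i) → FreeAlgebra K (Σ i : ℤ, V.X i) → Prop
  | add (i : ℤ) (v v' : V.X i) : SymRel V (FreeAlgebra.ι K ⟨i, v + v'⟩)
      (FreeAlgebra.ι K ⟨i, v⟩ + FreeAlgebra.ι K ⟨i, v'⟩)
  | smul (i : ℤ) (c : K) (v : V.X i) : SymRel V (FreeAlgebra.ι K ⟨i, c • v⟩)
      (c • FreeAlgebra.ι K ⟨i, v⟩)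

variable (V : CochainComplex (ModuleCat.{w} K) ℤ)

/-- The presentation of `Sym(V)`. -/
@[reducible]
def symPres : GradedPres.{u, w} K where
  Gen := Σ i : ℤ, V.X i
  dg x := x.1
  rel := SymRel V
  homog := by
    intro x y h
    cases h with
    | add i v v' => exact ⟨i, freeDeg_ι' _ _ rfl,
        Submodule.add_mem _ (freeDeg_ι' _ _ rfl) (freeDeg_ι' _ _ rfl)⟩
    | smul i c v => exact ⟨i, freeDeg_ι' _ _ rfl, Submodule.smul_mem _ _ (freeDeg_ι' _ _ rfl)⟩

/-- The inclusion of the generators in `Sym(V)`. -/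
def symGen {i : ℤ} (v : V.X i) : (symPres V).Alg := (symPres V).gen ⟨i, v⟩

variable {V}

theorem symGen_add {i : ℤ} (v v' : V.X i) : symGen V (v + v') = symGen V v + symGen V v' := by
  exact (GradedPres.mk_rel (P := symPres V) (.of (SymRel.add i v v'))).trans
    (map_add (symPres V).toAlg _ _)

theorem symGen_smul {i : ℤ} (c : K) (v : V.X i) : symGen V (c • v) = c • symGen V v := by
  exact (GradedPres.mk_rel (P := symPres V) (.of (SymRel.smul i c v))).trans
    (map_smul (symPres V).toAlg _ _)

theorem symGen_mem {i : ℤ} (v : V.X i) : symGen V v ∈ (symPres V).degPart i :=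
  GradedPres.gen_mem (P := symPres V) ⟨i, v⟩

theorem symGen_zero {i : ℤ} : symGen V (0 : V.X i) = 0 := by
  rw [← zero_smul K (0 : V.X i), symGen_smul, zero_smul]

/-- A derivation of `Sym(V)` from a homogeneous linear map `V → Sym(V)`. -/
def symDerData (e : ℤ) (f : ∀ i, V.X i →ₗ[K] (symPres V).Alg)
    (hf : ∀ i v, f i v ∈ (symPres V).degPart (i + e)) : (symPres V).DerData e where
  f x := f x.1 x.2
  f_mem x := hf x.1 x.2
  f_rel := by
    intro x y h
    cases h with
    | add i v v' =>
      refine (GradedPres.freeDer_ι (P := symPres V) _ _ _).trans ((map_add (f i) v v').trans ?_)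
      refine Eq.symm ((GradedPres.freeDer_add (P := symPres V) _ _ _ _).trans ?_)
      exact congrArg₂ (fun z z' => z + z') (GradedPres.freeDer_ι (P := symPres V) _ _ _)
        (GradedPres.freeDer_ι (P := symPres V) _ _ _)
    | smul i c v =>
      refine (GradedPres.freeDer_ι (P := symPres V) _ _ _).trans ((map_smul (f i) c v).trans ?_)
      refine Eq.symm ((GradedPres.freeDer_smul (P := symPres V) _ _ _ _).trans ?_)
      exact congrArg (fun z => c • z) (GradedPres.freeDer_ι (P := symPres V) _ _ _)

variable (V)

/-- The data of the differential of `Sym(V)`. -/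
def symDData : (symPres V).DerData 1 :=
  symDerData 1
    (fun i =>
      { toFun := fun v => symGen V ((V.d i (i + 1)).hom v)
        map_add' := fun v v' => by rw [map_add, symGen_add]
        map_smul' := fun c v => by rw [map_smul, symGen_smul]; rfl })
    (fun _ _ => symGen_mem _)

/-- The free commutative dg-algebra `Sym(V)` on a cochain complex `V`. -/
noncomputable def symCDGA : CDGA.{u, max u w} K where
  carrier := (symPres V).Alg
  deg := (symPres V).degPart
  comm _ _ _ _ ha hb := GradedPres.mul_comm' ha hb
  d := ⟨(symDData V).der, fun _ _ ha => (symDData V).der_mem ha,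
    fun i _ ha b => by rw [(symDData V).der_mul ha b]⟩
  d_d a := by
    have hd : ∀ (x : (symPres V).Gen) (a : (symPres V).Alg),
        (symDData V).der ((symPres V).gen x * a) = (symDData V).der ((symPres V).gen x) * a +
          sg K (1 * x.1) • ((symPres V).gen x * (symDData V).der a) :=
      fun x a => (symDData V).der_mul (GradedPres.gen_mem (P := symPres V) x) a
    have hg : ∀ x : (symPres V).Gen, (symDData V).der ((symPres V).gen x) =
        symGen V ((V.d x.1 (x.1 + 1)).hom x.2) := fun x => (symDData V).der_gen x
    change (symDData V).der ((symDData V).der a) = 0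
    induction a using GradedPres.ind with
    | one => rw [(symDData V).der_one, map_zero]
    | gen_mul x a ih =>
      rw [hd, map_add, map_smul, hd, ih, mul_zero, smul_zero, add_zero, hg, symGen, hd, hg, symGen]
      rw [show (V.d (x.1 + 1) (x.1 + 1 + 1)).hom ((V.d x.1 (x.1 + 1)).hom x.2) = 0 from
        congrArg (fun f => f.hom x.2) (V.d_comp_d x.1 (x.1 + 1) (x.1 + 1 + 1)),
        show (symPres V).gen ⟨x.1 + 1 + 1, 0⟩ = 0 from symGen_zero, zero_mul, zero_add,
        ← add_smul, mul_add, sg_add, sg_odd K (a := 1 * 1) (by decide)]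
      simp
    | add a b ha hb => rw [map_add, map_add, ha, hb, add_zero]
    | smul c a ha => rw [map_smul, map_smul, ha, smul_zero]

end Sym

/-! ### The dual complex and the constant derivations -/

section Dual

variable {K : Type u} [Field K]

/-- The dual complex: degree `i` is the dual of degree `-i`, and `dθ = -(-1)^{|θ|} θ ∘ d`. -/
def dualComplex (g : CochainComplex (ModuleCat.{v} K) ℤ) :
    CochainComplex (ModuleCat.{max u v} K) ℤ where
  X i := ModuleCat.of K (Module.Dual K (g.X (-i)))
  d i j := ModuleCat.ofHom (-(sg K i) • (g.d (-j) (-i)).hom.dualMap)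
  shape i j h := by
    rw [g.shape (-j) (-i) (by
      simp only [ComplexShape.up_Rel] at h ⊢
      omega)]
    ext θ y
    simp
  d_comp_d' i j k _ _ := by
    ext θ y
    have h : (g.d (-j) (-i)).hom ((g.d (-k) (-j)).hom y) = 0 :=
      congrArg (fun f => f.hom y) (g.d_comp_d (-k) (-j) (-i))
    simp [LinearMap.dualMap_apply, h]

/-- The complex `g*[-1]`. -/
abbrev shiftedDual (g : CochainComplex (ModuleCat.{v} K) ℤ) :
    CochainComplex (ModuleCat.{max u v} K) ℤ :=
  (CochainComplex.shiftFunctor (ModuleCat.{max u v} K) (-1)).obj (dualComplex g)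

/-- The free commutative dg-algebra `Sym(g*[-1])`. -/
noncomputable abbrev symDual (g : CochainComplex (ModuleCat.{v} K) ℤ) : CDGA.{u, max u v} K :=
  symCDGA (shiftedDual g)

/-- The total space of a complex. -/
abbrev Tot (g : CochainComplex (ModuleCat.{v} K) ℤ) : Type v := DirectSum ℤ fun i => g.X i

variable (g : CochainComplex (ModuleCat.{v} K) ℤ)

/-- The element `sθ` of `g*[-1]` as a functional `θ` on the total space of `g`. -/
noncomputable def functional {i : ℤ} (θ : (shiftedDual g).X i) : Tot g →ₗ[K] K :=
  (show Module.Dual K (g.X (-(i + -1))) from θ) ∘ₗ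
    DirectSum.component K ℤ (fun i => g.X i) (-(i + -1))

/-- The data of the derivation `∂_x` of `Sym(g*[-1])`. -/
noncomputable def constDerData {j : ℤ} (x : g.X j) :
    (symPres (shiftedDual g)).DerData (j - 1) := symDerData (j - 1)
    (fun i =>
      { toFun := fun θ => algebraMap K _ (functional g θ (DirectSum.lof K ℤ (fun i => g.X i) j x))
        map_add' := fun θ θ' => by
          rw [← map_add]
          rfl
        map_smul' := fun c θ => by
          rw [RingHom.id_apply, Algebra.smul_def, ← map_mul]
          rfl })
    (fun i θ => by
      change algebraMap K _ (functional g θ (DirectSum.lof K ℤ (fun i => g.X i) j x)) ∈ _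
      by_cases h : i + (j - 1) = 0
      · rw [h, Algebra.algebraMap_eq_smul_one]
        exact Submodule.smul_mem _ _ GradedPres.one_mem
      · have h0 : functional g θ (DirectSum.lof K ℤ (fun i => g.X i) j x) = 0 := by
          rw [functional, LinearMap.comp_apply, DirectSum.component.of, dif_neg (by omega), map_zero]
        rw [h0, map_zero]
        exact Submodule.zero_mem _)

/-- The derivation `∂_x` of `Sym(g*[-1])`, of degree `|x| - 1`, with `∂_x(sθ) = ⟨θ, x⟩`. -/
noncomputable def constDer {j : ℤ} (x : g.X j) : (symDual g).Der (j - 1) :=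
  ⟨(constDerData g x).der, fun _ _ ha => (constDerData g x).der_mem ha,
    fun _ _ ha b => (constDerData g x).der_mul ha b⟩

theorem constDer_gen {j i : ℤ} (x : g.X j) (θ : (shiftedDual g).X i) :
    (constDer g x).1 (symGen (shiftedDual g) θ) =
      algebraMap K (symPres (shiftedDual g)).Alg
        (functional g θ (DirectSum.lof K ℤ (fun i => g.X i) j x)) :=
  (constDerData g x).der_gen ⟨i, θ⟩

end Dual

/-! ### Tensor powers of a complex and maps between them -/

section Hom

variable {K : Type u} [Field K] (g : CochainComplex (ModuleCat.{v} K) ℤ)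

/-- The inclusion of a homogeneous element into the total space. -/
abbrev inc {i : ℤ} (x : g.X i) : Tot g := DirectSum.lof K ℤ (fun i => g.X i) i x

/-- The differential on the total space. -/
noncomputable def totD : Tot g →ₗ[K] Tot g :=
  DirectSum.toModule K ℤ (Tot g) fun i =>
    DirectSum.lof K ℤ (fun i => g.X i) (i + 1) ∘ₗ (g.d i (i + 1)).hom

/-- The map `x ↦ (-1)^{k|x|} x`. -/
noncomputable def totTwist (k : ℤ) : Tot g →ₗ[K] Tot g :=
  DirectSum.toModule K ℤ (Tot g) fun i => sg K (k * i) • DirectSum.lof K ℤ (fun i => g.X i) i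

/-- The projections onto the even part (`ε = 0`) and the odd part (`ε = 1`). -/
noncomputable def parityProj (ε : Fin 2) : Tot g →ₗ[K] Tot g :=
  DirectSum.toModule K ℤ (Tot g) fun i =>
    if i % 2 = (ε.val : ℤ) then DirectSum.lof K ℤ (fun i => g.X i) i else 0

/-- The `l`-fold tensor power of the total space. -/
abbrev TP (l : ℕ) : Type (max u v) := TensorPower K l (Tot g)

/-- The tensors of total degree `i`. -/
def tensorDeg (l : ℕ) (i : ℤ) : Submodule K (TP g l) :=
  Submodule.span K {t | ∃ (c : Fin l → ℤ) (y : ∀ j, g.X (c j)), ∑ j, c j = i ∧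
    t = PiTensorProduct.tprod K fun j => inc g (y j)}

/-- The differential `∑ₖ ± y₁ ⊗ ⋯ ⊗ dyₖ ⊗ ⋯ ⊗ y_l` with the sign `(-1)^{|y₁| + ⋯ + |yₖ₋₁|}`. -/
noncomputable def tensorD (l : ℕ) : TP g l →ₗ[K] TP g l :=
  ∑ k : Fin l, PiTensorProduct.map fun j : Fin l =>
    if j < k then totTwist g 1 else if j = k then totD g else LinearMap.id

/-- The exponent of the Koszul sign of `y₁ ⋯ y_l ↦ y_{σ(1)} ⋯ y_{σ(l)}`, with `c j = |y_j|`. -/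
def koszulExp {l : ℕ} (σ : Equiv.Perm (Fin l)) (c : Fin l → ℤ) : ℤ :=
  ∑ i, ∑ j, if i < j ∧ σ j < σ i then c (σ i) * c (σ j) else 0

/-- The symmetric braiding `y₁ ⊗ ⋯ ⊗ y_l ↦ ± y_{σ(1)} ⊗ ⋯ ⊗ y_{σ(l)}` with the Koszul sign. -/
noncomputable def braid {l : ℕ} (σ : Equiv.Perm (Fin l)) : TP g l →ₗ[K] TP g l :=
  ∑ ε : Fin l → Fin 2, sg K (koszulExp σ fun j => ((ε j).val : ℤ)) •
    ((PiTensorProduct.reindex K (fun _ => Tot g) σ.symm).toLinearMap ∘ₗ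
      PiTensorProduct.map fun j => parityProj g (ε j))

theorem parityProj_inc (ε : Fin 2) {i : ℤ} (x : g.X i) :
    parityProj g ε (inc g x) = if i % 2 = (ε.val : ℤ) then inc g x else 0 := by
  rw [parityProj, inc, DirectSum.toModule_lof]
  split_ifs <;> rfl

theorem braid_tprod {l : ℕ} (σ : Equiv.Perm (Fin l)) (c : Fin l → ℤ) (y : ∀ j, g.X (c j)) :
    braid g σ (PiTensorProduct.tprod K fun j => inc g (y j)) =
      sg K (koszulExp σ c) • PiTensorProduct.tprod K fun j => inc g (y (σ j)) := by
  have hc : ∀ j, (c j % 2).toNat < 2 := fun j => by omega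
  rw [braid, LinearMap.sum_apply, Finset.sum_eq_single fun j => (⟨(c j % 2).toNat, hc j⟩ : Fin 2)]
  · rw [LinearMap.smul_apply, LinearMap.comp_apply, PiTensorProduct.map_tprod]
    have h1 : ∀ j, parityProj g ⟨(c j % 2).toNat, hc j⟩ (inc g (y j)) = inc g (y j) := by
      intro j
      rw [parityProj_inc, if_pos]
      change c j % 2 = ((c j % 2).toNat : ℤ)
      omega
    simp only [h1]
    congr 1
    · refine sg_congr K ?_
      rw [koszulExp, koszulExp, ← Finset.sum_sub_distrib]
      refine Finset.even_sum _ fun i _ => ?_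
      rw [← Finset.sum_sub_distrib]
      refine Finset.even_sum _ fun j _ => ?_
      split_ifs
      · have e1 : ∀ j, (((c j % 2).toNat : ℕ) : ℤ) = c j % 2 := fun j => by omega
        simp only [e1]
        rw [Int.even_iff, Int.sub_emod, ← Int.mul_emod, sub_self, Int.zero_emod]
      · simp
    · exact PiTensorProduct.reindex_tprod _ _
  · intro ε _ hε
    have : ∃ j, c j % 2 ≠ ((ε j).val : ℤ) := by
      by_contra! h
      apply hε
      funext j
      apply Fin.ext
      have := h j
      change (ε j).val = (c j % 2).toNat
      omega
    obtain ⟨j, hj⟩ := this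
    rw [LinearMap.smul_apply, LinearMap.comp_apply, PiTensorProduct.map_tprod,
      (PiTensorProduct.tprod K).map_coord_zero j, map_zero, smul_zero]
    rw [parityProj_inc, if_neg hj]
  · intro h
    exact absurd (Finset.mem_univ _) h

/-- The sign `(-1)^{|ρ| n}` of a permutation. -/
def permSign (K : Type u) [Field K] {l : ℕ} (n : ℤ) (ρ : Equiv.Perm (Fin l)) : K :=
  (((Equiv.Perm.sign ρ ^ n : ℤˣ) : ℤ) : K)

/-- The maps `g^{⊗l} → g^{⊗m}` whose input is totally antisymmetric and whose output is totally
symmetric for `n` even and totally antisymmetric for `n` odd. -/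
def homPM (n : ℤ) (l m : ℕ) : Submodule K (TP g l →ₗ[K] TP g m) where
  carrier := {L | (∀ σ, L ∘ₗ braid g σ = permSign K 1 σ • L) ∧
    ∀ ρ, braid g ρ ∘ₗ L = permSign K n ρ • L}
  zero_mem' := ⟨fun σ => by simp, fun ρ => by simp⟩
  add_mem' := by
    rintro L L' ⟨h1, h2⟩ ⟨h1', h2'⟩
    refine ⟨fun σ => ?_, fun ρ => ?_⟩
    · rw [LinearMap.add_comp, h1, h1', smul_add]
    · rw [LinearMap.comp_add, h2, h2', smul_add]
  smul_mem' := by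
    rintro c L ⟨h1, h2⟩
    refine ⟨fun σ => ?_, fun ρ => ?_⟩
    · rw [LinearMap.smul_comp, h1, smul_comm]
    · rw [LinearMap.comp_smul, h2, smul_comm]

variable {g}

/-- The map `L` has degree `k`. -/
def HasDegree {l m : ℕ} (L : TP g l →ₗ[K] TP g m) (k : ℤ) : Prop :=
  ∀ i, ∀ t ∈ tensorDeg g l i, L t ∈ tensorDeg g m (i + k)

/-- The differential `∂L = d ∘ L - (-1)^k L ∘ d` of a map of degree `k`. -/
noncomputable def homD {l m : ℕ} (k : ℤ) (L : TP g l →ₗ[K] TP g m) : TP g l →ₗ[K] TP g m :=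
  tensorD g m ∘ₗ L - sg K k • (L ∘ₗ tensorD g l)

/-- The composite
`(L ⊗ id) ∘ (id^{⊗a} ⊗ L') : g^{⊗a} ⊗ g^{⊗b} → g^{⊗(a+1)} ⊗ g^{⊗q} → g^{⊗(p+1)} ⊗ g^{⊗q}`
for `L'` of degree `k`; the first output of `L'` becomes the last input of `L`. By the Koszul rule,
`(id^{⊗a} ⊗ L')(y ⊗ z) = (-1)^{k|y|} y ⊗ L'(z)`. -/
noncomputable def graft {a b p q : ℕ} (k : ℤ) (L : TP g (a + 1) →ₗ[K] TP g (p + 1))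
    (L' : TP g b →ₗ[K] TP g (q + 1)) : TP g (a + b) →ₗ[K] TP g (p + 1 + q) :=
  (TensorPower.mulEquiv (R := K) (M := Tot g) (n := p + 1) (m := q)).toLinearMap ∘ₗ
    TensorProduct.map L LinearMap.id ∘ₗ
    (TensorPower.mulEquiv (R := K) (M := Tot g) (n := a + 1) (m := q)).symm.toLinearMap ∘ₗ
    (TensorPower.cast K (Tot g) (show a + (q + 1) = a + 1 + q by omega)).toLinearMap ∘ₗ
    (TensorPower.mulEquiv (R := K) (M := Tot g) (n := a) (m := q + 1)).toLinearMap ∘ₗ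
    TensorProduct.map (PiTensorProduct.map fun _ => totTwist g k) L' ∘ₗ
    (TensorPower.mulEquiv (R := K) (M := Tot g) (n := a) (m := b)).symm.toLinearMap

/-- The `(a, b)`-shuffles: permutations that are increasing on the first `a` and on the last `b`
elements. -/
def shuffles (a b : ℕ) : Finset (Equiv.Perm (Fin (a + b))) :=
  {σ | (∀ i j : Fin a, i < j → σ (Fin.castAdd b i) < σ (Fin.castAdd b j)) ∧
    ∀ i j : Fin b, i < j → σ (Fin.natAdd a i) < σ (Fin.natAdd a j)}

/-- The sum `∑_{σ,ρ} (-1)^{|σ|} (-1)^{|ρ|n} γ_ρ ∘ (L ⊗ id) ∘ (id ⊗ L') ∘ γ_σ` over shuffles. Here `γ_σ`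
sends `y₁ ⊗ ⋯` to `± y_{σ(1)} ⊗ ⋯`, and `γ_ρ` moves the `k`-th tensor factor to position `ρ(k)`. -/
noncomputable def shuffleComp (n : ℤ) {a b p q : ℕ} (k : ℤ) (L : TP g (a + 1) →ₗ[K] TP g (p + 1))
    (L' : TP g b →ₗ[K] TP g (q + 1)) : TP g (a + b) →ₗ[K] TP g (p + 1 + q) :=
  ∑ σ ∈ shuffles a b, ∑ ρ ∈ shuffles (p + 1) q, (permSign K 1 σ * permSign K n ρ) •
    (braid g ρ⁻¹ ∘ₗ graft k L L' ∘ₗ braid g σ)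

/-- Transport of a map along equalities of the numbers of tensor factors. -/
noncomputable def castHom {l l' m m' : ℕ} (hl : l = l') (hm : m = m')
    (L : TP g l →ₗ[K] TP g m) : TP g l' →ₗ[K] TP g m' :=
  (TensorPower.cast K (Tot g) hm).toLinearMap ∘ₗ L ∘ₗ
    (TensorPower.cast K (Tot g) hl).symm.toLinearMap

/-- The degree `(1 - m) n + 2 - l` of the map `π^{(m,l)}`. -/
def mapDeg (n : ℤ) (m l : ℕ) : ℤ := (1 - (m : ℤ)) * n + 2 - l

/-- The sign `(-1)^{((1-m₁)n+2-l₁)((m₂-1)n+l₂-1)} (-1)^{n(m₂-1)(l₁-1)}`. -/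
def quadSign (K : Type u) [Field K] (n : ℤ) (m₁ l₁ m₂ l₂ : ℕ) : K :=
  sg K (((1 - (m₁ : ℤ)) * n + 2 - l₁) * (((m₂ : ℤ) - 1) * n + l₂ - 1)) *
    sg K (n * ((m₂ : ℤ) - 1) * ((l₁ : ℤ) - 1))

variable (g)

/-- A family of maps `π^{(m,l)}`, `m ≥ 1`, `l ≥ 0`, subject to the quadratic identities; `map p l` is
`π^{(p+1,l)}`. In `identity`, the weights are `m = r + 1`, `m₁ = p + 1`, `m₂ = q + 1` with `p + q = r`,
and `l₁ = a + 1`, `l₂ = b` with `a + b = l`. -/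
structure GraphFamily (n : ℤ) where
  map : ∀ p l : ℕ, TP g l →ₗ[K] TP g (p + 1)
  symm : ∀ p l, map p l ∈ homPM g n l (p + 1)
  degree : ∀ p l : ℕ, HasDegree (map p l) (mapDeg n (p + 1) l)
  bounded : ∀ p, ∃ N : ℕ, ∀ l, N < l → map p l = 0
  identity : ∀ r l : ℕ,
    sg K ((((r + 1 : ℕ) : ℤ) - 1) * n + l - 1) • homD (mapDeg n (r + 1) l) (map r l) +
      (∑ pq ∈ (Finset.HasAntidiagonal.antidiagonal r).attach,
        ∑ ab ∈ (Finset.HasAntidiagonal.antidiagonal l).attach,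
          quadSign K n (pq.1.1 + 1) (ab.1.1 + 1) (pq.1.2 + 1) ab.1.2 •
            castHom (Finset.HasAntidiagonal.mem_antidiagonal.1 ab.2)
              (show pq.1.1 + 1 + pq.1.2 = r + 1 by
                have := Finset.HasAntidiagonal.mem_antidiagonal.1 pq.2
                omega)
              (shuffleComp n (mapDeg n (pq.1.2 + 1) ab.1.2) (map pq.1.1 (ab.1.1 + 1))
                (map pq.1.2 ab.1.2))) = 0

end Hom

/-! ### The transfer from polyvectors to maps -/

section Transfer

variable {K : Type u} [Field K] (g : CochainComplex (ModuleCat.{v} K) ℤ) (n : ℤ)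

/-- The generator `sθ` as a homogeneous element of `Sym(g*[-1])`. -/
noncomputable def dualGen {i : ℤ} (θ : (shiftedDual g).X i) : (symDual g).deg i :=
  ⟨symGen (shiftedDual g) θ, symGen_mem θ⟩

/-- The polyvector `s^n x₁ ⋯ s^n x_m sθ₁ ⋯ sθ_l`, where `s^n x = s^{n+1} ∂_x`. -/
noncomputable def monomial {m l : ℕ} {a : Fin m → ℤ} {b : Fin l → ℤ} (x : ∀ k, g.X (a k))
    (θ : ∀ j, (shiftedDual g).X (b j)) : Pol (symDual g).toGCA n :=
  (List.ofFn fun k => Pol.vf n (constDer g (x k))).prod *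
    (List.ofFn fun j => Pol.fn n (dualGen g (θ j))).prod

theorem monomial_mem {m l : ℕ} {a : Fin m → ℤ} {b : Fin l → ℤ} (x : ∀ k, g.X (a k))
    (θ : ∀ j, (shiftedDual g).X (b j)) :
    monomial g n x θ ∈ Pol.weight (symDual g).toGCA n m := by
  refine Submodule.subset_span ⟨List.ofFn (fun k => PolGen.vf (a k - 1) (constDer g (x k))) ++
    List.ofFn (fun j => PolGen.fn (b j) (dualGen g (θ j))), ?_, ?_⟩
  · simp [List.map_ofFn, Function.comp_def, PolGen.wt]
  · rw [List.map_append, List.prod_append, List.map_ofFn, List.map_ofFn]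
    rfl

/-- `Ψ` is the transfer isomorphism: it sends `s^n x₁ ⋯ s^n x_m sθ₁ ⋯ sθ_l` to the map
`L : g^{⊗l} → g^{⊗m}` which takes homogeneous `y₁, …, y_l` to
`(-1)^{∑ₖ |xₖ|((m-k)n+l)} (-1)^{∑ⱼ |θⱼ|(l-j)} ∑_{σ,ρ} ε₁ ε₂ ε₃ ⊗ₖ x_{ρ(k)} ∏ⱼ ⟨θ_{σ(j)}, yⱼ⟩`; here
`ε₁` is the Koszul sign of `x₁ ⋯ x_m ↦ x_{ρ(1)} ⋯ x_{ρ(m)}` times `(-1)^{|ρ|n}`, `ε₂` the Koszul sign of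
`θ₁ ⋯ θ_l ↦ θ_{σ(1)} ⋯ θ_{σ(l)}` times `(-1)^{|σ|}`, and `ε₃` the Koszul sign of the reversal of
`y₁ ⋯ y_l`. These monomials span, so that there is at most one such `Ψ`. -/
def IsTransfer (Ψ : ∀ m : ℕ, Pol.weight (symDual g).toGCA n m ≃ₗ[K]
    DirectSum ℕ fun l => homPM g n l m) : Prop :=
  ∀ (m l : ℕ) (a : Fin m → ℤ) (b : Fin l → ℤ) (x : ∀ k, g.X (a k))
    (θ : ∀ j, (shiftedDual g).X (b j)),
    (∀ l', l' ≠ l → Ψ m ⟨monomial g n x θ, monomial_mem g n x θ⟩ l' = 0) ∧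
    ∀ (c : Fin l → ℤ) (y : ∀ j, g.X (c j)),
      (Ψ m ⟨monomial g n x θ, monomial_mem g n x θ⟩ l).1
          (PiTensorProduct.tprod K fun j => inc g (y j)) =
        (sg K (∑ k, a k * (((m : ℤ) - (((k : ℕ) : ℤ) + 1)) * n + l)) *
          sg K (∑ j, (b j - 1) * ((l : ℤ) - (((j : ℕ) : ℤ) + 1)))) •
        ∑ σ : Equiv.Perm (Fin l), ∑ ρ : Equiv.Perm (Fin m),
          ((permSign K n ρ * sg K (koszulExp ρ a)) *
            (permSign K 1 σ * sg K (koszulExp σ fun j => b j - 1)) *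
            sg K (koszulExp Fin.revPerm c) *
            ∏ j, functional g (θ (σ j)) (inc g (y j))) •
          PiTensorProduct.tprod K fun k => inc g (x (ρ k))

end Transfer

/-! ### The combined datum -/

section Datum

variable {K : Type u} [Field K] [CharZero K] (g : CochainComplex (ModuleCat.{v} K) ℤ) (n : ℤ)

/-- A semi-free deformation of `Sym(g*[-1])` together with an `n`-shifted Poisson structure on the
deformed algebra. -/
structure SemiFreePoisson where
  α : (symDual g).MaurerCartan
  π : ShiftedPoisson ((symDual g).deform α) n

variable {g n}

/-- The part of weight `m` of the formal sum `s^{n+1}α + π`. -/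
noncomputable def SemiFreePoisson.total (c : SemiFreePoisson g n) :
    ∀ m : ℕ, Pol.weight (symDual g).toGCA n m
  | 1 => ⟨Pol.vf n c.α.α, Submodule.subset_span ⟨[.vf 1 c.α.α], by simp [PolGen.wt], by
      rw [List.map_singleton, List.prod_singleton]
      rfl⟩⟩
  | m => ⟨(c.π.π m).1, Pol.piece_le_weight ((symDual g).deform c.α).toGCA n m (n + 2)
      (c.π.π m).2⟩

end Datum

/-! ### Signs of permutations -/

section Parity

/-! The complex has a finite homogeneous basis x_i, of degrees d_i, with dual basis θ_i. Hence
Pol(A, n) is generated by the coordinates e_i = sθ_i of degree 1 - d_i and f_i = s^n x_i of degree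
d_i + n. Up to sign, bracketing with e_i and with f_i gives the derivations E_i = ∂/∂f_i and F_i =
∂/∂e_i, which commute up to Koszul signs. The coefficient of a polyvector P at index tuples H, J is
the augmentation of E_H F_J P, and the transfer is, in matrix entries, this coefficient times the
explicit sign `trExp`.

Transfer. The coefficients of a monomial are computed by Wick's formula (`GCA.wick`): a signed sum
over all complete pairings, which is the sum over σ and ρ in the statement. The sign `trExp` is the
one that makes the formula come out (`monomial_sign`). By décalage (`koszulExp_shift`) it also turns
Koszul signs for the shifted degrees d + n and d - 1 into the symmetries required of the maps. The
inverse pairs the matrix entries with monomials and divides by m! l!, whence characteristic 0. It is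
a two-sided inverse because monomials span; their independence is a consequence and is not
presupposed.

Equation. For P, Q of degree n + 2 the bracket is P∘Q + Q∘P, where P∘Q = ∑ ± (F_i P)(E_i Q) is a
single contraction (`schouten_eq_add`), so that half of the bracket of π with itself is the sum of
the compositions of its components. In a coefficient of P∘Q the Leibniz rule distributes F_J and E_H
over the two factors. Such distributions are shuffles: the weight of P fixes how many E's it
receives, and the number of F's it receives runs over the splittings of l. The contracted index i
becomes the last input of the map of P and the first output of the map of Q, which gives C
(`toMap_comp`). The internal differential commutes with the E's and F's up to its own matrix entries
and dies under the augmentation, which gives the linear term (`toMap_polD`).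

Assembly. Collect α and π into the single sum s^{n+1}α + π. The weight one part of its Maurer–Cartan
equation is the equation for α (`mcSum_one`). The other parts are the equation for π over A_α, since
deforming the differential adds the bracket with α (`mcSum_of_ne_one`). A polyvector of given weight
is determined by its maps (`weight_ext`), so the Maurer–Cartan equation and the quadratic identities
are equivalent. Conversely a family comes from polyvectors, because finitely many maps in each
weight make a finite sum, and weight one elements of degree n + 2 are derivations
(`exists_vf_of_mem_piece`).

Every sign identity is reduced to one between exponents in `ZMod 2`, where squares equal their
roots. -/

theorem sg_eq_of_zmod (K : Type u) [Field K] {a b : ℤ} (h : (a : ZMod 2) = (b : ZMod 2)) :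
    sg K a = sg K b := by
  refine sg_congr K ?_
  rw [← ZMod.intCast_eq_zero_iff_even, Int.cast_sub, h, sub_self]

theorem sg_mul_self (K : Type u) [Field K] (a : ℤ) : sg K a * sg K a = 1 := by
  rw [← sg_add]
  exact sg_even K ⟨a, rfl⟩

theorem zmod_two_mul_self (a : ZMod 2) : a * a = a := by
  revert a; decide

/-- The sum of the products `c i * c j` over all pairs `i < j`. -/
def pairSum {l : ℕ} (c : Fin l → ℤ) : ℤ := ∑ i, ∑ j, if i < j then c i * c j else 0

/-- The sum of the entries weighted with their positions. -/
def posSum {l : ℕ} (c : Fin l → ℤ) : ℤ := ∑ k : Fin l, ((k : ℕ) : ℤ) * c k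

/-- Square the sum and group the terms by i < j, i = j and i > j. Permutation invariance and the
rules for concatenation, shift and update of `pairSum` all follow from this closed form by
cancelling the factor 2. -/
theorem two_mul_pairSum {l : ℕ} (c : Fin l → ℤ) :
    2 * pairSum c = (∑ i, c i) * (∑ i, c i) - ∑ i, c i * c i := by
  have h : pairSum c + pairSum c + ∑ i, c i * c i = (∑ i, c i) * ∑ i, c i := by
    conv_lhs => enter [1, 2]; rw [pairSum, Finset.sum_comm]
    rw [pairSum, Finset.sum_mul_sum, ← Finset.sum_add_distrib, ← Finset.sum_add_distrib]
    refine Finset.sum_congr rfl fun i _ => ?_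
    have : c i * c i = ∑ j, if i = j then c i * c j else 0 := by simp
    rw [this, ← Finset.sum_add_distrib, ← Finset.sum_add_distrib]
    refine Finset.sum_congr rfl fun j _ => ?_
    rcases lt_trichotomy i j with h | rfl | h
    · simp [h, h.not_gt, h.ne]
    · simp
    · simp [h, h.not_gt, h.ne', mul_comm]
  linarith

theorem pairSum_perm {l : ℕ} (σ : Equiv.Perm (Fin l)) (c : Fin l → ℤ) :
    pairSum (c ∘ σ) = pairSum c := by
  have h1 := two_mul_pairSum (c ∘ σ)
  have h2 := two_mul_pairSum c
  have e1 : ∑ i, (c ∘ σ) i = ∑ i, c i := Equiv.sum_comp σ c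
  have e2 : ∑ i, (c ∘ σ) i * (c ∘ σ) i = ∑ i, c i * c i := Equiv.sum_comp σ fun i => c i * c i
  rw [e1, e2] at h1
  linarith

theorem pairSum_append {a b : ℕ} (c : Fin a → ℤ) (c' : Fin b → ℤ) :
    pairSum (Fin.append c c') = pairSum c + pairSum c' + (∑ i, c i) * ∑ i, c' i := by
  have h1 := two_mul_pairSum (Fin.append c c')
  have h2 := two_mul_pairSum c
  have h3 := two_mul_pairSum c'
  simp only [Fin.sum_univ_add, Fin.append_left, Fin.append_right] at h1
  linarith

theorem pairSum_cons {a : ℕ} (x : ℤ) (c : Fin a → ℤ) :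
    pairSum (Fin.cons x c : Fin (a + 1) → ℤ) = pairSum c + x * ∑ i, c i := by
  have h1 := two_mul_pairSum (Fin.cons x c : Fin (a + 1) → ℤ)
  have h2 := two_mul_pairSum c
  simp only [Fin.sum_univ_succ, Fin.cons_zero, Fin.cons_succ] at h1
  linarith

theorem posSum_append {a b : ℕ} (c : Fin a → ℤ) (c' : Fin b → ℤ) :
    posSum (Fin.append c c') = posSum c + posSum c' + a * ∑ i, c' i := by
  simp only [posSum, Fin.sum_univ_add, Fin.append_left, Fin.append_right, Fin.val_castAdd,
    Fin.val_natAdd, Nat.cast_add, add_mul, Finset.sum_add_distrib, Finset.mul_sum]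
  ring

theorem posSum_cons {a : ℕ} (x : ℤ) (c : Fin a → ℤ) :
    posSum (Fin.cons x c : Fin (a + 1) → ℤ) = posSum c + ∑ i, c i := by
  simp [posSum, Fin.sum_univ_succ, add_mul, Finset.sum_add_distrib]

theorem posSum_snoc {a : ℕ} (c : Fin a → ℤ) (x : ℤ) :
    posSum (Fin.snoc c x : Fin (a + 1) → ℤ) = posSum c + a * x := by
  simp [posSum, Fin.sum_univ_castSucc]

/-- The number of pairs in a set of `l` elements. -/
def pairs (l : ℕ) : ℤ := pairSum fun _ : Fin l => 1

theorem pairs_add (a b : ℕ) : pairs (a + b) = pairs a + pairs b + a * b := by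
  have := pairSum_append (fun _ : Fin a => (1 : ℤ)) (fun _ : Fin b => 1)
  rw [show Fin.append (fun _ : Fin a => (1 : ℤ)) (fun _ : Fin b => 1) = fun _ => 1 by
    funext i; refine Fin.addCases (fun i => ?_) (fun i => ?_) i <;> simp] at this
  simpa [pairs] using this

theorem pairs_succ (a : ℕ) : pairs (a + 1) = pairs a + a := by
  rw [pairs_add]
  simp [pairs, pairSum]

theorem pairSum_add_const {l : ℕ} (c : Fin l → ℤ) (n : ℤ) :
    pairSum (fun i => c i + n) = pairSum c + n * ((l - 1) * ∑ i, c i) + n * n * pairs l := by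
  have h1 := two_mul_pairSum fun i => c i + n
  have h2 := two_mul_pairSum c
  have h3 := two_mul_pairSum fun _ : Fin l => (1 : ℤ)
  simp only [Finset.sum_add_distrib, add_mul, mul_add, Finset.sum_const, Finset.card_univ,
    Fintype.card_fin, nsmul_eq_mul, ← Finset.sum_mul, ← Finset.mul_sum] at h1
  simp only [Finset.sum_const, Finset.card_univ, Fintype.card_fin, nsmul_eq_mul] at h3
  rw [pairs]
  have h4 := congrArg (fun t => n * n * t) h3
  linarith

/-- Reindexing both sums by σ exchanges the inversions of σ⁻¹ with those of σ. -/
theorem koszulExp_inv {l : ℕ} (σ : Equiv.Perm (Fin l)) (c : Fin l → ℤ) :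
    koszulExp σ⁻¹ (c ∘ σ) = koszulExp σ c := by
  rw [koszulExp, koszulExp, ← Equiv.sum_comp σ, Finset.sum_comm, ← Equiv.sum_comp σ]
  refine Finset.sum_congr rfl fun i _ => Finset.sum_congr rfl fun j _ => ?_
  have h : ∀ k, σ⁻¹ (σ k) = k := σ.symm_apply_apply
  simp only [h, Function.comp_apply, and_comm, mul_comm]

theorem koszulExp_add_const {l : ℕ} (σ : Equiv.Perm (Fin l)) (c : Fin l → ℤ) (n : ℤ) :
    koszulExp σ (fun i => c i + n) = koszulExp σ c +
      n * (∑ i, ∑ j, if i < j ∧ σ j < σ i then c (σ i) + c (σ j) else 0) +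
        n * n * koszulExp σ fun _ => 1 := by
  simp only [koszulExp, Finset.mul_sum, ← Finset.sum_add_distrib]
  refine Finset.sum_congr rfl fun i _ => Finset.sum_congr rfl fun j _ => ?_
  split_ifs <;> ring

/-- The décalage sign: shifting all degrees by `n` changes the Koszul sign of a permutation by its
signature to the power `n` and a coboundary. -/
theorem koszulExp_shift {l : ℕ} (σ : Equiv.Perm (Fin l)) (c : Fin l → ℤ) (n : ℤ) :
    ((koszulExp σ fun i => c i + n : ℤ) : ZMod 2) =
      koszulExp σ c + n * (posSum c + posSum (c ∘ σ)) + n * koszulExp σ fun _ => 1 := by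
  -- The value c (σ i) is counted once for each inversion containing i. These j form the symmetric
  -- difference of {j < i} and {σ j < σ i}, so their number has the parity of i + σ i; weighting by
  -- position gives the two sums `posSum`.
  have key : ((∑ i, ∑ j, if i < j ∧ σ j < σ i then c (σ i) + c (σ j) else 0 : ℤ) : ZMod 2) =
      posSum c + posSum (c ∘ σ) := by
    have h1 : posSum c = ∑ k, ((σ k : ℕ) : ℤ) * c (σ k) :=
      (Equiv.sum_comp σ fun k => ((k : ℕ) : ℤ) * c k).symm
    have h2 : (∑ i, ∑ j, if i < j ∧ σ j < σ i then c (σ i) + c (σ j) else 0) =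
        ∑ i, c (σ i) * ∑ j, ((if i < j ∧ σ j < σ i then 1 else 0) +
          if j < i ∧ σ i < σ j then 1 else 0) := by
      have : ∀ i j, (if i < j ∧ σ j < σ i then c (σ i) + c (σ j) else 0) =
          (if i < j ∧ σ j < σ i then c (σ i) else 0) +
            if i < j ∧ σ j < σ i then c (σ j) else 0 := by
        intro i j; split_ifs <;> simp
      simp only [this, Finset.sum_add_distrib, mul_add, Finset.mul_sum, mul_ite, mul_one, mul_zero]
      congr 1
      rw [Finset.sum_comm]
    have hval : ∀ i : Fin l, ((i : ℕ) : ℤ) = ∑ j, if j < i then 1 else 0 := by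
      intro i
      rw [Finset.sum_boole, Finset.filter_gt_eq_Iio, Fin.card_Iio]
    have hval2 : ∀ i : Fin l, ((σ i : ℕ) : ℤ) = ∑ j, if σ j < σ i then 1 else 0 := by
      intro i
      rw [hval, Equiv.sum_comp σ fun j => if j < σ i then (1 : ℤ) else 0]
    rw [h2, h1, posSum]
    simp only [hval2, hval, Function.comp_apply]
    push_cast
    rw [← Finset.sum_add_distrib]
    refine Finset.sum_congr rfl fun i _ => ?_
    rw [← add_mul, mul_comm, ← Finset.sum_add_distrib]
    congr 1
    refine Finset.sum_congr rfl fun j _ => ?_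
    have two : (1 : ZMod 2) + 1 = 0 := by decide
    rcases lt_trichotomy i j with h | rfl | h
    · simp [h, h.not_gt]
    · simp
    · have : σ i ≠ σ j := fun e => h.ne' (σ.injective e)
      rcases lt_or_gt_of_ne this with h' | h'
      · simp [h, h.not_gt, h', h'.not_gt]
      · simp [h, h.not_gt, h', h'.not_gt, two]
  rw [koszulExp_add_const]
  push_cast at key ⊢
  rw [key, zmod_two_mul_self]

/-- The signature is the Koszul sign with all degrees equal to 1: both count inversions. This brings
all permutation signs into the form `sg`. -/
theorem permSign_eq (K : Type u) [Field K] {l : ℕ} (n : ℤ) (σ : Equiv.Perm (Fin l)) :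
    permSign K n σ = sg K (n * koszulExp σ fun _ => 1) := by
  have h : Equiv.Perm.sign σ = (koszulExp σ fun _ => 1).negOnePow := by
    rw [Equiv.Perm.sign_eq_prod_prod_Ioi, koszulExp]
    have hs : ∀ (s : Finset (Fin l)) (f : Fin l → ℤ),
        (∑ i ∈ s, f i).negOnePow = ∏ i ∈ s, (f i).negOnePow := by
      intro s f
      induction s using Finset.cons_induction with
      | empty => simp
      | cons a s ha ih => rw [Finset.sum_cons, Finset.prod_cons, Int.negOnePow_add, ih]
    rw [hs]
    refine Finset.prod_congr rfl fun i _ => ?_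
    rw [hs, ← Finset.prod_subset (Finset.subset_univ (Finset.Ioi i))]
    · refine Finset.prod_congr rfl fun j hj => ?_
      have hij : i < j := Finset.mem_Ioi.1 hj
      have : σ i ≠ σ j := fun e => hij.ne (σ.injective e)
      rcases lt_or_gt_of_ne this with h' | h'
      · simp [h', h'.not_gt]
      · simp [hij, h', h'.not_gt]
    · intro j _ hj
      rw [if_neg fun h => hj (Finset.mem_Ioi.2 h.1), Int.negOnePow_zero]
  rw [permSign, h, sg, Int.negOnePow_def, Int.negOnePow_def, ← zpow_mul, mul_comm]

end Parity

/-! ### Decomposition of a permutation along the image of the last element -/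

section InsPerm

/-- The permutation with `last ↦ p` that acts on the other elements as `τ`. -/
def insPerm {N : ℕ} (p : Fin (N + 1)) (τ : Equiv.Perm (Fin N)) : Equiv.Perm (Fin (N + 1)) :=
  (finSuccEquiv' (Fin.last N)).trans ((Equiv.optionCongr τ).trans (finSuccEquiv' p).symm)

theorem insPerm_last {N : ℕ} (p : Fin (N + 1)) (τ : Equiv.Perm (Fin N)) :
    insPerm p τ (Fin.last N) = p := by
  simp [insPerm]

theorem insPerm_castSucc {N : ℕ} (p : Fin (N + 1)) (τ : Equiv.Perm (Fin N)) (k : Fin N) :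
    insPerm p τ k.castSucc = p.succAbove (τ k) := by
  have : finSuccEquiv' (Fin.last N) k.castSucc = some k := by
    rw [← Fin.succAbove_last_apply, finSuccEquiv'_succAbove]
  simp [insPerm, this]

theorem insPerm_bijective (N : ℕ) :
    Function.Bijective fun x : Fin (N + 1) × Equiv.Perm (Fin N) => insPerm x.1 x.2 := by
  rw [Fintype.bijective_iff_injective_and_card]
  constructor
  · rintro ⟨p, τ⟩ ⟨p', τ'⟩ h
    have h0 : insPerm p τ = insPerm p' τ' := h
    have h1 : p = p' := by rw [← insPerm_last p τ, h0, insPerm_last]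
    subst h1
    have h2 : τ = τ' := by
      ext1 k
      have := congrArg (fun e : Equiv.Perm (Fin (N + 1)) => e k.castSucc) h0
      simp only [insPerm_castSucc] at this
      exact Fin.succAbove_right_injective this
    rw [h2]
  · simp [Fintype.card_perm, Nat.factorial_succ]

theorem exists_insPerm {N : ℕ} (σ : Equiv.Perm (Fin (N + 1))) : ∃ p τ, σ = insPerm p τ := by
  obtain ⟨⟨p, τ⟩, h⟩ := (insPerm_bijective N).2 σ
  exact ⟨p, τ, h.symm⟩

/-- Removing the last element allows induction over symmetric groups: when a product of operators
acts, the last one acts first, and p records which factor it contracts. -/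
theorem sum_insPerm {M : Type*} [AddCommMonoid M] {N : ℕ} (f : Equiv.Perm (Fin (N + 1)) → M) :
    ∑ σ, f σ = ∑ p, ∑ τ, f (insPerm p τ) := by
  rw [← (insPerm_bijective N).sum_comp f, Fintype.sum_prod_type]

/-- The last position forms inversions exactly with the positions whose value exceeds p; all other
inversions are those of τ. -/
theorem koszulExp_insPerm {N : ℕ} (p : Fin (N + 1)) (τ : Equiv.Perm (Fin N))
    (c : Fin (N + 1) → ℤ) :
    koszulExp (insPerm p τ) c = koszulExp τ (c ∘ p.succAbove) +
      c p * ∑ i, if p < p.succAbove i then c (p.succAbove i) else 0 := by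
  rw [koszulExp, Fin.sum_univ_castSucc]
  simp only [Fin.sum_univ_castSucc, insPerm_castSucc, insPerm_last, Fin.castSucc_lt_castSucc_iff,
    Fin.castSucc_lt_last, true_and, false_and, if_false, add_zero,
    (Fin.strictMono_succAbove p).lt_iff_lt, (Fin.le_last _).not_gt]
  rw [Finset.sum_add_distrib, Finset.sum_const_zero, add_zero, koszulExp]
  congr 1
  rw [Finset.mul_sum, ← Equiv.sum_comp τ fun i => c p * _]
  refine Finset.sum_congr rfl fun i _ => ?_
  split_ifs <;> ring

theorem pairSum_succAbove {N : ℕ} (p : Fin (N + 1)) (c : Fin (N + 1) → ℤ) :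
    pairSum c = pairSum (c ∘ p.succAbove) + c p * ∑ i, c (p.succAbove i) := by
  have h1 := two_mul_pairSum c
  have h2 := two_mul_pairSum (c ∘ p.succAbove)
  simp only [Fin.sum_univ_succAbove _ p, Function.comp_apply] at h1 h2
  linarith

end InsPerm

/-! ### Products of elements that commute up to sign -/

section Product

variable {K : Type u} [Field K] {R : Type*} [Ring R] [Algebra K R]

theorem prod_ofFn_succ' {N : ℕ} (a : Fin (N + 1) → R) :
    (List.ofFn a).prod = (List.ofFn fun k => a (Fin.castSucc k)).prod * a (Fin.last N) := by
  rw [List.ofFn_succ', List.concat_eq_append, List.prod_append, List.prod_singleton]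

theorem prod_ofFn_succ {N : ℕ} (a : Fin (N + 1) → R) :
    (List.ofFn a).prod = a 0 * (List.ofFn fun k => a (Fin.succ k)).prod := by
  rw [List.ofFn_succ, List.prod_cons]

theorem prod_ofFn_mul_comm {N : ℕ} (a : Fin N → R) (c : Fin N → ℤ) (x : R) (e : ℤ)
    (h : ∀ i, a i * x = sg K (c i * e) • (x * a i)) :
    (List.ofFn a).prod * x = sg K ((∑ i, c i) * e) • (x * (List.ofFn a).prod) := by
  induction N with
  | zero => simp [sg_zero]
  | succ N ih =>
    rw [prod_ofFn_succ, mul_assoc, ih (fun k => a k.succ) (fun k => c k.succ) fun i => h i.succ,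
      mul_smul_comm, ← mul_assoc, h 0, smul_mul_assoc, smul_smul, ← sg_add, mul_assoc,
      Fin.sum_univ_succ]
    congr 2
    ring

/-- To return to its place, the factor `a p` passes exactly the factors with larger index. -/
theorem prod_succAbove_mul {N : ℕ} (a : Fin (N + 1) → R) (c : Fin (N + 1) → ℤ)
    (h : ∀ i j, a i * a j = sg K (c i * c j) • (a j * a i)) (p : Fin (N + 1)) :
    (List.ofFn fun k => a (p.succAbove k)).prod * a p =
      sg K (c p * ∑ i, if p < p.succAbove i then c (p.succAbove i) else 0) •
        (List.ofFn a).prod := by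
  induction N with
  | zero =>
    obtain rfl : p = 0 := Subsingleton.elim (α := Fin 1) _ _
    simp [sg_zero]
  | succ N ih =>
    refine Fin.cases ?_ (fun p => ?_) p
    · simp only [Fin.succAbove_zero]
      rw [prod_ofFn_mul_comm _ (fun k => c k.succ) (a 0) (c 0) fun i => h _ _, ← prod_ofFn_succ]
      simp [mul_comm]
    · rw [prod_ofFn_succ, prod_ofFn_succ a]
      simp only [Fin.succ_succAbove_zero, Fin.succ_succAbove_succ, Fin.sum_univ_succ, mul_assoc]
      rw [ih (fun k => a k.succ) (fun k => c k.succ) (fun i j => h _ _) p, mul_smul_comm]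
      simp

theorem prod_perm {N : ℕ} (a : Fin N → R) (c : Fin N → ℤ)
    (h : ∀ i j, a i * a j = sg K (c i * c j) • (a j * a i)) (σ : Equiv.Perm (Fin N)) :
    (List.ofFn fun k => a (σ k)).prod = sg K (koszulExp σ c) • (List.ofFn a).prod := by
  induction N with
  | zero => simp [koszulExp, sg_zero]
  | succ N ih =>
    obtain ⟨p, τ, rfl⟩ := exists_insPerm σ
    rw [prod_ofFn_succ']
    simp only [insPerm_castSucc, insPerm_last]
    rw [ih (fun k => a (p.succAbove k)) (c ∘ p.succAbove) (fun i j => h _ _) τ, smul_mul_assoc,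
      prod_succAbove_mul a c h, smul_smul, ← sg_add, koszulExp_insPerm]

/-- Moving an operator `d` to the left through a product. -/
theorem prod_mul_eq {N : ℕ} (a a' : Fin N → R) (c : Fin N → ℤ) (d : R)
    (h : ∀ i, a i * d = sg K (c i) • (d * a i) + a' i) :
    (List.ofFn a).prod * d = sg K (∑ i, c i) • (d * (List.ofFn a).prod) +
      ∑ k, sg K (∑ i, if k < i then c i else 0) •
        (List.ofFn (Function.update a k (a' k))).prod := by
  induction N with
  | zero => simp [sg_zero]
  | succ N ih =>
    rw [prod_ofFn_succ, mul_assoc, ih (fun k => a k.succ) (fun k => a' k.succ)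
      (fun k => c k.succ) fun i => h i.succ, mul_add, mul_smul_comm, ← mul_assoc, h 0, add_mul,
      smul_add, smul_mul_assoc, smul_smul, ← sg_add, mul_assoc, add_assoc]
    congr 1
    · rw [Fin.sum_univ_succ, add_comm]
    · rw [Fin.sum_univ_succ]
      congr 1
      · rw [prod_ofFn_succ]
        simp [Fin.sum_univ_succ]
      · rw [Finset.mul_sum]
        refine Finset.sum_congr rfl fun k _ => ?_
        rw [prod_ofFn_succ, mul_smul_comm]
        have e1 : ∀ j : Fin N, Function.update a k.succ (a' k.succ) j.succ =
            Function.update (fun k => a k.succ) k (a' k.succ) j := by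
          intro j
          by_cases hj : j = k
          · subst hj; simp
          · rw [Function.update_of_ne (by simpa using hj), Function.update_of_ne hj]
        simp only [e1, Fin.sum_univ_succ]
        rw [Function.update_of_ne (Fin.succ_ne_zero k).symm]
        simp

end Product

/-! ### Iterated derivations -/

namespace GCA

variable {K : Type u} [Field K] {B : GCA.{u, w} K}

theorem one_mem_deg : (1 : B.carrier) ∈ B.deg 0 := SetLike.GradedOne.one_mem

theorem prod_ofFn_mem {N : ℕ} {z : Fin N → B.carrier} {b : Fin N → ℤ} (hz : ∀ j, z j ∈ B.deg (b j)) :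
    (List.ofFn z).prod ∈ B.deg (∑ j, b j) := by
  induction N with
  | zero => simpa using one_mem_deg
  | succ N ih =>
    rw [prod_ofFn_succ, Fin.sum_univ_succ]
    exact B.mul_mem (hz 0) (ih fun j => hz j.succ)

theorem prod_ofFn_der_mem {N : ℕ} {D : Fin N → Module.End K B.carrier} {c : Fin N → ℤ}
    (hD : ∀ k, D k ∈ B.Der (c k)) {i : ℤ} {a : B.carrier} (ha : a ∈ B.deg i) :
    (List.ofFn D).prod a ∈ B.deg (i + ∑ k, c k) := by
  induction N with
  | zero => simpa using ha
  | succ N ih =>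
    rw [prod_ofFn_succ, Fin.sum_univ_succ, Module.End.mul_apply, add_comm (c 0), ← add_assoc]
    exact (hD 0).1 _ _ (ih fun k => hD k.succ)

/-- By the Leibniz rule D contracts one factor after passing those to its left. The hypothesis `hδ`
replaces the degree of D in the sign by that of the contracted factor, so the result no longer
mentions δ. -/
theorem der_prod_ofFn {N : ℕ} {D : Module.End K B.carrier} {δ : ℤ} (hD : D ∈ B.Der δ)
    {z : Fin (N + 1) → B.carrier} {b : Fin (N + 1) → ℤ} (hz : ∀ j, z j ∈ B.deg (b j))
    {m : Fin (N + 1) → K} (hm : ∀ j, D (z j) = m j • 1) (hδ : ∀ j, m j ≠ 0 → δ = -b j) :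
    D (List.ofFn z).prod = ∑ p, (sg K (b p * ∑ i, if p.succAbove i < p then b (p.succAbove i)
      else 0) * m p) • (List.ofFn fun k => z (p.succAbove k)).prod := by
  induction N with
  | zero => simp [hm, sg_zero]
  | succ N ih =>
    rw [prod_ofFn_succ, hD.2 _ _ (hz 0), hm 0, ih (fun j => hz j.succ) (fun j => hm j.succ)
      fun j => hδ j.succ]
    refine Eq.trans ?_ (Fin.sum_univ_succ _).symm
    congr 1
    · simp [sg_zero]
    · rw [Finset.mul_sum, Finset.smul_sum]
      refine Finset.sum_congr rfl fun p _ => ?_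
      rw [prod_ofFn_succ fun k => z (p.succ.succAbove k)]
      simp only [Fin.succ_succAbove_zero, Fin.succ_succAbove_succ, Fin.sum_univ_succ,
        Fin.succ_lt_succ_iff, Fin.succ_pos, if_true]
      rw [mul_smul_comm, smul_smul, mul_add, sg_add, mul_assoc]
      -- A vanishing contraction makes both sides zero; otherwise δ is minus the degree of the
      -- contracted factor, and the sign of the exponent is irrelevant.
      by_cases h : m p.succ = 0
      · simp [h]
      · rw [hδ _ h, sg_congr K (a := -b p.succ * b 0) (b := b p.succ * b 0)
          ⟨-(b p.succ * b 0), by ring⟩]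

/-- The value of an iterated derivation on a product of as many elements. -/
theorem wick {N : ℕ} {D : Fin N → Module.End K B.carrier} {δ : Fin N → ℤ}
    (hD : ∀ k, D k ∈ B.Der (δ k)) {z : Fin N → B.carrier} {b : Fin N → ℤ}
    (hz : ∀ j, z j ∈ B.deg (b j)) {m : Fin N → Fin N → K} (hm : ∀ k j, D k (z j) = m k j • 1)
    (hδ : ∀ k j, m k j ≠ 0 → δ k = -b j) :
    (List.ofFn D).prod (List.ofFn z).prod =
      (∑ σ : Equiv.Perm (Fin N), sg K (pairSum b + koszulExp σ b) * ∏ k, m k (σ k)) • 1 := by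
  induction N with
  | zero => simp [koszulExp, pairSum, sg_zero]
  | succ N ih =>
    -- The last operator acts first and contracts the factor p; the remaining contractions are a
    -- permutation τ of what is left, and together they form `insPerm p τ`.
    rw [prod_ofFn_succ', Module.End.mul_apply, der_prod_ofFn (hD _) hz (hm _) (hδ _), map_sum,
      sum_insPerm, Finset.sum_smul]
    refine Finset.sum_congr rfl fun p _ => ?_
    rw [map_smul, ih (fun k => hD k.castSucc) (fun j => hz (p.succAbove j)) (fun k j => hm _ _)
      fun k j => hδ _ _, smul_smul, Finset.mul_sum]
    congr 1
    refine Finset.sum_congr rfl fun τ _ => ?_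
    rw [Fin.prod_univ_castSucc, koszulExp_insPerm, pairSum_succAbove p b]
    simp only [insPerm_castSucc, insPerm_last]
    -- The contraction produces the factors to the left of p and `koszulExp_insPerm` those to the
    -- right; their total is what `pairSum` loses when p is removed.
    have h : (∑ i, if p.succAbove i < p then b (p.succAbove i) else 0) =
        (∑ i, b (p.succAbove i)) - ∑ i, if p < p.succAbove i then b (p.succAbove i) else 0 := by
      rw [← Finset.sum_sub_distrib]
      refine Finset.sum_congr rfl fun i _ => ?_
      rcases lt_or_gt_of_ne (Fin.succAbove_ne p i) with h | h
      · simp [h, h.not_gt]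
      · simp [h, h.not_gt]
    rw [h]
    generalize (∑ i, if p < p.succAbove i then b (p.succAbove i) else 0) = s
    rw [sg_congr K (a := pairSum (b ∘ p.succAbove) + b p * ∑ i, b (p.succAbove i) +
      (koszulExp τ (b ∘ p.succAbove) + b p * s))
      (b := b p * ((∑ i, b (p.succAbove i)) - s) + (pairSum (b ∘ p.succAbove) +
      koszulExp τ (b ∘ p.succAbove))) ⟨b p * s, by ring⟩, sg_add]
    simp only [Function.comp_def, sg_add]
    ring

/-- A product of operators of which fewer generators remain than there are operators. -/
theorem prod_der_smul_one {N : ℕ} {D : Fin (N + 1) → Module.End K B.carrier} {δ : Fin (N + 1) → ℤ}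
    (hD : ∀ k, D k ∈ B.Der (δ k)) (c : K) : (List.ofFn D).prod (c • 1) = 0 := by
  rw [prod_ofFn_succ', Module.End.mul_apply, map_smul, Der.one (hD _), smul_zero, map_zero]

/-- Each operator uses up one factor, so a surplus operator meets a scalar, and derivations kill
scalars. -/
theorem prod_der_eq_zero {N L : ℕ} {D : Fin N → Module.End K B.carrier} {δ : Fin N → ℤ}
    (hD : ∀ k, D k ∈ B.Der (δ k)) {z : Fin L → B.carrier} {b : Fin L → ℤ}
    (hz : ∀ j, z j ∈ B.deg (b j)) {m : Fin N → Fin L → K} (hm : ∀ k j, D k (z j) = m k j • 1)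
    (hδ : ∀ k j, m k j ≠ 0 → δ k = -b j) (h : L < N) :
    (List.ofFn D).prod (List.ofFn z).prod = 0 := by
  induction L generalizing N with
  | zero =>
    obtain ⟨N, rfl⟩ := Nat.exists_eq_succ_of_ne_zero h.ne'
    simpa using prod_der_smul_one hD (1 : K)
  | succ L ih =>
    obtain ⟨N, rfl⟩ := Nat.exists_eq_succ_of_ne_zero (Nat.zero_lt_of_lt h).ne'
    rw [prod_ofFn_succ', Module.End.mul_apply, der_prod_ofFn (hD _) hz (hm _) (hδ _), map_sum]
    refine Finset.sum_eq_zero fun p _ => ?_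
    rw [map_smul, ih (fun k => hD k.castSucc) (fun j => hz (p.succAbove j)) (fun k j => hm _ _)
      (fun k j => hδ _ _) (by omega), smul_zero]

/-- Each operator uses up one factor, so some factor survives, and the augmentation kills it. -/
theorem aug_prod_der_eq_zero {N L : ℕ} (ε : B.carrier →ₐ[K] K) {D : Fin N → Module.End K B.carrier}
    {δ : Fin N → ℤ} (hD : ∀ k, D k ∈ B.Der (δ k)) {z : Fin L → B.carrier} {b : Fin L → ℤ}
    (hz : ∀ j, z j ∈ B.deg (b j)) {m : Fin N → Fin L → K} (hm : ∀ k j, D k (z j) = m k j • 1)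
    (hδ : ∀ k j, m k j ≠ 0 → δ k = -b j) (hε : ∀ j, ε (z j) = 0) (h : N < L) :
    ε ((List.ofFn D).prod (List.ofFn z).prod) = 0 := by
  induction N generalizing L with
  | zero =>
    obtain ⟨L, rfl⟩ := Nat.exists_eq_succ_of_ne_zero h.ne'
    simp [hε]
  | succ N ih =>
    obtain ⟨L, rfl⟩ := Nat.exists_eq_succ_of_ne_zero (Nat.zero_lt_of_lt h).ne'
    rw [prod_ofFn_succ', Module.End.mul_apply, der_prod_ofFn (hD _) hz (hm _) (hδ _), map_sum,
      map_sum]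
    refine Finset.sum_eq_zero fun p _ => ?_
    rw [map_smul, map_smul, ih (fun k => hD k.castSucc) (fun j => hz (p.succAbove j))
      (fun k j => hm _ _) (fun k j => hδ _ _) (fun j => hε _) (by omega), smul_zero]

end GCA

/-! ### The Leibniz rule for iterated derivations -/

section Selection

/-- The product, in increasing order, of the entries selected by `s`. -/
def selProd {R : Type*} [Monoid R] {N : ℕ} (s : Fin N → Bool) (a : Fin N → R) : R :=
  (((List.finRange N).filter s).map a).prod

/-- The Koszul exponent of moving the selected entries to the front. -/
def selExp {N : ℕ} (s : Fin N → Bool) (c : Fin N → ℤ) : ℤ :=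
  ∑ i, ∑ j, if i < j ∧ s i = false ∧ s j = true then c i * c j else 0

theorem selProd_cons {R : Type*} [Monoid R] {N : ℕ} (x : Bool) (s : Fin N → Bool)
    (a : Fin (N + 1) → R) : selProd (Fin.cons x s : Fin (N + 1) → Bool) a =
      (if x then a 0 else 1) * selProd s fun k => a k.succ := by
  rw [selProd, List.finRange_succ, List.filter_cons, List.filter_map, selProd]
  cases x <;> simp [Function.comp_def]

theorem sum_cons_bool {M : Type*} [AddCommMonoid M] {N : ℕ} (f : (Fin (N + 1) → Bool) → M) :
    ∑ s, f s = ∑ s : Fin N → Bool, (f (Fin.cons true s) + f (Fin.cons false s)) := by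
  rw [← (Fin.consEquiv fun _ : Fin (N + 1) => Bool).sum_comp f, Fintype.sum_prod_type_right]
  refine Finset.sum_congr rfl fun s _ => ?_
  rw [Fintype.sum_bool]
  rfl

theorem selExp_cons_true {N : ℕ} (s : Fin N → Bool) (c : Fin (N + 1) → ℤ) :
    selExp (Fin.cons true s : Fin (N + 1) → Bool) c = selExp s fun k => c k.succ := by
  simp [selExp, Fin.sum_univ_succ]

theorem selExp_cons_false {N : ℕ} (s : Fin N → Bool) (c : Fin (N + 1) → ℤ) :
    selExp (Fin.cons false s : Fin (N + 1) → Bool) c = (selExp s fun k => c k.succ) +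
      c 0 * ∑ j, if s j then c j.succ else 0 := by
  simp [selExp, Fin.sum_univ_succ, Finset.mul_sum]
  ring

end Selection

namespace GCA

variable {K : Type u} [Field K] {B : GCA.{u, w} K}

theorem selProd_mem {N : ℕ} (s : Fin N → Bool) {D : Fin N → Module.End K B.carrier} {c : Fin N → ℤ}
    (hD : ∀ k, D k ∈ B.Der (c k)) {u : ℤ} {U : B.carrier} (hU : U ∈ B.deg u) :
    selProd s D U ∈ B.deg (u + ∑ j, if s j then c j else 0) := by
  induction N with
  | zero => simpa [selProd] using hU
  | succ N ih =>
    obtain ⟨x, s, rfl⟩ : ∃ x s', s = Fin.cons x s' := ⟨s 0, Fin.tail s, (Fin.cons_self_tail s).symm⟩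
    have := ih s fun k => hD k.succ
    rw [selProd_cons, Fin.sum_univ_succ]
    simp only [Fin.cons_zero, Fin.cons_succ]
    cases x
    · simpa using this
    · rw [if_pos rfl, if_pos rfl, Module.End.mul_apply, add_comm (c 0), ← add_assoc]
      exact (hD 0).1 _ _ this

/-- Each operator acts on U or on V, and s records those acting on U. The sign comes from selected
operators overtaking unselected ones and from unselected ones passing U. -/
theorem prod_der_mul {N : ℕ} {D : Fin N → Module.End K B.carrier} {c : Fin N → ℤ}
    (hD : ∀ k, D k ∈ B.Der (c k)) {u : ℤ} {U : B.carrier} (hU : U ∈ B.deg u) (V : B.carrier) :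
    (List.ofFn D).prod (U * V) = ∑ s : Fin N → Bool,
      sg K (selExp s c + u * ∑ i, if s i then 0 else c i) •
        (selProd s D U * selProd (fun i => !s i) D V) := by
  induction N with
  | zero => simp [selProd, selExp, sg_zero]
  | succ N ih =>
    rw [prod_ofFn_succ, Module.End.mul_apply, ih fun k => hD k.succ, map_sum, sum_cons_bool]
    refine Finset.sum_congr rfl fun s _ => ?_
    have e : ∀ x, (fun i => !(Fin.cons x s : Fin (N + 1) → Bool) i) = Fin.cons (!x) fun i => !s i := by
      intro x
      funext i
      refine Fin.cases ?_ (fun i => ?_) i <;> simp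
    -- The first operator either hits the left factor or passes it. That factor has degree u plus
    -- the selected degrees, which is what the first operator adds to the exponent when it is not
    -- selected.
    rw [map_smul, (hD 0).2 _ _ (selProd_mem s (fun k => hD k.succ) hU), e, e]
    simp only [selProd_cons, selExp_cons_true, selExp_cons_false, Fin.sum_univ_succ, Fin.cons_zero,
      Fin.cons_succ, if_true, Bool.not_true, Bool.not_false, Bool.false_eq_true, if_false, one_mul,
      zero_add, Module.End.mul_apply, smul_add, smul_smul, ← sg_add]
    congr 3
    ring

end GCA

/-! ### Shuffles -/

section Shuffles

/-- The set of images of the first `a` elements. -/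
def firstBlock {a b : ℕ} (σ : Equiv.Perm (Fin (a + b))) (i : Fin (a + b)) : Bool :=
  decide ((σ.symm i : ℕ) < a)

theorem mem_shuffles {a b : ℕ} {σ : Equiv.Perm (Fin (a + b))} : σ ∈ shuffles a b ↔
    StrictMono (fun i : Fin a => σ (Fin.castAdd b i)) ∧ StrictMono fun i : Fin b => σ (Fin.natAdd a i) := by
  simp [shuffles, StrictMono]

/-- Both lists are strictly increasing and have the same members, hence coincide. -/
theorem filter_firstBlock {a b : ℕ} {σ : Equiv.Perm (Fin (a + b))} (hσ : σ ∈ shuffles a b) :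
    (List.finRange (a + b)).filter (firstBlock σ) = List.ofFn fun i => σ (Fin.castAdd b i) := by
  have h1 : ((List.finRange (a + b)).filter (firstBlock σ)).Pairwise (· < ·) :=
    (List.sortedLT_finRange _).pairwise.filter _
  have h2 : (List.ofFn fun i => σ (Fin.castAdd b i)).Pairwise (· < ·) := by
    rw [List.pairwise_ofFn]
    exact fun i j h => (mem_shuffles.1 hσ).1 h
  refine List.Perm.eq_of_pairwise' (h1.imp le_of_lt) (h2.imp le_of_lt) ?_
  rw [List.perm_ext_iff_of_nodup (h1.imp ne_of_lt) (h2.imp ne_of_lt)]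
  intro i
  simp only [List.mem_filter, List.mem_finRange, true_and, firstBlock, decide_eq_true_eq,
    List.mem_ofFn']
  constructor
  · intro h
    exact ⟨⟨_, h⟩, by simp [Fin.castAdd, Fin.castLE]⟩
  · rintro ⟨j, rfl⟩
    simp

theorem filter_not_firstBlock {a b : ℕ} {σ : Equiv.Perm (Fin (a + b))} (hσ : σ ∈ shuffles a b) :
    (List.finRange (a + b)).filter (fun i => !firstBlock σ i) =
      List.ofFn fun i => σ (Fin.natAdd a i) := by
  have h1 : ((List.finRange (a + b)).filter (fun i => !firstBlock σ i)).Pairwise (· < ·) :=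
    (List.sortedLT_finRange _).pairwise.filter _
  have h2 : (List.ofFn fun i => σ (Fin.natAdd a i)).Pairwise (· < ·) := by
    rw [List.pairwise_ofFn]
    exact fun i j h => (mem_shuffles.1 hσ).2 h
  refine List.Perm.eq_of_pairwise' (h1.imp le_of_lt) (h2.imp le_of_lt) ?_
  rw [List.perm_ext_iff_of_nodup (h1.imp ne_of_lt) (h2.imp ne_of_lt)]
  intro i
  simp only [List.mem_filter, List.mem_finRange, true_and, firstBlock, Bool.not_eq_true',
    decide_eq_false_iff_not, List.mem_ofFn', not_lt]
  constructor
  · intro h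
    refine ⟨⟨(σ.symm i : ℕ) - a, by omega⟩, ?_⟩
    change σ (Fin.natAdd a _) = i
    rw [← Equiv.eq_symm_apply]
    ext
    simp [h]
  · rintro ⟨j, rfl⟩
    simp

theorem selProd_firstBlock {R : Type*} [Monoid R] {a b : ℕ} {σ : Equiv.Perm (Fin (a + b))}
    (hσ : σ ∈ shuffles a b) (x : Fin (a + b) → R) :
    selProd (firstBlock σ) x = (List.ofFn fun i => x (σ (Fin.castAdd b i))).prod := by
  rw [selProd, filter_firstBlock hσ, List.map_ofFn]
  rfl

theorem selProd_not_firstBlock {R : Type*} [Monoid R] {a b : ℕ} {σ : Equiv.Perm (Fin (a + b))}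
    (hσ : σ ∈ shuffles a b) (x : Fin (a + b) → R) :
    selProd (fun i => !firstBlock σ i) x = (List.ofFn fun i => x (σ (Fin.natAdd a i))).prod := by
  rw [selProd, filter_not_firstBlock hσ, List.map_ofFn]
  rfl

/-- A shuffle has no inversion inside a block. Its inversions are the pairs of a first-block value
lying above a second-block value, which is what `selExp` counts. -/
theorem selExp_firstBlock {a b : ℕ} {σ : Equiv.Perm (Fin (a + b))} (hσ : σ ∈ shuffles a b)
    (c : Fin (a + b) → ℤ) : selExp (firstBlock σ) c = koszulExp σ c := by
  rw [selExp, koszulExp, ← Equiv.sum_comp σ, Finset.sum_comm, ← Equiv.sum_comp σ]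
  refine Finset.sum_congr rfl fun j _ => Finset.sum_congr rfl fun i _ => ?_
  rw [mul_comm]
  refine if_congr ?_ rfl rfl
  simp only [firstBlock, Equiv.symm_apply_apply, decide_eq_false_iff_not, decide_eq_true_eq, not_lt]
  constructor
  · rintro ⟨h, h1, h2⟩
    exact ⟨Fin.lt_def.2 (by omega), h⟩
  · rintro ⟨h, h'⟩
    refine ⟨h', ?_⟩
    obtain ⟨m1, m2⟩ := mem_shuffles.1 hσ
    induction i using Fin.addCases with
    | left i =>
      induction j using Fin.addCases with
      | left j =>
        exact absurd (m1 (show j < i from h)) h'.not_gt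
      | right j => exact absurd h (by simp [Fin.lt_def]; omega)
    | right i =>
      induction j using Fin.addCases with
      | left j => simp
      | right j => exact absurd (m2 (show j < i by simpa using h)) h'.not_gt

theorem sum_firstBlock {M : Type*} [AddCommMonoid M] {a b : ℕ} {σ : Equiv.Perm (Fin (a + b))}
    (c : Fin (a + b) → M) :
    (∑ i, if firstBlock σ i then c i else 0) = ∑ i, c (σ (Fin.castAdd b i)) := by
  rw [← Equiv.sum_comp σ, Fin.sum_univ_add]
  simp [firstBlock]

theorem sum_not_firstBlock {M : Type*} [AddCommMonoid M] {a b : ℕ} {σ : Equiv.Perm (Fin (a + b))}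
    (c : Fin (a + b) → M) :
    (∑ i, if firstBlock σ i then 0 else c i) = ∑ i, c (σ (Fin.natAdd a i)) := by
  rw [← Equiv.sum_comp σ, Fin.sum_univ_add]
  simp [firstBlock]

/-- Shuffles correspond to subsets. -/
theorem sum_shuffles {M : Type*} [AddCommMonoid M] {a b : ℕ} (f : (Fin (a + b) → Bool) → M) :
    ∑ σ ∈ shuffles a b, f (firstBlock σ) =
      ∑ s : Fin (a + b) → Bool, if (∑ i, if s i then 1 else 0) = a then f s else 0 := by
  rw [← Finset.sum_filter]
  refine Finset.sum_bij (fun σ _ => firstBlock σ) ?_ ?_ ?_ ?_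
  · intro σ _
    rw [Finset.mem_filter, sum_firstBlock]
    simp
  -- A shuffle is recovered from the subset by listing the subset and then its complement in
  -- increasing order.
  · intro σ hσ τ hτ h
    have h1 := filter_firstBlock hσ
    have h2 := filter_not_firstBlock hσ
    rw [h, filter_firstBlock hτ] at h1
    rw [h, filter_not_firstBlock hτ] at h2
    have h1 := List.ofFn_injective h1
    have h2 := List.ofFn_injective h2
    ext1 i
    refine Fin.addCases (fun i => ?_) (fun i => ?_) i
    · exact (congrFun h1 i).symm
    · exact (congrFun h2 i).symm
  · intro s hs
    rw [Finset.mem_filter] at hs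
    set S : Finset (Fin (a + b)) := Finset.univ.filter fun i => s i = true with hS
    have hmem : ∀ j, j ∈ S ↔ s j = true := by simp [hS]
    have h1 : S.card = a := by
      rw [hS, Finset.card_filter]
      exact hs.2
    have h2 : Sᶜ.card = b := by rw [Finset.card_compl, h1, Fintype.card_fin]; omega
    -- The preimage of a subset enumerates the subset increasingly on the first block and its
    -- complement increasingly on the second.
    refine ⟨finSumFinEquiv.symm.trans (finSumEquivOfFinset h1 h2), ?_, ?_⟩
    · rw [mem_shuffles]
      constructor
      · intro i j h
        simpa using h
      · intro i j h
        simpa using h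
    · funext i
      obtain ⟨i, rfl⟩ := (finSumFinEquiv.symm.trans (finSumEquivOfFinset h1 h2)).surjective i
      rw [firstBlock, Equiv.symm_apply_apply]
      refine Fin.addCases (fun i => ?_) (fun i => ?_) i
      · have := Finset.orderEmbOfFin_mem S h1 i
        rw [hmem] at this
        simpa using this.symm
      · have := Finset.orderEmbOfFin_mem Sᶜ h2 i
        rw [Finset.mem_compl, hmem] at this
        simpa using this
  · intro σ _
    rfl

end Shuffles

/-! ### Homogeneous bases and coordinates of tensor powers -/

section Coordinates

variable {K : Type u} [Field K] {g : CochainComplex (ModuleCat.{v} K) ℤ}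

theorem functional_inc_of_ne {i j : ℤ} (θ : (shiftedDual g).X i) (y : g.X j) (h : j ≠ 1 - i) :
    functional g θ (inc g y) = 0 := by
  rw [functional, LinearMap.comp_apply, DirectSum.component.of, dif_neg (by omega), map_zero]

/-- The element `sθ` for a functional `θ` on `g.X j`. -/
def dualElt {j : ℤ} (φ : Module.Dual K (g.X j)) : (shiftedDual g).X (1 - j) :=
  show Module.Dual K (g.X (-(1 - j + -1))) from
    (show j = -(1 - j + -1) by ring) ▸ φ

theorem functional_dualElt {j : ℤ} (φ : Module.Dual K (g.X j)) :
    functional g (dualElt φ) = φ ∘ₗ DirectSum.component K ℤ (fun i => g.X i) j := by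
  -- With the target degree as a variable the transport along the equality of degrees can be
  -- eliminated.
  have key : ∀ (k : ℤ) (h : j = k), (h ▸ φ : Module.Dual K (g.X k)) ∘ₗ
      DirectSum.component K ℤ (fun i => g.X i) k =
        φ ∘ₗ DirectSum.component K ℤ (fun i => g.X i) j := by
    rintro k rfl
    rfl
  exact key _ (by ring)

variable (g) in
/-- A finite homogeneous basis of the total space, with the dual basis. -/
structure HomBasis where
  I : Type
  [fintype : Fintype I]
  [decEq : DecidableEq I]
  d : I → ℤ
  x : ∀ i, g.X (d i)
  θ : ∀ i, (shiftedDual g).X (1 - d i)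
  pair : ∀ i j, functional g (θ i) (inc g (x j)) = if i = j then 1 else 0
  expand : ∀ t : Tot g, t = ∑ i, functional g (θ i) t • inc g (x i)

attribute [instance] HomBasis.fintype HomBasis.decEq

/-- Boundedness leaves the degrees from -N to N, and each contributes a finite basis. The index type
is a sum of `Fin`s, so it lives in `Type` whatever the universe of g. -/
theorem exists_homBasis (hb : ∃ N : ℤ, ∀ i : ℤ, N < |i| → Subsingleton (g.X i))
    (hf : ∀ i : ℤ, Module.Finite K (g.X i)) : Nonempty (HomBasis g) := by
  obtain ⟨N, hN⟩ := hb
  let b := fun i : ℤ => Module.finBasis K (g.X i)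
  refine ⟨{ I := Σ i : Finset.Icc (-N) N, Fin (Module.finrank K (g.X i.1))
            d := fun i => i.1.1
            x := fun i => b i.1.1 i.2
            θ := fun i => dualElt ((b i.1.1).coord i.2)
            pair := ?_
            expand := ?_ }⟩
  · rintro ⟨⟨i, hi⟩, k⟩ ⟨⟨j, hj⟩, k'⟩
    rw [functional_dualElt, LinearMap.comp_apply, DirectSum.component.of]
    by_cases h : j = i
    · subst h
      simp only [dite_true, Module.Basis.coord_apply, Module.Basis.repr_self, Finsupp.single_apply]
      refine if_congr ?_ rfl rfl
      constructor
      · rintro rfl; rfl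
      · intro h
        simp only [Sigma.mk.injEq, heq_eq_eq, true_and] at h
        exact h.symm
    · rw [dif_neg h, map_zero, if_neg]
      intro h'
      apply h
      simp only [Sigma.mk.injEq, Subtype.mk.injEq] at h'
      exact h'.1.symm
  · intro t
    -- The expansion is an identity of linear maps, so it may be checked on one homogeneous summand
    -- at a time.
    have key : LinearMap.id = ∑ i : Σ i : Finset.Icc (-N) N, Fin (Module.finrank K (g.X i.1)),
        (functional g (dualElt ((b i.1.1).coord i.2))).smulRight (inc g (b i.1.1 i.2)) := by
      refine DirectSum.linearMap_ext K fun j => LinearMap.ext fun y => ?_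
      simp only [LinearMap.comp_apply, LinearMap.id_apply, LinearMap.sum_apply,
        LinearMap.smulRight_apply, functional_dualElt, DirectSum.component.of]
      rw [Fintype.sum_sigma]
      by_cases hj : |j| ≤ N
      · have hj' : j ∈ Finset.Icc (-N) N := by
          rw [Finset.mem_Icc]; exact abs_le.1 hj
        rw [Finset.sum_eq_single ⟨j, hj'⟩]
        · conv_lhs => rw [← (b j).sum_repr y, map_sum]
          simp [inc]
        · rintro ⟨i, hi⟩ _ h
          have h' : j ≠ i := fun e => h (by subst e; rfl)
          simp [h']
        · intro h
          exact absurd (Finset.mem_univ _) h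
      · have := hN j (not_le.1 hj)
        rw [Subsingleton.elim y 0]
        symm
        simp only [map_zero]
        refine Finset.sum_eq_zero fun i _ => Finset.sum_eq_zero fun k _ => ?_
        split_ifs with h
        · have : h ▸ (0 : g.X j) = 0 := by clear this; subst h; rfl
          simp [this]
        · simp
    conv_lhs => rw [← LinearMap.id_apply (R := K) t, key]
    simp

namespace HomBasis

variable (β : HomBasis g)

theorem inc_congr {i j : β.I} (h : i = j) : inc g (β.x i) = inc g (β.x j) := by
  rw [h]

/-- The basis tensors. -/
noncomputable def tv {l : ℕ} (J : Fin l → β.I) : TP g l :=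
  PiTensorProduct.tprod K fun k => inc g (β.x (J k))

/-- The coordinates of a tensor. -/
noncomputable def coord {m : ℕ} (H : Fin m → β.I) : TP g m →ₗ[K] K :=
  PiTensorProduct.lift ((MultilinearMap.mkPiAlgebra K (Fin m) K).compLinearMap
    fun k => functional g (β.θ (H k)))

theorem coord_tprod {m : ℕ} (H : Fin m → β.I) (z : Fin m → Tot g) :
    β.coord H (PiTensorProduct.tprod K z) = ∏ k, functional g (β.θ (H k)) (z k) := by
  rw [coord, PiTensorProduct.lift.tprod]
  simp

theorem coord_tv {m : ℕ} (H J : Fin m → β.I) : β.coord H (β.tv J) = if H = J then 1 else 0 := by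
  rw [tv, coord_tprod]
  simp only [β.pair]
  rw [Finset.prod_ite_zero]
  simp [funext_iff]

theorem tprod_eq {m : ℕ} (z : Fin m → Tot g) : PiTensorProduct.tprod K z =
    ∑ H : Fin m → β.I, (∏ k, functional g (β.θ (H k)) (z k)) • β.tv H := by
  conv_lhs => enter [2, k]; rw [β.expand (z k)]
  rw [MultilinearMap.map_sum]
  refine Finset.sum_congr rfl fun H _ => ?_
  rw [MultilinearMap.map_smul_univ]
  rfl

theorem eq_sum_coord {m : ℕ} (t : TP g m) : t = ∑ H : Fin m → β.I, β.coord H t • β.tv H := by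
  induction t using PiTensorProduct.induction_on with
  | smul_tprod r z =>
    conv_lhs => rw [β.tprod_eq z, Finset.smul_sum]
    refine Finset.sum_congr rfl fun H _ => ?_
    rw [map_smul, coord_tprod, smul_smul, smul_eq_mul]
  | add t t' ht ht' =>
    conv_lhs => rw [ht, ht', ← Finset.sum_add_distrib]
    refine Finset.sum_congr rfl fun H _ => ?_
    rw [map_add, add_smul]

theorem coord_ext {m : ℕ} {t t' : TP g m} (h : ∀ H, β.coord H t = β.coord H t') : t = t' := by
  rw [β.eq_sum_coord t, β.eq_sum_coord t']
  exact Finset.sum_congr rfl fun H _ => by rw [h]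

/-- The matrix entries of a map. -/
noncomputable def ent {l m : ℕ} (L : TP g l →ₗ[K] TP g m) (H : Fin m → β.I) (J : Fin l → β.I) : K :=
  β.coord H (L (β.tv J))

theorem map_tv {l m : ℕ} (L : TP g l →ₗ[K] TP g m) (J : Fin l → β.I) :
    L (β.tv J) = ∑ H, β.ent L H J • β.tv H := β.eq_sum_coord _

theorem coord_map {l m : ℕ} (L : TP g l →ₗ[K] TP g m) (H : Fin m → β.I) (t : TP g l) :
    β.coord H (L t) = ∑ J, β.coord J t * β.ent L H J := by
  conv_lhs => rw [β.eq_sum_coord t, map_sum, map_sum]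
  refine Finset.sum_congr rfl fun J _ => ?_
  rw [map_smul, map_smul, smul_eq_mul, ent]

theorem ent_ext {l m : ℕ} {L L' : TP g l →ₗ[K] TP g m} (h : ∀ H J, β.ent L H J = β.ent L' H J) :
    L = L' := by
  refine LinearMap.ext fun t => β.coord_ext fun H => ?_
  rw [coord_map, coord_map]
  exact Finset.sum_congr rfl fun J _ => by rw [h]

theorem ent_add {l m : ℕ} (L L' : TP g l →ₗ[K] TP g m) (H : Fin m → β.I) (J : Fin l → β.I) :
    β.ent (L + L') H J = β.ent L H J + β.ent L' H J := by simp [ent]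

theorem ent_sub {l m : ℕ} (L L' : TP g l →ₗ[K] TP g m) (H : Fin m → β.I) (J : Fin l → β.I) :
    β.ent (L - L') H J = β.ent L H J - β.ent L' H J := by simp [ent]

theorem ent_smul {l m : ℕ} (c : K) (L : TP g l →ₗ[K] TP g m) (H : Fin m → β.I) (J : Fin l → β.I) :
    β.ent (c • L) H J = c * β.ent L H J := by simp [ent]

theorem ent_sum {ι : Type*} (s : Finset ι) {l m : ℕ} (L : ι → TP g l →ₗ[K] TP g m)
    (H : Fin m → β.I) (J : Fin l → β.I) : β.ent (∑ i ∈ s, L i) H J = ∑ i ∈ s, β.ent (L i) H J := by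
  simp [ent]

theorem ent_comp {l m k : ℕ} (L : TP g m →ₗ[K] TP g k) (L' : TP g l →ₗ[K] TP g m)
    (H : Fin k → β.I) (J : Fin l → β.I) :
    β.ent (L ∘ₗ L') H J = ∑ G, β.ent L' G J * β.ent L H G := by
  rw [ent, LinearMap.comp_apply, coord_map]
  rfl

/-! #### Degrees -/

theorem functional_inc_ne_zero {j : ℤ} {i : β.I} {y : g.X j}
    (h : functional g (β.θ i) (inc g y) ≠ 0) : β.d i = j := by
  by_contra h'
  exact h (functional_inc_of_ne _ _ (by omega))

theorem tv_mem {l : ℕ} (J : Fin l → β.I) : β.tv J ∈ tensorDeg g l (∑ k, β.d (J k)) :=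
  Submodule.subset_span ⟨_, fun k => β.x (J k), rfl, rfl⟩

theorem coord_eq_zero {m : ℕ} {i : ℤ} {t : TP g m} (ht : t ∈ tensorDeg g m i) {H : Fin m → β.I}
    (h : ∑ k, β.d (H k) ≠ i) : β.coord H t = 0 := by
  induction ht using Submodule.span_induction with
  | mem t ht =>
    obtain ⟨c, y, rfl, rfl⟩ := ht
    rw [coord_tprod]
    by_contra h'
    rw [← ne_eq, Finset.prod_ne_zero_iff] at h'
    exact h (Finset.sum_congr rfl fun k _ => β.functional_inc_ne_zero (h' k (Finset.mem_univ _)))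
  | zero => simp
  | add t t' _ _ h1 h2 => rw [map_add, h1, h2, add_zero]
  | smul c t _ h1 => rw [map_smul, h1, smul_zero]

theorem hasDegree_iff {l m : ℕ} (L : TP g l →ₗ[K] TP g m) (k : ℤ) : HasDegree L k ↔
    ∀ (H : Fin m → β.I) (J : Fin l → β.I),
      β.ent L H J ≠ 0 → ∑ j, β.d (H j) = ∑ j, β.d (J j) + k := by
  constructor
  · intro h H J
    contrapose
    exact β.coord_eq_zero (h _ _ (β.tv_mem J))
  · intro h i t ht
    rw [β.eq_sum_coord (L t)]
    refine Submodule.sum_mem _ fun H _ => ?_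
    rw [coord_map, Finset.sum_smul]
    refine Submodule.sum_mem _ fun J _ => ?_
    by_cases h1 : β.ent L H J = 0
    · rw [h1, mul_zero, zero_smul]; exact Submodule.zero_mem _
    · by_cases h2 : ∑ j, β.d (J j) = i
      · rw [← h2, ← h H J h1]
        exact Submodule.smul_mem _ _ (β.tv_mem H)
      · rw [β.coord_eq_zero ht h2, zero_mul, zero_smul]; exact Submodule.zero_mem _

/-! #### Braidings -/

theorem braid_tv {l : ℕ} (σ : Equiv.Perm (Fin l)) (J : Fin l → β.I) :
    braid g σ (β.tv J) = sg K (koszulExp σ (β.d ∘ J)) • β.tv (J ∘ σ) :=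
  braid_tprod g σ _ _

/-- A braiding permutes the basis tensors up to sign, so a single basis tensor, that of `H ∘ ρ`,
contributes to the coordinate H. -/
theorem coord_braid_inv {m : ℕ} (ρ : Equiv.Perm (Fin m)) (H : Fin m → β.I) (t : TP g m) :
    β.coord H (braid g ρ⁻¹ t) = sg K (koszulExp ρ (β.d ∘ H)) * β.coord (H ∘ ρ) t := by
  rw [coord_map, Finset.sum_eq_single (H ∘ ρ)]
  · have key : koszulExp ρ⁻¹ (β.d ∘ H ∘ ρ) = koszulExp ρ (β.d ∘ H) := koszulExp_inv ρ (β.d ∘ H)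
    rw [ent, braid_tv, key, map_smul, coord_tv, smul_eq_mul, mul_comm]
    have : (H ∘ ρ) ∘ (ρ⁻¹ : Equiv.Perm (Fin m)) = H := by
      funext k
      simp
    rw [this, if_pos rfl, mul_one]
  · intro J _ hJ
    rw [ent, braid_tv, map_smul, coord_tv, if_neg, smul_zero, mul_zero]
    rintro rfl
    apply hJ
    funext k
    simp
  · intro h
    exact absurd (Finset.mem_univ _) h

theorem mem_homPM_iff {n : ℤ} {l m : ℕ} (L : TP g l →ₗ[K] TP g m) : L ∈ homPM g n l m ↔
    (∀ σ H J, sg K (koszulExp σ (β.d ∘ J)) * β.ent L H (J ∘ σ) = permSign K 1 σ * β.ent L H J) ∧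
    ∀ ρ H J, sg K (koszulExp ρ (β.d ∘ H)) * β.ent L (H ∘ ρ) J = permSign K n ρ * β.ent L H J := by
  have e1 : ∀ (σ : Equiv.Perm (Fin l)) H J, β.ent (L ∘ₗ braid g σ) H J =
      sg K (koszulExp σ (β.d ∘ J)) * β.ent L H (J ∘ σ) := by
    intro σ H J
    rw [ent, LinearMap.comp_apply, braid_tv, map_smul, map_smul, smul_eq_mul, ent]
  have e2 : ∀ (ρ : Equiv.Perm (Fin m)) H J, β.ent (braid g ρ⁻¹ ∘ₗ L) H J =
      sg K (koszulExp ρ (β.d ∘ H)) * β.ent L (H ∘ ρ) J := by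
    intro ρ H J
    rw [ent, LinearMap.comp_apply, coord_braid_inv, ent]
  have e3 : ∀ ρ : Equiv.Perm (Fin m), permSign K n ρ⁻¹ = permSign K n ρ := by
    intro ρ; rw [permSign, Equiv.Perm.sign_inv, permSign]
  constructor
  · rintro ⟨h1, h2⟩
    refine ⟨fun σ H J => ?_, fun ρ H J => ?_⟩
    · rw [← e1, h1, ent_smul]
    · rw [← e2, h2, ent_smul, e3]
  · rintro ⟨h1, h2⟩
    refine ⟨fun σ => β.ent_ext fun H J => ?_, fun ρ => β.ent_ext fun H J => ?_⟩
    · rw [e1, h1, ent_smul]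
    -- Coordinates are known for braidings by inverses, and every permutation is an inverse with the
    -- same signature.
    · obtain ⟨ρ, rfl⟩ : ∃ ρ', ρ = ρ'⁻¹ := ⟨ρ⁻¹, (inv_inv ρ).symm⟩
      rw [e2, h2, ent_smul, e3]

/-! #### Differentials -/

theorem totTwist_inc (k : ℤ) {i : ℤ} (y : g.X i) : totTwist g k (inc g y) = sg K (k * i) • inc g y := by
  rw [totTwist, inc, DirectSum.toModule_lof]
  rfl

theorem totD_inc {i : ℤ} (y : g.X i) : totD g (inc g y) = inc g ((g.d i (i + 1)).hom y) := by
  rw [totD, inc, DirectSum.toModule_lof]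
  rfl

/-- The matrix entries of the differential. -/
noncomputable def dMat (i j : β.I) : K := functional g (β.θ i) (totD g (inc g (β.x j)))

theorem dMat_ne_zero {i j : β.I} (h : β.dMat i j ≠ 0) : β.d i = β.d j + 1 := by
  rw [dMat, totD_inc] at h
  exact β.functional_inc_ne_zero h

theorem prod_sg (K : Type u) [Field K] {ι : Type*} (s : Finset ι) (f : ι → ℤ) :
    ∏ i ∈ s, sg K (f i) = sg K (∑ i ∈ s, f i) := by
  induction s using Finset.cons_induction with
  | empty => simp [sg_zero]
  | cons a s ha ih => rw [Finset.prod_cons, ih, Finset.sum_cons, sg_add]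

theorem tensorD_tv {l : ℕ} (J : Fin l → β.I) : tensorD g l (β.tv J) =
    ∑ k, ∑ i, (sg K (∑ j, if j < k then β.d (J j) else 0) * β.dMat i (J k)) •
      β.tv (Function.update J k i) := by
  rw [tensorD, LinearMap.sum_apply]
  refine Finset.sum_congr rfl fun k _ => ?_
  rw [tv, PiTensorProduct.map_tprod]
  -- On homogeneous vectors the twists in front of slot k are scalars, so the tensor is a multiple
  -- of one with only slot k changed.
  have h1 : (fun j => (if j < k then totTwist g 1 else if j = k then totD g else LinearMap.id)
      (inc g (β.x (J j)))) = fun j => (if j < k then sg K (β.d (J j)) else 1) •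
        Function.update (fun j => inc g (β.x (J j))) k (totD g (inc g (β.x (J k)))) j := by
    funext j
    by_cases h : j < k
    · simp only [h, if_true, totTwist_inc, Function.update_of_ne h.ne, one_mul]
    · by_cases h' : j = k
      · subst h'; simp
      · simp [h, h']
  rw [h1, MultilinearMap.map_smul_univ, β.expand (totD g (inc g (β.x (J k)))),
    MultilinearMap.map_update_sum, Finset.smul_sum]
  refine Finset.sum_congr rfl fun i _ => ?_
  rw [MultilinearMap.map_update_smul, smul_smul]
  congr 1
  · congr 1
    rw [← prod_sg]
    refine Finset.prod_congr rfl fun j _ => ?_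
    split_ifs <;> simp [sg_zero]
  · rw [tv]
    congr 1
    funext j
    by_cases h : j = k
    · subst h
      rw [Function.update_self]
      exact β.inc_congr (Function.update_self j i J).symm
    · rw [Function.update_of_ne h]
      exact β.inc_congr (Function.update_of_ne h i J).symm

theorem ent_comp_tensorD {l m : ℕ} (L : TP g l →ₗ[K] TP g m) (H : Fin m → β.I) (J : Fin l → β.I) :
    β.ent (L ∘ₗ tensorD g l) H J = ∑ k, ∑ i, sg K (∑ j, if j < k then β.d (J j) else 0) *
      β.dMat i (J k) * β.ent L H (Function.update J k i) := by
  rw [ent, LinearMap.comp_apply, tensorD_tv]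
  simp [ent]

theorem ent_tensorD_comp {l m : ℕ} (L : TP g l →ₗ[K] TP g m) (H : Fin m → β.I) (J : Fin l → β.I) :
    β.ent (tensorD g m ∘ₗ L) H J = ∑ k, ∑ i, sg K (∑ j, if j < k then β.d (H j) else 0) *
      β.dMat (H k) i * β.ent L (Function.update H k i) J := by
  rw [ent_comp]
  -- The entry vanishes unless G and H agree off k. The redundant index i', forced to be `G k`, lets
  -- the sum over G be exchanged for a sum over the k-th entry of a modified H.
  have h : ∀ G, β.ent (tensorD g m) H G = ∑ k, ∑ i, ∑ i', (sg K (∑ j, if j < k then β.d (G j) else 0) *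
      β.dMat i (G k)) * (if i' = G k ∧ i = H k then if G = Function.update H k i' then 1 else 0 else 0) := by
    intro G
    rw [ent, tensorD_tv, map_sum]
    refine Finset.sum_congr rfl fun k _ => ?_
    rw [map_sum]
    refine Finset.sum_congr rfl fun i _ => ?_
    rw [map_smul, coord_tv, Finset.sum_eq_single (G k), smul_eq_mul]
    · congr 1
      by_cases h : H = Function.update G k i
      · rw [if_pos h, if_pos ⟨rfl, by rw [h]; simp⟩, if_pos]
        rw [h]; simp
      · rw [if_neg h]
        by_cases h1 : i = H k
        · rw [if_pos ⟨rfl, h1⟩, if_neg]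
          intro h2
          apply h
          rw [h2, h1]; simp
        · rw [if_neg fun h => h1 h.2]
    · intro i' _ h
      simp [h]
    · intro h
      exact absurd (Finset.mem_univ _) h
  simp only [h, Finset.mul_sum]
  rw [Finset.sum_comm]
  refine Finset.sum_congr rfl fun k _ => ?_
  have h2 : ∀ G i i', β.ent L G J * (sg K (∑ j, if j < k then β.d (G j) else 0) * β.dMat i (G k) *
      (if i' = G k ∧ i = H k then if G = Function.update H k i' then 1 else 0 else 0)) =
      if i = H k then if G = Function.update H k i' then
        sg K (∑ j, if j < k then β.d (H j) else 0) *
      β.dMat (H k) i' * β.ent L (Function.update H k i') J else 0 else 0 := by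
    intro G i i'
    by_cases h1 : i = H k
    · by_cases h3 : G = Function.update H k i'
      · subst h1 h3
        have : (∑ j, if j < k then β.d (Function.update H k i' j) else 0) =
            ∑ j, if j < k then β.d (H j) else 0 := by
          refine Finset.sum_congr rfl fun j _ => ?_
          split_ifs with hj
          · rw [Function.update_of_ne hj.ne]
          · rfl
        simp [this]
        ring
      · simp [h3]
    · simp [h1]
  simp only [h2]
  rw [Finset.sum_comm, Finset.sum_eq_single (H k)]
  · rw [Finset.sum_comm]
    refine Finset.sum_congr rfl fun i _ => ?_
    simp
  · intro i _ hi
    simp [hi]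
  · intro h
    exact absurd (Finset.mem_univ _) h

/-! #### Grafting -/

theorem cast_tv {l l' : ℕ} (h : l = l') (J : Fin l → β.I) :
    TensorPower.cast K (Tot g) h (β.tv J) = β.tv (J ∘ Fin.cast h.symm) := by
  rw [tv, TensorPower.cast_tprod]
  rfl

theorem mulEquiv_tv {a b : ℕ} (J : Fin a → β.I) (J' : Fin b → β.I) :
    TensorPower.mulEquiv (R := K) (M := Tot g) (β.tv J ⊗ₜ[K] β.tv J') = β.tv (Fin.append J J') := by
  have := TensorPower.tprod_mul_tprod K (fun k => inc g (β.x (J k))) fun k => inc g (β.x (J' k))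
  rw [TensorPower.gMul_def] at this
  refine this.trans ?_
  rw [tv]
  congr 1
  funext k
  refine Fin.addCases (fun k => ?_) (fun k => ?_) k
  · rw [Fin.append_left]
    exact β.inc_congr (Fin.append_left J J' k).symm
  · rw [Fin.append_right]
    exact β.inc_congr (Fin.append_right J J' k).symm

theorem ent_castHom {l l' m m' : ℕ} (hl : l = l') (hm : m = m') (L : TP g l →ₗ[K] TP g m)
    (H : Fin m' → β.I) (J : Fin l' → β.I) :
    β.ent (castHom hl hm L) H J = β.ent L (H ∘ Fin.cast hm) (J ∘ Fin.cast hl) := by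
  subst hl hm
  simp [castHom, ent]

theorem append_eq_append {a b : ℕ} {X : Type*} {f f' : Fin a → X} {h h' : Fin b → X} :
    Fin.append f h = Fin.append f' h' ↔ f = f' ∧ h = h' := by
  constructor
  · intro e
    constructor
    · funext i
      simpa using congrFun e (Fin.castAdd b i)
    · funext i
      simpa using congrFun e (Fin.natAdd a i)
  · rintro ⟨rfl, rfl⟩
    rfl

/-- Composition sums over the basis vector i in the one shared slot; the other outputs of L' pass
through unchanged, which forces them to equal H'. -/
theorem ent_graft {a b p q : ℕ} (k : ℤ) (L : TP g (a + 1) →ₗ[K] TP g (p + 1))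
    (L' : TP g b →ₗ[K] TP g (q + 1)) (H : Fin (p + 1) → β.I) (H' : Fin q → β.I) (J : Fin a → β.I)
    (J' : Fin b → β.I) : β.ent (graft k L L') (Fin.append H H') (Fin.append J J') =
      sg K (k * ∑ r, β.d (J r)) *
        ∑ i, β.ent L H (Fin.snoc J i) * β.ent L' (Fin.cons i H') J' := by
  have e1 : (PiTensorProduct.map fun _ : Fin a => totTwist g k) (β.tv J) =
      sg K (k * ∑ r, β.d (J r)) • β.tv J := by
    rw [tv, PiTensorProduct.map_tprod]
    simp only [totTwist_inc]
    rw [MultilinearMap.map_smul_univ, prod_sg, Finset.mul_sum]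
  -- Rebracketing: the first output of L' is also the entry following J, that is, the last input of
  -- L.
  have e2 : ∀ (i : β.I) (G : Fin q → β.I),
      Fin.append J (Fin.cons i G : Fin (q + 1) → β.I) ∘
        Fin.cast (show a + (q + 1) = a + 1 + q by omega).symm =
      Fin.append (Fin.snoc J i : Fin (a + 1) → β.I) G := by
    intro i G
    rw [Fin.append_right_cons, Function.comp_assoc]
    rfl
  rw [ent, graft]
  simp only [LinearMap.comp_apply, LinearEquiv.coe_coe]
  rw [← mulEquiv_tv, LinearEquiv.symm_apply_apply, TensorProduct.map_tmul, e1, β.map_tv L',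
    TensorProduct.tmul_sum]
  simp only [map_sum, TensorProduct.tmul_smul, ← TensorProduct.smul_tmul', map_smul, mulEquiv_tv,
    cast_tv]
  rw [← (Fin.consEquiv fun _ : Fin (q + 1) => β.I).sum_comp (M := K), Fintype.sum_prod_type,
    Finset.mul_sum _ _ (sg K _)]
  refine Finset.sum_congr rfl fun i _ => ?_
  simp only [Fin.consEquiv, Equiv.coe_fn_mk]
  rw [Finset.sum_eq_single H']
  · rw [e2, ← mulEquiv_tv, LinearEquiv.symm_apply_apply, TensorProduct.map_tmul, β.map_tv L,
      TensorProduct.sum_tmul]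
    simp only [LinearMap.id_apply, ← TensorProduct.smul_tmul', map_smul, map_sum, mulEquiv_tv,
      coord_tv, append_eq_append, and_true, smul_eq_mul, mul_ite, mul_one, mul_zero,
      Finset.sum_ite_eq, Finset.mem_univ, if_true]
    ring
  · intro G _ hG
    rw [e2, ← mulEquiv_tv, LinearEquiv.symm_apply_apply, TensorProduct.map_tmul, β.map_tv L,
      TensorProduct.sum_tmul]
    simp only [LinearMap.id_apply, map_smul, map_sum, ← TensorProduct.smul_tmul', mulEquiv_tv,
      coord_tv, append_eq_append, hG.symm, and_false, if_false, smul_zero, Finset.sum_const_zero]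
  · intro h
    exact absurd (Finset.mem_univ _) h

theorem ent_shuffleComp (n : ℤ) {a b p q : ℕ} (k : ℤ) (L : TP g (a + 1) →ₗ[K] TP g (p + 1))
    (L' : TP g b →ₗ[K] TP g (q + 1)) (H : Fin (p + 1 + q) → β.I) (J : Fin (a + b) → β.I) :
    β.ent (shuffleComp n k L L') H J = ∑ σ ∈ shuffles a b, ∑ ρ ∈ shuffles (p + 1) q,
      permSign K 1 σ * permSign K n ρ * (sg K (koszulExp ρ (β.d ∘ H)) *
        (sg K (koszulExp σ (β.d ∘ J)) * (sg K (k * ∑ r, β.d (J (σ (Fin.castAdd b r)))) *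
        ∑ i, β.ent L (fun r => H (ρ (Fin.castAdd q r))) (Fin.snoc (fun r => J (σ (Fin.castAdd b r))) i) *
          β.ent L' (Fin.cons i fun r => H (ρ (Fin.natAdd (p + 1) r)))
            fun r => J (σ (Fin.natAdd a r))))) := by
  rw [shuffleComp, ent_sum]
  refine Finset.sum_congr rfl fun σ _ => ?_
  rw [ent_sum]
  refine Finset.sum_congr rfl fun ρ _ => ?_
  rw [ent_smul, ent, LinearMap.comp_apply, coord_braid_inv, LinearMap.comp_apply, braid_tv, map_smul,
    map_smul, smul_eq_mul, ← ent_graft]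
  congr 3
  rw [ent, ← Fin.append_castAdd_natAdd (f := H ∘ ρ), ← Fin.append_castAdd_natAdd (f := J ∘ σ)]
  rfl

end HomBasis

end Coordinates

/-! ### The algebra of polyvectors: projections and derivations -/

section PolGCA

variable {K : Type u} [Field K] (A : GCA.{u, w} K) (n : ℤ)

/-- The polyvectors as a graded-commutative algebra. -/
noncomputable abbrev polGCA : GCA.{u, max u w} K where
  carrier := Pol A n
  deg := (polPres A n).degPart
  comm _ _ _ _ ha hb := GradedPres.mul_comm' ha hb

variable {A}

theorem ad_mem_der (x : PolGen A) : Pol.ad n x ∈ (polGCA A n).Der (PolGen.dg n x - (n + 1)) :=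
  ⟨fun _ _ ha => Pol.ad_mem x ha, fun _ _ ha b => (Pol.adData n x).der_mul ha b⟩

theorem schouten_mem_der {p : ℤ} (P : (polPres A n).degPart p) :
    Pol.schouten P ∈ (polGCA A n).Der (p - (n + 1)) :=
  ⟨fun _ _ ha => (Pol.schData P).der_mem ha, fun _ _ ha b => (Pol.schData P).der_mul ha b⟩

theorem smul_mem_der {B : GCA.{u, w} K} {k : ℤ} {D : B.carrier →ₗ[K] B.carrier} (c : K)
    (h : D ∈ B.Der k) : c • D ∈ B.Der k := Submodule.smul_mem _ _ h

/-- The projection of the polyvectors onto the functions. -/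
def polProj : Pol A n →ₐ[K] A.carrier :=
  (polPres A n).lift (FreeAlgebra.lift K fun x => match x with
    | .fn _ a => a.1
    | .vf _ _ => 0) (by
      intro x y h
      cases h with
      | of h => cases h <;> simp
      | comm x y =>
        cases x with
        | fn i a =>
          cases y with
          | fn j b => simpa [PolGen.dg] using A.comm i j a.1 b.1 a.2 b.2
          | vf k D => simp
        | vf k D => simp)

theorem polProj_fn {j : ℤ} (a : A.deg j) : polProj n (Pol.fn n a) = a.1 := by
  refine (GradedPres.lift_mk (P := polPres A n) _ _ _).trans ?_
  rw [FreeAlgebra.lift_ι_apply]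

theorem polProj_vf {k : ℤ} (D : A.Der k) : polProj n (Pol.vf n D) = 0 := by
  refine (GradedPres.lift_mk (P := polPres A n) _ _ _).trans ?_
  rw [FreeAlgebra.lift_ι_apply]

theorem vf_sum {ι : Type*} (s : Finset ι) {k : ℤ} (D : ι → A.Der k) :
    Pol.vf n (∑ i ∈ s, D i) = ∑ i ∈ s, Pol.vf n (D i) := by
  induction s using Finset.cons_induction with
  | empty => exact Pol.vf_zero
  | cons a s ha ih => rw [Finset.sum_cons, Pol.vf_add, ih, Finset.sum_cons]

/-- Bracketing with a function a turns the class of D into ± D(a), which the projection to functions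
reads off; homogeneous a span. -/
theorem vf_injective {k : ℤ} {D D' : A.Der k} (h : Pol.vf n D = Pol.vf n D') : D = D' := by
  have key : ∀ {j : ℤ} (a : A.deg j), D.1 a.1 = D'.1 a.1 := by
    intro j a
    have h1 := congrArg (fun P => polProj n (Pol.ad n (.fn j a) P)) h
    simp only [Pol.ad_vf, Pol.genBracket, map_neg, map_smul, polProj_fn, Pol.ev, neg_inj] at h1
    have h2 := congrArg (fun P => sg K (j * k) • P) h1
    simpa [smul_smul, sg_mul_self] using h2
  refine Subtype.ext (LinearMap.ext fun a => ?_)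
  classical
  rw [← DirectSum.sum_support_decompose A.deg a, map_sum, map_sum]
  exact Finset.sum_congr rfl fun i _ => key _

end PolGCA

/-! ### Augmentation of the polyvectors and inclusion of the functions. -/

section SymPol

variable {K : Type u} [Field K] {g : CochainComplex (ModuleCat.{v} K) ℤ}

/-- The augmentation of `Sym(V)`. -/
def symAug (V : CochainComplex (ModuleCat.{w} K) ℤ) : (symPres V).Alg →ₐ[K] K :=
  (symPres V).lift (FreeAlgebra.lift K fun _ => 0) (by
    intro x y h
    cases h with
    | of h => cases h <;> simp
    | comm x y => simp)

theorem symAug_gen (V : CochainComplex (ModuleCat.{w} K) ℤ) {i : ℤ} (x : V.X i) :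
    symAug V (symGen V x) = 0 := by
  refine (GradedPres.lift_mk (P := symPres V) _ _ _).trans ?_
  rw [FreeAlgebra.lift_ι_apply]

theorem symAug_of_ne (V : CochainComplex (ModuleCat.{w} K) ℤ) {i : ℤ} {a : (symPres V).Alg}
    (ha : a ∈ (symPres V).degPart i) (hi : i ≠ 0) : symAug V a = 0 := by
  refine GradedPres.degInd (P := symPres V) (p := fun i a => i ≠ 0 → symAug V a = 0) ?_ ?_ ?_ ?_ ?_ ha hi
  · intro i _; simp
  · intro h; exact absurd rfl h
  · intro x i a _ _ _
    rw [map_mul]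
    exact mul_eq_zero_of_left (symAug_gen V x.2) _
  · intro i a b h1 h2 h; rw [map_add, h1 h, h2 h, add_zero]
  · intro i c a h1 h; rw [map_smul, h1 h, smul_zero]

variable (g) (n : ℤ)

/-- The augmentation of the polyvectors on `Sym(g*[-1])`. -/
noncomputable def polAug : Pol (symDual g).toGCA n →ₐ[K] K :=
  (symAug (shiftedDual g)).comp (polProj n)

theorem polProj_mem {A : GCA.{u, w} K} {i : ℤ} {P : Pol A n} (hP : P ∈ (polPres A n).degPart i) :
    polProj n P ∈ A.deg i := by
  refine GradedPres.degInd (P := polPres A n) (p := fun i P => polProj n P ∈ A.deg i) ?_ ?_ ?_ ?_ ?_ hP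
  · intro i; rw [map_zero]; exact Submodule.zero_mem _
  · rw [map_one]; exact SetLike.GradedOne.one_mem
  · intro x i a _ h
    rw [map_mul]
    cases x with
    | fn j b =>
      change polProj n (Pol.fn n b) * _ ∈ _
      rw [polProj_fn]
      exact A.mul_mem b.2 h
    | vf k D =>
      change polProj n (Pol.vf n D) * _ ∈ _
      rw [polProj_vf, zero_mul]
      exact Submodule.zero_mem _
  · intro i a b h1 h2; rw [map_add]; exact Submodule.add_mem _ h1 h2
  · intro i c a h; rw [map_smul]; exact Submodule.smul_mem _ _ h

theorem polAug_of_ne {i : ℤ} {P : Pol (symDual g).toGCA n}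
    (hP : P ∈ (polPres (symDual g).toGCA n).degPart i) (hi : i ≠ 0) : polAug g n P = 0 :=
  symAug_of_ne (shiftedDual g) (polProj_mem n hP) hi

theorem polAug_vf {k : ℤ} (D : (symDual g).Der k) : polAug g n (Pol.vf n D) = 0 := by
  exact (congrArg (symAug (shiftedDual g)) (polProj_vf n D)).trans (map_zero _)

theorem polAug_fn {i : ℤ} (θ : (shiftedDual g).X i) : polAug g n (Pol.fn n (dualGen g θ)) = 0 := by
  exact (congrArg (symAug (shiftedDual g)) (polProj_fn n (dualGen g θ))).trans (symAug_gen _ _)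

/-- The inclusion of the functions in the polyvectors. -/
noncomputable def polIncl : (symPres (shiftedDual g)).Alg →ₐ[K] Pol (symDual g).toGCA n :=
  (symPres (shiftedDual g)).lift (FreeAlgebra.lift K fun x => Pol.fn n (dualGen g x.2)) (by
    intro x y h
    cases h with
    | of h =>
      cases h with
      | add i a b =>
        rw [map_add]
        simp only [FreeAlgebra.lift_ι_apply]
        rw [← Pol.fn_add]
        congr 1
        exact Subtype.ext (symGen_add a b)
      | smul i c a =>
        rw [map_smul]
        simp only [FreeAlgebra.lift_ι_apply]
        rw [← Pol.fn_smul]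
        congr 1
        exact Subtype.ext (symGen_smul c a)
    | comm x y =>
      rw [map_mul, map_smul, map_mul]
      simp only [FreeAlgebra.lift_ι_apply]
      exact GradedPres.gen_mul_gen (P := polPres (symDual g).toGCA n) _ _)

theorem polIncl_gen {i : ℤ} (θ : (shiftedDual g).X i) :
    polIncl g n (symGen (shiftedDual g) θ) = Pol.fn n (dualGen g θ) := by
  refine (GradedPres.lift_mk (P := symPres (shiftedDual g)) _ _ _).trans ?_
  rw [FreeAlgebra.lift_ι_apply]

/-- The classes `fn` exist only for homogeneous elements, degree by degree. Identifying them with an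
algebra map on all of A makes scalars and products computable. -/
theorem polIncl_eq {j : ℤ} (a : (symDual g).deg j) : polIncl g n a.1 = Pol.fn n a := by
  obtain ⟨a, ha⟩ := a
  -- The membership proof is part of the predicate because the induction changes the element while
  -- its class depends on the proof.
  have key : ∃ ha : a ∈ (symDual g).deg j, polIncl g n a = Pol.fn n ⟨a, ha⟩ := by
    refine GradedPres.degInd (P := symPres (shiftedDual g)) (p := fun j a =>
      ∃ ha : a ∈ (symDual g).deg j, polIncl g n a = Pol.fn n ⟨a, ha⟩) ?_ ?_ ?_ ?_ ?_ ha
    · intro i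
      refine ⟨Submodule.zero_mem _, ?_⟩
      rw [map_zero]
      exact (Pol.fn_zero (n := n)).symm
    · refine ⟨GradedPres.one_mem, ?_⟩
      rw [map_one]
      exact Pol.fn_one.symm
    · rintro x i a _ ⟨ha, ih⟩
      refine ⟨(symDual g).mul_mem (dualGen g x.2).2 ha, ?_⟩
      rw [map_mul, ih]
      refine (congrArg (fun z => z * _) (polIncl_gen g n x.2)).trans ?_
      exact Pol.fn_mul (dualGen g x.2) ⟨a, ha⟩
    · rintro i a b ⟨ha, h1⟩ ⟨hb, h2⟩
      refine ⟨Submodule.add_mem _ ha hb, ?_⟩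
      rw [map_add, h1, h2]
      exact (Pol.fn_add (⟨a, ha⟩ : (symDual g).deg i) ⟨b, hb⟩).symm
    · rintro i c a ⟨ha, h1⟩
      refine ⟨Submodule.smul_mem _ _ ha, ?_⟩
      rw [map_smul, h1]
      exact (Pol.fn_smul c (⟨a, ha⟩ : (symDual g).deg i)).symm
  exact key.2

end SymPol

/-! ### Generation by the dual basis and the constant vector fields -/

section Generation

variable {K : Type u} [Field K] {g : CochainComplex (ModuleCat.{v} K) ℤ}

theorem functional_injective {b : ℤ} {θ θ' : (shiftedDual g).X b}
    (h : functional g θ = functional g θ') : θ = θ' := by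
  have h1 : (show Module.Dual K (g.X (-(b + -1))) from θ) = θ' := by
    refine LinearMap.ext fun y => ?_
    have e : ∀ θ : (shiftedDual g).X b, functional g θ (inc g y) =
        (show Module.Dual K (g.X (-(b + -1))) from θ) y := by
      intro θ
      rw [functional, LinearMap.comp_apply, DirectSum.component.lof_self]
    exact (e θ).symm.trans ((LinearMap.congr_fun h (inc g y)).trans (e θ'))
  exact h1

/-- The functional as a linear map. -/
noncomputable def functionalHom (g : CochainComplex (ModuleCat.{v} K) ℤ) (b : ℤ) :
    (shiftedDual g).X b →ₗ[K] (Tot g →ₗ[K] K) where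
  toFun θ := functional g θ
  map_add' _ _ := rfl
  map_smul' _ _ := rfl

/-- This is the expansion of θ in the dual basis. The basis elements live in degrees 1 - d_i rather
than in b, so they are compared after linear maps into one module; terms of the wrong degree have
coefficient zero. -/
theorem eval_smul_cast (β : HomBasis g) {b : ℤ} {X : Type*} [AddCommGroup X] [Module K X]
    (f : ∀ b, (shiftedDual g).X b →ₗ[K] X) (θ : (shiftedDual g).X b) :
    f b θ = ∑ i, functional g θ (inc g (β.x i)) • f (1 - β.d i) (β.θ i) := by
  have h1 : θ = ∑ i, functional g θ (inc g (β.x i)) •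
      if h : 1 - β.d i = b then (h ▸ β.θ i : (shiftedDual g).X b) else 0 := by
    apply functional_injective
    change functionalHom g b θ = functionalHom g b _
    rw [map_sum]
    refine LinearMap.ext fun t => ?_
    conv_lhs => rw [β.expand t, map_sum]
    rw [LinearMap.sum_apply]
    refine Finset.sum_congr rfl fun i _ => ?_
    rw [map_smul, map_smul, LinearMap.smul_apply, smul_eq_mul, smul_eq_mul, mul_comm]
    by_cases h : 1 - β.d i = b
    · subst h
      simp only [dite_true]
      rfl
    · have : functional g θ (inc g (β.x i)) = 0 := functional_inc_of_ne _ _ (by omega)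
      change functional g θ (inc g (β.x i)) * functional g (β.θ i) t = _
      rw [this, zero_mul, zero_mul]
  conv_lhs => rw [h1, map_sum]
  refine Finset.sum_congr rfl fun i _ => ?_
  rw [map_smul]
  by_cases h : 1 - β.d i = b
  · subst h
    simp
  · have : functional g θ (inc g (β.x i)) = 0 := functional_inc_of_ne _ _ (by omega)
    rw [this, zero_smul, zero_smul]

/-- The generators as a linear map. -/
noncomputable def symGenHom (V : CochainComplex (ModuleCat.{w} K) ℤ) (b : ℤ) :
    V.X b →ₗ[K] (symPres V).Alg where
  toFun := symGen V
  map_add' := symGen_add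
  map_smul' := symGen_smul

theorem symGen_eq_sum (β : HomBasis g) {b : ℤ} (θ : (shiftedDual g).X b) :
    symGen (shiftedDual g) θ =
      ∑ i, functional g θ (inc g (β.x i)) • symGen (shiftedDual g) (β.θ i) :=
  eval_smul_cast β (symGenHom (shiftedDual g)) θ

/-- A derivation is determined by its values on the generators, hence D = ∑ D(sθ_i) ∂_{x_i}. Each
summand has degree k only after arithmetic, hence the repackaging. -/
theorem der_eq_sum (β : HomBasis g) {k : ℤ} (D : (symDual g).Der k) :
    D = ∑ i, (⟨(GCA.act (Pol.ev D (dualGen g (β.θ i))) (constDer g (β.x i))).1,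
      Pol.mem_congr (S := (symDual g).Der) (by ring)
        (GCA.act (Pol.ev D (dualGen g (β.θ i))) (constDer g (β.x i))).2⟩ : (symDual g).Der k) := by
  set D' := ∑ i, (⟨(GCA.act (Pol.ev D (dualGen g (β.θ i))) (constDer g (β.x i))).1,
      Pol.mem_congr (S := (symDual g).Der) (by ring)
        (GCA.act (Pol.ev D (dualGen g (β.θ i))) (constDer g (β.x i))).2⟩ : (symDual g).Der k)
    with hD'
  refine Subtype.ext (LinearMap.ext fun a => ?_)
  refine GradedPres.der_ext (P := symPres (shiftedDual g)) (e := k) (D := D.1) (D' := D'.1)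
    D.1.isLinear D'.1.isLinear (GCA.Der.one D.2) (GCA.Der.one D'.2) ?_ ?_ ?_ a
  · intro x a
    exact D.2.2 _ _ (GradedPres.gen_mem (P := symPres (shiftedDual g)) x) a
  · intro x a
    exact D'.2.2 _ _ (GradedPres.gen_mem (P := symPres (shiftedDual g)) x) a
  · rintro ⟨b, θ⟩
    have h1 : D'.1 (symGen (shiftedDual g) θ) = ∑ i, D.1 (symGen (shiftedDual g) (β.θ i)) *
        (constDer g (β.x i)).1 (symGen (shiftedDual g) θ) := by
      rw [hD', Submodule.coe_sum]
      exact LinearMap.sum_apply _ _ _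
    refine Eq.trans ?_ h1.symm
    change D.1 (symGen (shiftedDual g) θ) = _
    refine (congrArg D.1 (symGen_eq_sum β θ)).trans ((map_sum D.1 _ _).trans ?_)
    refine Finset.sum_congr rfl fun i _ => ?_
    rw [constDer_gen]
    refine (map_smul D.1 _ _).trans ?_
    refine (Algebra.smul_def _ _).trans ?_
    exact Algebra.commutes _ _

namespace HomBasis

variable (β : HomBasis g) (n : ℤ)

/-- The coordinate functions as polyvectors. -/
noncomputable def e (i : β.I) : Pol (symDual g).toGCA n := Pol.fn n (dualGen g (β.θ i))

/-- The coordinate vector fields as polyvectors. -/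
noncomputable def f (i : β.I) : Pol (symDual g).toGCA n := Pol.vf n (constDer g (β.x i))

theorem e_mem (i : β.I) : β.e n i ∈ (polPres (symDual g).toGCA n).degPart (1 - β.d i) :=
  Pol.fn_mem _

theorem f_mem (i : β.I) : β.f n i ∈ (polPres (symDual g).toGCA n).degPart (β.d i + n) :=
  Pol.mem_congr (S := (polPres (symDual g).toGCA n).degPart) (by ring) (Pol.vf_mem _)

theorem vf_eq_sum {k : ℤ} (D : (symDual g).Der k) : Pol.vf n D =
    ∑ i, sg K ((1 - β.d i + k) * (n + 1)) •
      (Pol.fn n (Pol.ev D (dualGen g (β.θ i))) * β.f n i) := by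
  conv_lhs => rw [der_eq_sum β D, vf_sum]
  refine Finset.sum_congr rfl fun i _ => ?_
  rw [f, ← Pol.vf_act]
  exact Pol.vf_congr (by ring) rfl

theorem polIncl_mem_adjoin (a : (symPres (shiftedDual g)).Alg) :
    polIncl g n a ∈ Algebra.adjoin K (Set.range (β.e n)) := by
  induction a using GradedPres.ind with
  | one => rw [map_one]; exact Subalgebra.one_mem _
  | gen_mul x a ih =>
    rw [map_mul]
    refine Subalgebra.mul_mem _ ?_ ih
    change polIncl g n (symGen (shiftedDual g) x.2) ∈ _
    rw [symGen_eq_sum β, map_sum]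
    refine Subalgebra.sum_mem _ fun i _ => ?_
    rw [map_smul, polIncl_gen]
    exact Subalgebra.smul_mem _ (Algebra.subset_adjoin (Set.mem_range_self i)) _
  | add a b ha hb => rw [map_add]; exact Subalgebra.add_mem _ ha hb
  | smul c a ha => rw [map_smul]; exact Subalgebra.smul_mem _ ha _

theorem fn_mem_adjoin {j : ℤ} (a : (symDual g).deg j) :
    Pol.fn n a ∈ Algebra.adjoin K (Set.range (β.e n)) := by
  rw [← polIncl_eq]
  exact β.polIncl_mem_adjoin n _

/-- Induction on polyvectors by left multiplication with the coordinates. -/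
theorem pol_ind {p : Pol (symDual g).toGCA n → Prop} (one : p 1) (e_mul : ∀ i a, p a → p (β.e n i * a))
    (f_mul : ∀ i a, p a → p (β.f n i * a)) (add : ∀ a b, p a → p b → p (a + b))
    (smul : ∀ (c : K) a, p a → p (c • a)) (a : Pol (symDual g).toGCA n) : p a := by
  have hsum : ∀ (z : β.I → Pol (symDual g).toGCA n), (∀ i, p (z i)) → p (∑ i, z i) := by
    intro z hz
    refine Finset.sum_induction z p add ?_ fun i _ => hz i
    simpa using smul 0 1 one
  have hfn : ∀ x ∈ Algebra.adjoin K (Set.range (β.e n)), ∀ b, p b → p (x * b) := by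
    intro x hx
    induction hx using Algebra.adjoin_induction with
    | mem x hx =>
      obtain ⟨i, rfl⟩ := hx
      exact e_mul i
    | algebraMap r => intro b hb; rw [← Algebra.smul_def]; exact smul r b hb
    | add x y _ _ hx hy => intro b hb; rw [add_mul]; exact add _ _ (hx b hb) (hy b hb)
    | mul x y _ _ hx hy => intro b hb; rw [mul_assoc]; exact hx _ (hy b hb)
  induction a using GradedPres.ind with
  | one => exact one
  | gen_mul x a ih =>
    cases x with
    | fn j b => exact hfn _ (β.fn_mem_adjoin n b) _ ih
    | vf k D =>
      change p (Pol.vf n D * a)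
      -- A vector field is a combination of functions times coordinate vector fields, so
      -- multiplication by coordinates suffices.
      rw [β.vf_eq_sum, Finset.sum_mul]
      refine hsum _ fun i => ?_
      rw [smul_mul_assoc, mul_assoc]
      exact smul _ _ (hfn _ (β.fn_mem_adjoin n _) _ (f_mul i a ih))
  | add a b ha hb => exact add a b ha hb
  | smul c a ha => exact smul c a ha

/-- A derivation that kills the coordinates is zero. -/
theorem der_eq_zero {k : ℤ} {D : Pol (symDual g).toGCA n →ₗ[K] Pol (symDual g).toGCA n}
    (hD : D ∈ (polGCA (symDual g).toGCA n).Der k) (he : ∀ i, D (β.e n i) = 0)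
    (hf : ∀ i, D (β.f n i) = 0) : D = 0 := by
  refine LinearMap.ext fun a => ?_
  induction a using β.pol_ind n with
  | one => exact GCA.Der.one hD
  | e_mul i a h =>
    refine (hD.2 _ _ (β.e_mem n i) a).trans ?_
    rw [he, h]; simp
  | f_mul i a h =>
    refine (hD.2 _ _ (β.f_mem n i) a).trans ?_
    rw [hf, h]; simp
  | add a b ha hb => rw [map_add, ha, hb, map_add]
  | smul c a ha => rw [map_smul, ha, map_smul]

theorem der_ext {k : ℤ} {D D' : Pol (symDual g).toGCA n →ₗ[K] Pol (symDual g).toGCA n}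
    (hD : D ∈ (polGCA (symDual g).toGCA n).Der k) (hD' : D' ∈ (polGCA (symDual g).toGCA n).Der k)
    (he : ∀ i, D (β.e n i) = D' (β.e n i)) (hf : ∀ i, D (β.f n i) = D' (β.f n i)) : D = D' := by
  refine sub_eq_zero.1 (β.der_eq_zero n (k := k) (Submodule.sub_mem _ hD hD') ?_ ?_)
  · intro i; rw [LinearMap.sub_apply, he, sub_self]
  · intro i; rw [LinearMap.sub_apply, hf, sub_self]

end HomBasis

end Generation

/-! ### The coordinate derivations -/

section Operators

variable {K : Type u} [Field K] {g : CochainComplex (ModuleCat.{v} K) ℤ} (n : ℤ)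

theorem fn_constDer {i j : ℤ} (x : g.X j) (θ : (shiftedDual g).X i) :
    Pol.fn n (Pol.ev (constDer g x) (dualGen g θ)) =
      functional g θ (inc g x) • (1 : Pol (symDual g).toGCA n) := by
  rw [← polIncl_eq]
  change polIncl g n ((constDer g x).1 (symGen (shiftedDual g) θ)) = _
  rw [constDer_gen, AlgHom.commutes, Algebra.algebraMap_eq_smul_one]

/-- Each of the two derivations sends generators to scalars, and the other one kills scalars. -/
theorem bracket_constDer {i j : ℤ} (x : g.X i) (y : g.X j) :
    GCA.bracket (constDer g x) (constDer g y) = 0 := by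
  refine Subtype.ext (LinearMap.ext fun a => ?_)
  set D := GCA.bracket (constDer g x) (constDer g y)
  refine GradedPres.der_ext (P := symPres (shiftedDual g)) (e := i - 1 + (j - 1)) (D := D.1) (D' := 0)
    D.1.isLinear (0 : _ →ₗ[K] _).isLinear (GCA.Der.one D.2) rfl ?_ ?_ ?_ a
  · intro x a
    exact D.2.2 _ _ (GradedPres.gen_mem (P := symPres (shiftedDual g)) x) a
  · intro x a
    simp
  · rintro ⟨b, θ⟩
    have h : ∀ {k : ℤ} (z : g.X k) (c : K),
        (constDer g z).1 (algebraMap K (symPres (shiftedDual g)).Alg c) = 0 := by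
      intro k z c
      rw [Algebra.algebraMap_eq_smul_one]
      refine (map_smul (constDer g z).1 c _).trans ?_
      refine (congrArg (fun t => c • t) (GCA.Der.one (constDer g z).2)).trans (smul_zero _)
    change (constDer g x).1 ((constDer g y).1 (symGen (shiftedDual g) θ)) -
      sg K ((i - 1) * (j - 1)) • (constDer g y).1 ((constDer g x).1 (symGen (shiftedDual g) θ)) = 0
    rw [constDer_gen, constDer_gen, h, h]
    refine (congrArg (fun t => _ - t) (smul_zero _)).trans (sub_zero _)

namespace HomBasis

variable (β : HomBasis g)

/-- The derivation dual to the coordinate vector field `f i`. -/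
noncomputable def opE (i : β.I) : Module.End K (Pol (symDual g).toGCA n) :=
  sg K (β.d i) • Pol.ad n (.fn (1 - β.d i) (dualGen g (β.θ i)))

/-- The derivation dual to the coordinate function `e i`. -/
noncomputable def opF (i : β.I) : Module.End K (Pol (symDual g).toGCA n) :=
  sg K ((β.d i - 1) * (n + 1)) • Pol.ad n (.vf (β.d i - 1) (constDer g (β.x i)))

theorem opE_mem (i : β.I) : β.opE n i ∈ (polGCA (symDual g).toGCA n).Der (-(β.d i + n)) :=
  smul_mem_der _ (Pol.mem_congr (S := (polGCA (symDual g).toGCA n).Der)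
    (by simp only [PolGen.dg]; ring) (ad_mem_der n _))

theorem opF_mem (i : β.I) : β.opF n i ∈ (polGCA (symDual g).toGCA n).Der (β.d i - 1) :=
  smul_mem_der _ (Pol.mem_congr (S := (polGCA (symDual g).toGCA n).Der)
    (by simp only [PolGen.dg]; ring) (ad_mem_der n _))

theorem opE_fn (i : β.I) {j : ℤ} (a : (symDual g).deg j) : β.opE n i (Pol.fn n a) = 0 := by
  rw [opE, LinearMap.smul_apply, Pol.ad_fn]
  exact smul_zero _

theorem opE_vf (i : β.I) {j : ℤ} (x : g.X j) :
    β.opE n i (Pol.vf n (constDer g x)) = functional g (β.θ i) (inc g x) • 1 := by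
  rw [opE, LinearMap.smul_apply, Pol.ad_vf]
  simp only [Pol.genBracket]
  rw [fn_constDer, smul_neg, smul_smul, smul_smul]
  by_cases h : functional g (β.θ i) (inc g x) = 0
  · simp [h]
  -- A nonzero pairing forces the degree of x to be d_i; the total exponent is then even because d_i
  -- (d_i - 1) is.
  · obtain rfl := β.functional_inc_ne_zero h
    rw [← neg_smul, ← sg_add, ← neg_mul, neg_sg, sg_even, one_mul]
    have := Int.even_mul_pred_self (β.d i)
    rw [show β.d i + (1 - β.d i) * (β.d i - 1) + 1 =
      2 * β.d i - β.d i * (β.d i - 1) by ring]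
    exact (even_two_mul _).sub this

theorem opF_fn (i : β.I) {j : ℤ} (θ : (shiftedDual g).X j) :
    β.opF n i (Pol.fn n (dualGen g θ)) = functional g θ (inc g (β.x i)) • 1 := by
  rw [opF, LinearMap.smul_apply, Pol.ad_fn]
  simp only [Pol.genBracket]
  rw [fn_constDer, smul_smul, sg_mul_self, one_smul]

theorem opF_vf (i : β.I) {j : ℤ} (x : g.X j) : β.opF n i (Pol.vf n (constDer g x)) = 0 := by
  rw [opF, LinearMap.smul_apply, Pol.ad_vf]
  simp only [Pol.genBracket]
  rw [bracket_constDer, Pol.vf_zero, smul_zero]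

theorem opE_e (i j : β.I) : β.opE n i (β.e n j) = 0 := β.opE_fn n i _

theorem opE_f (i j : β.I) : β.opE n i (β.f n j) = (if i = j then 1 else 0 : K) • 1 := by
  rw [f, opE_vf, β.pair]

theorem opF_e (i j : β.I) : β.opF n i (β.e n j) = (if i = j then 1 else 0 : K) • 1 := by
  rw [e, opF_fn, β.pair]
  simp only [eq_comm]

theorem opF_f (i j : β.I) : β.opF n i (β.f n j) = 0 := β.opF_vf n i _

/-- Derivations whose values on the coordinates are scalars commute up to sign. -/
theorem comm_of_scalar {c c' : ℤ} {D D' : Module.End K (Pol (symDual g).toGCA n)}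
    (hD : D ∈ (polGCA (symDual g).toGCA n).Der c) (hD' : D' ∈ (polGCA (symDual g).toGCA n).Der c')
    (he : ∀ i, ∃ k : K, D (β.e n i) = k • 1) (hf : ∀ i, ∃ k : K, D (β.f n i) = k • 1)
    (he' : ∀ i, ∃ k : K, D' (β.e n i) = k • 1) (hf' : ∀ i, ∃ k : K, D' (β.f n i) = k • 1) :
    D * D' = sg K (c * c') • (D' * D) := by
  have h1 : ∀ k : K, D (k • 1) = 0 := fun k => by
    rw [map_smul, GCA.Der.one (A := polGCA (symDual g).toGCA n) hD, smul_zero]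
  have h1' : ∀ k : K, D' (k • 1) = 0 := fun k => by
    rw [map_smul, GCA.Der.one (A := polGCA (symDual g).toGCA n) hD', smul_zero]
  refine sub_eq_zero.1 (β.der_eq_zero n (GCA.bracket_mem hD hD') ?_ ?_)
  · intro i
    obtain ⟨k, hk⟩ := he i
    obtain ⟨k', hk'⟩ := he' i
    simp only [LinearMap.sub_apply, Module.End.mul_apply,
      LinearMap.smul_apply, hk, hk', h1, h1', smul_zero, sub_zero]
  · intro i
    obtain ⟨k, hk⟩ := hf i
    obtain ⟨k', hk'⟩ := hf' i
    simp only [LinearMap.sub_apply, Module.End.mul_apply,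
      LinearMap.smul_apply, hk, hk', h1, h1', smul_zero, sub_zero]

theorem opE_scalar_e (i j : β.I) : ∃ k : K, β.opE n i (β.e n j) = k • 1 :=
  ⟨0, by rw [opE_e, zero_smul]⟩

theorem opF_scalar_f (i j : β.I) : ∃ k : K, β.opF n i (β.f n j) = k • 1 :=
  ⟨0, by rw [opF_f, zero_smul]⟩

theorem opE_comm (i j : β.I) : β.opE n i * β.opE n j =
    sg K (-(β.d i + n) * -(β.d j + n)) • (β.opE n j * β.opE n i) :=
  β.comm_of_scalar n (β.opE_mem n i) (β.opE_mem n j) (β.opE_scalar_e n i) (fun k => ⟨_, β.opE_f n i k⟩)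
    (β.opE_scalar_e n j) fun k => ⟨_, β.opE_f n j k⟩

theorem opF_comm (i j : β.I) : β.opF n i * β.opF n j =
    sg K ((β.d i - 1) * (β.d j - 1)) • (β.opF n j * β.opF n i) :=
  β.comm_of_scalar n (β.opF_mem n i) (β.opF_mem n j) (fun k => ⟨_, β.opF_e n i k⟩)
    (β.opF_scalar_f n i) (fun k => ⟨_, β.opF_e n j k⟩) (β.opF_scalar_f n j)

theorem opF_opE_comm (i j : β.I) : β.opF n i * β.opE n j =
    sg K ((β.d i - 1) * -(β.d j + n)) • (β.opE n j * β.opF n i) :=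
  β.comm_of_scalar n (β.opF_mem n i) (β.opE_mem n j) (fun k => ⟨_, β.opF_e n i k⟩)
    (β.opF_scalar_f n i) (β.opE_scalar_e n j) (fun k => ⟨_, β.opE_f n j k⟩)

/-! #### The differential -/

/-- The shift by -1 contributes the sign -1 and the dual differential contributes -(-1)^{b-1}; the
two minus signs cancel. -/
theorem functional_d {b j : ℤ} (θ : (shiftedDual g).X b) (y : g.X j) :
    functional g (((shiftedDual g).d b (b + 1)).hom θ) (inc g y) =
      sg K (b - 1) * functional g θ (totD g (inc g y)) := by
  rw [totD_inc]
  by_cases h : j = -b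
  -- The degrees are kept as variables so that they can be replaced by the expressions built into
  -- the shifted dual.
  · have key : ∀ k, j = -(b + 1 + -1) → k = -(b + -1) →
        functional g (((shiftedDual g).d b (b + 1)).hom θ) (inc g y) =
          sg K (b - 1) * functional g θ (inc g ((g.d j k).hom y)) := by
      rintro k rfl rfl
      rw [functional, functional, LinearMap.comp_apply, LinearMap.comp_apply, inc, inc,
        DirectSum.component.lof_self, DirectSum.component.lof_self]
      change ((-1 : ℤ).negOnePow • (-sg K (b + -1) * (show Module.Dual K (g.X (-(b + -1))) from θ)
        ((g.d (-(b + 1 + -1)) (-(b + -1))).hom y)) : K) = _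
      rw [Int.negOnePow_odd (-1) (by decide), Units.neg_smul, one_smul, neg_mul, neg_neg, sub_eq_add_neg]
    exact key (j + 1) (by omega) (by omega)
  · rw [functional_inc_of_ne _ _ (by omega), functional_inc_of_ne _ _ (by omega), mul_zero]

theorem polD_mem_der : Pol.polD (symDual g) n ∈ (polGCA (symDual g).toGCA n).Der 1 :=
  smul_mem_der _ (Pol.mem_congr (S := (polGCA (symDual g).toGCA n).Der)
    (by simp only [PolGen.dg]; ring) (ad_mem_der n _))

theorem d_symGen {b : ℤ} (θ : (shiftedDual g).X b) : (symDual g).d.1 (symGen (shiftedDual g) θ) =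
    symGen (shiftedDual g) (((shiftedDual g).d b (b + 1)).hom θ) :=
  (symDData (shiftedDual g)).der_gen ⟨b, θ⟩

theorem fn_dualGen_eq_sum {b : ℤ} (θ : (shiftedDual g).X b) :
    Pol.fn n (dualGen g θ) = ∑ i, functional g θ (inc g (β.x i)) • β.e n i := by
  rw [← polIncl_gen, symGen_eq_sum β, map_sum]
  refine Finset.sum_congr rfl fun i _ => ?_
  rw [map_smul, polIncl_gen, e]

theorem polD_e (i : β.I) :
    Pol.polD (symDual g) n (β.e n i) = ∑ j, (sg K (β.d i) * β.dMat i j) • β.e n j := by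
  rw [e, Pol.polD_fn]
  have h : Pol.ev (symDual g).d (dualGen g (β.θ i)) =
      dualGen g (((shiftedDual g).d (1 - β.d i) (1 - β.d i + 1)).hom (β.θ i)) :=
    Subtype.ext (d_symGen (β.θ i))
  rw [h, fn_dualGen_eq_sum n β]
  refine Finset.sum_congr rfl fun j _ => ?_
  rw [functional_d, dMat, sg_congr K (a := 1 - β.d i - 1) (b := β.d i) ⟨-β.d i, by ring⟩]

/-- The commutator of d with ∂_x sends a generator to ∓ ∂_x(d sθ), because d kills the scalar
∂_x(sθ); hence the matrix of d reappears. -/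
theorem polD_f (j : β.I) :
    Pol.polD (symDual g) n (β.f n j) = ∑ i, (sg K n * β.dMat i j) • β.f n i := by
  rw [f, Pol.polD_vf, vf_eq_sum β, Finset.smul_sum]
  refine Finset.sum_congr rfl fun i _ => ?_
  have h : Pol.fn n (Pol.ev (GCA.bracket (symDual g).d (constDer g (β.x j))) (dualGen g (β.θ i))) =
      -((sg K (β.d j - 1) * (sg K (β.d i) * β.dMat i j)) • 1) := by
    rw [← polIncl_eq]
    have h0 : (symDual g).d.1 (algebraMap K (symPres (shiftedDual g)).Alg
        (functional g (β.θ i) (inc g (β.x j)))) = 0 := by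
      rw [Algebra.algebraMap_eq_smul_one]
      refine (map_smul (symDual g).d.1 _ _).trans ?_
      refine (congrArg (fun t => _ • t) (GCA.Der.one (symDual g).d.2)).trans (smul_zero _)
    have h1 : (GCA.bracket (symDual g).d (constDer g (β.x j))).1 (symGen (shiftedDual g) (β.θ i)) =
        -(sg K (1 * (β.d j - 1)) • algebraMap K (symPres (shiftedDual g)).Alg
          (sg K (1 - β.d i - 1) * β.dMat i j)) := by
      change (symDual g).d.1 ((constDer g (β.x j)).1 (symGen (shiftedDual g) (β.θ i))) -
        sg K (1 * (β.d j - 1)) • (constDer g (β.x j)).1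
          ((symDual g).d.1 (symGen (shiftedDual g) (β.θ i))) = _
      rw [d_symGen, constDer_gen, constDer_gen, functional_d, h0]
      exact zero_sub _
    refine (congrArg (polIncl g n) h1).trans ?_
    rw [map_neg, map_smul, AlgHom.commutes, Algebra.algebraMap_eq_smul_one, smul_smul, one_mul,
      sg_congr K (a := 1 - β.d i - 1) (b := β.d i) ⟨-β.d i, by ring⟩]
  rw [h, neg_mul, smul_mul_assoc, one_mul, smul_neg, smul_neg, smul_smul, smul_smul, ← neg_smul]
  by_cases hd : β.dMat i j = 0
  · simp [hd]
  · rw [β.dMat_ne_zero hd, f]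
    congr 1
    simp only [← mul_assoc]
    rw [← sg_add, ← sg_add, ← sg_add, ← neg_mul, neg_sg]
    congr 1
    refine sg_congr K ⟨β.d j + 1, by ring⟩

/-- The summands have different degrees in general, but a nonzero matrix entry of d forces d_i = d_j
+ 1. -/
theorem sum_opF_mem (j : β.I) :
    ∑ i, β.dMat i j • β.opF n i ∈ (polGCA (symDual g).toGCA n).Der (β.d j - 1 + 1) := by
  refine Submodule.sum_mem _ fun i _ => ?_
  by_cases h : β.dMat i j = 0
  · rw [h, zero_smul]; exact Submodule.zero_mem _
  · exact smul_mem_der _ (Pol.mem_congr (S := (polGCA (symDual g).toGCA n).Der)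
      (by rw [β.dMat_ne_zero h]; ring) (β.opF_mem n i))

theorem sum_opE_mem (h : β.I) :
    ∑ j, β.dMat h j • β.opE n j ∈ (polGCA (symDual g).toGCA n).Der (-(β.d h + n) + 1) := by
  refine Submodule.sum_mem _ fun i _ => ?_
  by_cases hh : β.dMat h i = 0
  · rw [hh, zero_smul]; exact Submodule.zero_mem _
  · exact smul_mem_der _ (Pol.mem_congr (S := (polGCA (symDual g).toGCA n).Der)
      (by rw [β.dMat_ne_zero hh]; ring) (β.opE_mem n i))

theorem polD_one : Pol.polD (symDual g) n 1 = 0 :=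
  GCA.Der.one (A := polGCA (symDual g).toGCA n) (polD_mem_der n)

/-- The graded commutator of two derivations is a derivation, so comparison on the coordinates
suffices; there the scalars produced by F are killed by the differential. -/
theorem opF_polD (j : β.I) : β.opF n j * Pol.polD (symDual g) n =
    sg K (β.d j - 1) • (Pol.polD (symDual g) n * β.opF n j) +
      sg K (β.d j - 1) • ∑ i, β.dMat i j • β.opF n i := by
  have h := GCA.bracket_mem (β.opF_mem n j) (polD_mem_der (g := g) n)
  rw [mul_one] at h
  rw [← sub_eq_iff_eq_add']
  refine β.der_ext n h (smul_mem_der _ (β.sum_opF_mem n j)) ?_ ?_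
  · intro i
    simp only [LinearMap.sub_apply, Module.End.mul_apply, LinearMap.smul_apply, polD_e, map_sum,
      map_smul, opF_e, polD_one, LinearMap.sum_apply, smul_zero, sub_zero]
    simp only [ite_smul, one_smul, zero_smul, smul_ite, smul_zero, Finset.sum_ite_eq,
      Finset.sum_ite_eq', Finset.mem_univ, if_true, smul_smul]
    by_cases hd : β.dMat i j = 0
    · simp [hd]
    · rw [β.dMat_ne_zero hd, sg_congr K (a := β.d j + 1) (b := β.d j - 1) ⟨1, by ring⟩]
  · intro i
    simp only [LinearMap.sub_apply, Module.End.mul_apply, LinearMap.smul_apply, polD_f, map_sum,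
      map_smul, opF_f, LinearMap.sum_apply, smul_zero, map_zero, sub_zero, Finset.sum_const_zero]

theorem opE_polD (j : β.I) : β.opE n j * Pol.polD (symDual g) n =
    sg K (-(β.d j + n)) • (Pol.polD (symDual g) n * β.opE n j) +
      sg K n • ∑ i, β.dMat j i • β.opE n i := by
  have h := GCA.bracket_mem (β.opE_mem n j) (polD_mem_der (g := g) n)
  rw [mul_one] at h
  rw [← sub_eq_iff_eq_add']
  refine β.der_ext n h (smul_mem_der _ (β.sum_opE_mem n j)) ?_ ?_
  · intro i
    simp only [LinearMap.sub_apply, Module.End.mul_apply, LinearMap.smul_apply, polD_e, map_sum,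
      map_smul, opE_e, LinearMap.sum_apply, smul_zero, map_zero, sub_zero, Finset.sum_const_zero]
  · intro i
    simp only [LinearMap.sub_apply, Module.End.mul_apply, LinearMap.smul_apply, polD_f, map_sum,
      map_smul, opE_f, polD_one, LinearMap.sum_apply, smul_zero, sub_zero]
    simp only [ite_smul, one_smul, zero_smul, smul_ite, smul_zero, Finset.sum_ite_eq,
      Finset.sum_ite_eq', Finset.mem_univ, if_true, smul_smul]

/-! #### The bracket -/

/-- The composition of polyvectors by a single contraction. -/
noncomputable def comp (P Q : Pol (symDual g).toGCA n) : Pol (symDual g).toGCA n :=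
  ∑ i, sg K (1 + (β.d i - 1) * n) • (β.opF n i P * β.opE n i Q)

theorem ad_fn_eq (i : β.I) (P : Pol (symDual g).toGCA n) :
    Pol.ad n (.fn (1 - β.d i) (dualGen g (β.θ i))) P = sg K (β.d i) • β.opE n i P := by
  rw [opE, LinearMap.smul_apply, smul_smul, sg_mul_self, one_smul]

theorem ad_vf_eq (i : β.I) (P : Pol (symDual g).toGCA n) :
    Pol.ad n (.vf (β.d i - 1) (constDer g (β.x i))) P =
      sg K ((β.d i - 1) * (n + 1)) • β.opF n i P := by
  rw [opF, LinearMap.smul_apply, smul_smul, sg_mul_self, one_smul]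

/-- Both sides are derivations of degree 1 in Q, so they are compared on coordinates. There
antisymmetry turns the bracket into one with a coordinate in the first argument, which is E or F
applied to P up to sign. -/
theorem schouten_eq (P : (polPres (symDual g).toGCA n).degPart (n + 2))
    (Q : Pol (symDual g).toGCA n) : Pol.schouten P Q = β.comp n P.1 Q +
      ∑ i, sg K (n + 1) • (β.opE n i P.1 * β.opF n i Q) := by
  have hE := fun i => (β.opE_mem n i).1 _ _ P.2
  have hF := fun i => (β.opF_mem n i).1 _ _ P.2
  have key : Pol.schouten P =
      ∑ i, sg K (1 + (β.d i - 1) * n) • (LinearMap.mulLeft K (β.opF n i P.1) ∘ₗ β.opE n i) +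
        ∑ i, sg K (n + 1) • (LinearMap.mulLeft K (β.opE n i P.1) ∘ₗ β.opF n i) := by
    refine β.der_ext n (k := 1) (Pol.mem_congr (S := (polGCA (symDual g).toGCA n).Der) (by ring)
      (schouten_mem_der n P)) ?_ ?_ ?_
    · refine Submodule.add_mem _ (Submodule.sum_mem _ fun i _ => smul_mem_der _ ?_)
        (Submodule.sum_mem _ fun i _ => smul_mem_der _ ?_)
      · exact Pol.mem_congr (S := (polGCA (symDual g).toGCA n).Der) (by ring)
          (GCA.act_mem (A := polGCA (symDual g).toGCA n) (hF i) (β.opE_mem n i))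
      · exact Pol.mem_congr (S := (polGCA (symDual g).toGCA n).Der) (by ring)
          (GCA.act_mem (A := polGCA (symDual g).toGCA n) (hE i) (β.opF_mem n i))
    · intro j
      refine (Pol.schouten_gen P _).trans ?_
      rw [ad_fn_eq]
      simp only [LinearMap.add_apply, LinearMap.sum_apply, LinearMap.smul_apply,
        LinearMap.comp_apply, LinearMap.mulLeft_apply, opE_e, opF_e, mul_ite, mul_zero, smul_zero,
        Finset.sum_const_zero, zero_add, mul_one, ite_smul, one_smul, zero_smul,
        smul_ite, Finset.sum_ite_eq', Finset.mem_univ, if_true, PolGen.dg]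
      rw [smul_smul, ← sg_add, ← neg_smul, neg_sg]
      congr 1
      exact sg_congr K ⟨-n, by ring⟩
    · intro j
      refine (Pol.schouten_gen P _).trans ?_
      rw [ad_vf_eq]
      simp only [LinearMap.add_apply, LinearMap.sum_apply, LinearMap.smul_apply,
        LinearMap.comp_apply, LinearMap.mulLeft_apply, opE_f, opF_f, mul_ite, mul_zero, smul_zero,
        Finset.sum_const_zero, add_zero, mul_one, ite_smul, one_smul, zero_smul,
        smul_ite, Finset.sum_ite_eq', Finset.mem_univ, if_true, PolGen.dg]
      rw [smul_smul, ← sg_add, ← neg_smul, neg_sg]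
      congr 1
      exact sg_congr K ⟨β.d j - 1, by ring⟩
  rw [key, comp]
  simp only [LinearMap.add_apply, LinearMap.sum_apply, LinearMap.smul_apply, LinearMap.comp_apply,
    LinearMap.mulLeft_apply]

theorem schouten_eq_add (P Q : (polPres (symDual g).toGCA n).degPart (n + 2)) :
    Pol.schouten P Q.1 = β.comp n P.1 Q.1 + β.comp n Q.1 P.1 := by
  rw [schouten_eq n β]
  congr 1
  refine Finset.sum_congr rfl fun i _ => ?_
  rw [GradedPres.mul_comm' ((β.opE_mem n i).1 _ _ P.2) ((β.opF_mem n i).1 _ _ Q.2), smul_smul,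
    ← sg_add]
  congr 1
  -- Exchanging the two factors gives a sign quadratic in d_i; it agrees with the sign in `comp`
  -- because P and Q have degree n + 2 and d_i (d_i - 1) is even.
  have := Int.even_mul_pred_self (β.d i)
  obtain ⟨t, ht⟩ := this
  exact sg_congr K ⟨1 + n - t - n * (β.d i - 1), by linear_combination (-1 : ℤ) * ht⟩

end HomBasis

end Operators

/-! ### Weights -/

section Weights

variable {K : Type u} [Field K]

/-- The polyvectors of weight `k`, for an integer `k`. -/
def intWeight (A : GCA.{u, w} K) (n k : ℤ) : Submodule K (Pol A n) :=
  Submodule.span K {P | ∃ l : List (PolGen A), ((l.map PolGen.wt).sum : ℤ) = k ∧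
    P = (l.map (polPres A n).gen).prod}

variable {A : GCA.{u, w} K} {n : ℤ}

theorem intWeight_natCast (m : ℕ) : intWeight A n m = Pol.weight A n m := by
  simp only [intWeight, Pol.weight, Nat.cast_inj]

/-- Weights are taken in ℤ so that the operators E lower the weight without exception; that E kills
functions is then a vanishing in weight -1. -/
theorem intWeight_of_neg {k : ℤ} (hk : k < 0) : intWeight A n k = ⊥ := by
  refine Submodule.span_eq_bot.2 ?_
  rintro _ ⟨l, rfl, rfl⟩
  omega

theorem one_mem_intWeight : (1 : Pol A n) ∈ intWeight A n 0 :=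
  Submodule.subset_span ⟨[], by simp⟩

theorem gen_mem_intWeight (x : PolGen A) : (polPres A n).gen x ∈ intWeight A n x.wt :=
  Submodule.subset_span ⟨[x], by simp⟩

theorem mul_mem_intWeight {i j : ℤ} {a b : Pol A n} (ha : a ∈ intWeight A n i)
    (hb : b ∈ intWeight A n j) : a * b ∈ intWeight A n (i + j) := by
  have h := Submodule.mul_mem_mul ha hb
  rw [intWeight, intWeight, Submodule.span_mul_span] at h
  refine Submodule.span_mono ?_ h
  rintro _ ⟨_, ⟨l, hl, rfl⟩, _, ⟨l', hl', rfl⟩, rfl⟩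
  exact ⟨l ++ l', by simp [← hl, ← hl'], by simp⟩

theorem fn_mem_intWeight {j : ℤ} (a : A.deg j) : Pol.fn n a ∈ intWeight A n 0 :=
  gen_mem_intWeight (PolGen.fn j a)

theorem vf_mem_intWeight {k : ℤ} (D : A.Der k) : Pol.vf n D ∈ intWeight A n 1 :=
  gen_mem_intWeight (PolGen.vf k D)

/-- A derivation that changes the weight of the generators by `δ` changes all weights by `δ`. -/
theorem der_mem_intWeight {k δ : ℤ} {D : Module.End K (Pol A n)} (hD : D ∈ (polGCA A n).Der k)
    (h : ∀ x : PolGen A, D ((polPres A n).gen x) ∈ intWeight A n (x.wt + δ)) {i : ℤ} {P : Pol A n}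
    (hP : P ∈ intWeight A n i) : D P ∈ intWeight A n (i + δ) := by
  induction hP using Submodule.span_induction with
  | mem P hP =>
    obtain ⟨l, rfl, rfl⟩ := hP
    induction l with
    | nil =>
      simp only [List.map_nil, List.prod_nil]
      refine (congrArg (· ∈ _) (GCA.Der.one (A := polGCA A n) hD)).mpr (Submodule.zero_mem _)
    | cons x l ih =>
      simp only [List.map_cons, List.prod_cons, List.sum_cons]
      refine (congrArg (· ∈ _) (hD.2 _ _ (GradedPres.gen_mem (P := polPres A n) x) _)).mpr ?_
      refine Submodule.add_mem _ ?_ (Submodule.smul_mem _ _ ?_)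
      · refine Pol.mem_congr (S := intWeight A n) ?_ (mul_mem_intWeight (h x)
          (Submodule.subset_span ⟨l, rfl, rfl⟩))
        push_cast; ring
      · refine Pol.mem_congr (S := intWeight A n) ?_ (mul_mem_intWeight (gen_mem_intWeight x) ih)
        push_cast; ring
  | zero => rw [map_zero]; exact Submodule.zero_mem _
  | add P Q _ _ h1 h2 => rw [map_add]; exact Submodule.add_mem _ h1 h2
  | smul c P _ h1 => rw [map_smul]; exact Submodule.smul_mem _ _ h1

theorem prod_der_mem_intWeight {δ : ℤ} {N : ℕ} {D : Fin N → Module.End K (Pol A n)}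
    (h : ∀ k i P, P ∈ intWeight A n i → D k P ∈ intWeight A n (i + δ)) {i : ℤ} {P : Pol A n}
    (hP : P ∈ intWeight A n i) : (List.ofFn D).prod P ∈ intWeight A n (i + N * δ) := by
  induction N with
  | zero => simpa using hP
  | succ N ih =>
    rw [prod_ofFn_succ, Module.End.mul_apply]
    refine Pol.mem_congr (S := intWeight A n) ?_ (h 0 _ _ (ih fun k => h k.succ))
    push_cast; ring

theorem intWeight_le_of_mul (S : ℤ → Submodule K (Pol A n)) (one : (1 : Pol A n) ∈ S 0)
    (mul : ∀ (x : PolGen A) i P, P ∈ S i → (polPres A n).gen x * P ∈ S (x.wt + i)) (i : ℤ) :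
    intWeight A n i ≤ S i := by
  refine Submodule.span_le.2 ?_
  rintro _ ⟨l, rfl, rfl⟩
  induction l with
  | nil => simpa using one
  | cons x l ih =>
    have := mul x _ _ ih
    simpa using this

end Weights

/-! ### The coordinate operators and the weight; spanning monomials. -/

section Operators

variable {K : Type u} [Field K] {g : CochainComplex (ModuleCat.{v} K) ℤ} (n : ℤ)

/-- A product of generators of nonzero weight contains a vector field, which the augmentation kills.
-/
theorem polAug_of_weight {k : ℤ} {P : Pol (symDual g).toGCA n}
    (hP : P ∈ intWeight (symDual g).toGCA n k) (hk : k ≠ 0) : polAug g n P = 0 := by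
  -- In weight 0 there is nothing to show, which is why the submodule is everything there and the
  -- kernel of the augmentation elsewhere.
  refine intWeight_le_of_mul (fun k => if k = 0 then ⊤ else LinearMap.ker (polAug g n).toLinearMap)
    (by simp) ?_ k hP |> fun h => by simpa [hk] using h
  intro x i P hP
  cases x with
  | fn j a =>
    simp only [PolGen.wt, Nat.cast_zero, zero_add]
    split_ifs with hi
    · trivial
    · rw [if_neg hi] at hP
      have h1 : polAug g n P = 0 := hP
      change polAug g n _ = 0
      rw [map_mul, h1, mul_zero]
  | vf j D =>
    have h1 : polAug g n ((polPres (symDual g).toGCA n).gen (.vf j D) * P) = 0 := by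
      rw [map_mul]
      exact mul_eq_zero_of_left (polAug_vf g n D) _
    split_ifs
    · trivial
    · exact h1

theorem polD_mem_intWeight {i : ℤ} {P : Pol (symDual g).toGCA n}
    (hP : P ∈ intWeight (symDual g).toGCA n i) :
    Pol.polD (symDual g) n P ∈ intWeight (symDual g).toGCA n i := by
  rw [← add_zero i]
  refine der_mem_intWeight (HomBasis.polD_mem_der n) ?_ hP
  intro x
  rw [add_zero]
  cases x with
  | fn j a => exact (congrArg (· ∈ _) (Pol.polD_fn (symDual g) n a)).mpr (fn_mem_intWeight _)
  | vf j D =>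
    exact (congrArg (· ∈ _) (Pol.polD_vf (symDual g) n D)).mpr
      (Submodule.smul_mem _ _ (vf_mem_intWeight _))

namespace HomBasis

variable (β : HomBasis g)

theorem opE_mem_intWeight (j : β.I) {i : ℤ} {P : Pol (symDual g).toGCA n}
    (hP : P ∈ intWeight (symDual g).toGCA n i) :
    β.opE n j P ∈ intWeight (symDual g).toGCA n (i + -1) := by
  refine der_mem_intWeight (β.opE_mem n j) ?_ hP
  intro x
  cases x with
  | fn k a => exact (congrArg (· ∈ _) (β.opE_fn n j a)).mpr (Submodule.zero_mem _)
  | vf k D =>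
    refine Submodule.smul_mem _ _ ?_
    rw [Pol.ad_gen]
    exact Submodule.neg_mem _ (Submodule.smul_mem _ _ (fn_mem_intWeight _))

theorem opF_mem_intWeight (j : β.I) {i : ℤ} {P : Pol (symDual g).toGCA n}
    (hP : P ∈ intWeight (symDual g).toGCA n i) :
    β.opF n j P ∈ intWeight (symDual g).toGCA n (i + 0) := by
  refine der_mem_intWeight (β.opF_mem n j) ?_ hP
  intro x
  refine Submodule.smul_mem _ _ ?_
  rw [Pol.ad_gen, add_zero]
  cases x with
  | fn k a => exact Submodule.smul_mem _ _ (fn_mem_intWeight _)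
  | vf k D => exact vf_mem_intWeight _

theorem comp_mem_intWeight {i j : ℤ} {P Q : Pol (symDual g).toGCA n}
    (hP : P ∈ intWeight (symDual g).toGCA n i) (hQ : Q ∈ intWeight (symDual g).toGCA n j) :
    β.comp n P Q ∈ intWeight (symDual g).toGCA n (i + j - 1) := by
  refine Submodule.sum_mem _ fun k _ => Submodule.smul_mem _ _ ?_
  exact Pol.mem_congr (S := intWeight _ n) (by ring)
    (mul_mem_intWeight (β.opF_mem_intWeight n k hP) (β.opE_mem_intWeight n k hQ))

/-! #### Monomials in the coordinates -/

/-- The monomial `f_{H 0} f_{H 1} ⋯ e_{J 0} e_{J 1} ⋯`. -/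
noncomputable def mono {m l : ℕ} (H : Fin m → β.I) (J : Fin l → β.I) : Pol (symDual g).toGCA n :=
  monomial g n (fun k => β.x (H k)) fun j => β.θ (J j)

theorem mono_eq {m l : ℕ} (H : Fin m → β.I) (J : Fin l → β.I) : β.mono n H J =
    (List.ofFn fun k => β.f n (H k)).prod * (List.ofFn fun k => β.e n (J k)).prod := rfl

theorem f_mul_mono {m l : ℕ} (i : β.I) (H : Fin m → β.I) (J : Fin l → β.I) :
    β.f n i * β.mono n H J = β.mono n (Fin.cons i H : Fin (m + 1) → β.I) J := by
  rw [mono_eq, mono_eq, prod_ofFn_succ (fun k => β.f n ((Fin.cons i H : Fin (m + 1) → β.I) k))]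
  simp only [Fin.cons_zero, Fin.cons_succ, mul_assoc]

theorem e_mul_mono {m l : ℕ} (i : β.I) (H : Fin m → β.I) (J : Fin l → β.I) :
    β.e n i * β.mono n H J = sg K ((1 - β.d i) * ∑ k, (β.d (H k) + n)) •
      β.mono n H (Fin.cons i J : Fin (l + 1) → β.I) := by
  rw [mono_eq, mono_eq, prod_ofFn_succ (fun k => β.e n ((Fin.cons i J : Fin (l + 1) → β.I) k)),
    ← mul_assoc, GradedPres.mul_comm' (β.e_mem n i)
      (GCA.prod_ofFn_mem (B := polGCA (symDual g).toGCA n) fun k => β.f_mem n (H k)),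
    smul_mul_assoc, mul_assoc]
  simp only [Fin.cons_zero, Fin.cons_succ]

/-- The span of the monomials of weight `k`. -/
noncomputable def monoSpan (k : ℤ) : Submodule K (Pol (symDual g).toGCA n) :=
  Submodule.span K {P | ∃ (m l : ℕ) (H : Fin m → β.I) (J : Fin l → β.I), (m : ℤ) = k ∧
    P = β.mono n H J}

theorem f_mul_monoSpan (i : β.I) {k : ℤ} {P : Pol (symDual g).toGCA n} (hP : P ∈ β.monoSpan n k) :
    β.f n i * P ∈ β.monoSpan n (1 + k) := by
  induction hP using Submodule.span_induction with
  | mem P hP =>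
    obtain ⟨m, l, H, J, rfl, rfl⟩ := hP
    rw [f_mul_mono]
    exact Submodule.subset_span ⟨m + 1, l, _, J, by push_cast; ring, rfl⟩
  | zero => rw [mul_zero]; exact Submodule.zero_mem _
  | add P Q _ _ h1 h2 => rw [mul_add]; exact Submodule.add_mem _ h1 h2
  | smul c P _ h1 => rw [mul_smul_comm]; exact Submodule.smul_mem _ _ h1

theorem e_mul_monoSpan (i : β.I) {k : ℤ} {P : Pol (symDual g).toGCA n} (hP : P ∈ β.monoSpan n k) :
    β.e n i * P ∈ β.monoSpan n k := by
  induction hP using Submodule.span_induction with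
  | mem P hP =>
    obtain ⟨m, l, H, J, rfl, rfl⟩ := hP
    rw [e_mul_mono]
    exact Submodule.smul_mem _ _ (Submodule.subset_span ⟨m, l + 1, H, _, rfl, rfl⟩)
  | zero => rw [mul_zero]; exact Submodule.zero_mem _
  | add P Q _ _ h1 h2 => rw [mul_add]; exact Submodule.add_mem _ h1 h2
  | smul c P _ h1 => rw [mul_smul_comm]; exact Submodule.smul_mem _ _ h1

theorem fn_mul_monoSpan {j : ℤ} (a : (symDual g).deg j) {k : ℤ} {P : Pol (symDual g).toGCA n}
    (hP : P ∈ β.monoSpan n k) : Pol.fn n a * P ∈ β.monoSpan n k := by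
  have h := β.fn_mem_adjoin n a
  generalize Pol.fn n a = x at h
  revert P
  induction h using Algebra.adjoin_induction with
  | mem x hx =>
    obtain ⟨i, rfl⟩ := hx
    exact fun hP => β.e_mul_monoSpan n i hP
  | algebraMap r => intro P hP; rw [← Algebra.smul_def]; exact Submodule.smul_mem _ _ hP
  | add x y _ _ hx hy => intro P hP; rw [add_mul]; exact Submodule.add_mem _ (hx hP) (hy hP)
  | mul x y _ _ hx hy => intro P hP; rw [mul_assoc]; exact hx (hy hP)

/-- The polyvectors of weight `k` are spanned by monomials. -/
theorem intWeight_le_monoSpan (k : ℤ) : intWeight (symDual g).toGCA n k ≤ β.monoSpan n k := by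
  refine intWeight_le_of_mul _ ?_ ?_ k
  · exact Submodule.subset_span ⟨0, 0, Fin.elim0, Fin.elim0, rfl, by simp [mono_eq]⟩
  · intro x i P hP
    cases x with
    | fn j a =>
      rw [show (((PolGen.fn j a : PolGen (symDual g).toGCA).wt : ℕ) : ℤ) + i = i by simp [PolGen.wt]]
      exact β.fn_mul_monoSpan n a hP
    | vf j D =>
      change Pol.vf n D * P ∈ β.monoSpan n (1 + i)
      rw [β.vf_eq_sum, Finset.sum_mul]
      refine Submodule.sum_mem _ fun k _ => ?_
      rw [smul_mul_assoc, mul_assoc]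
      exact Submodule.smul_mem _ _ (β.fn_mul_monoSpan n _ (β.f_mul_monoSpan n k hP))

theorem weight_induction {m : ℕ} {p : Pol (symDual g).toGCA n → Prop}
    (mono : ∀ (l : ℕ) (H : Fin m → β.I) (J : Fin l → β.I), p (β.mono n H J))
    (zero : p 0) (add : ∀ a b, p a → p b → p (a + b)) (smul : ∀ (c : K) a, p a → p (c • a))
    {P : Pol (symDual g).toGCA n} (hP : P ∈ Pol.weight (symDual g).toGCA n m) : p P := by
  rw [← intWeight_natCast] at hP
  have h := β.intWeight_le_monoSpan n _ hP
  clear hP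
  induction h using Submodule.span_induction with
  | mem P hP =>
    obtain ⟨m', l, H, J, hm, rfl⟩ := hP
    obtain rfl : m' = m := by exact_mod_cast hm
    exact mono l H J
  | zero => exact zero
  | add P Q _ _ h1 h2 => exact add _ _ h1 h2
  | smul c P _ h1 => exact smul _ _ h1

end HomBasis

end Operators

/-! ### Iterated derivations of a product one factor of which they kill. -/

namespace GCA

variable {K : Type u} [Field K] {B : GCA.{u, w} K}

theorem der_prod_eq_zero {D : Module.End K B.carrier} {k : ℤ} (hD : D ∈ B.Der k) {N : ℕ}
    {z : Fin N → B.carrier} {b : Fin N → ℤ} (hz : ∀ j, z j ∈ B.deg (b j)) (h : ∀ j, D (z j) = 0) :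
    D (List.ofFn z).prod = 0 := by
  induction N with
  | zero => simpa using Der.one hD
  | succ N ih =>
    rw [prod_ofFn_succ, hD.2 _ _ (hz 0), h 0, ih (fun j => hz j.succ) fun j => h j.succ]
    simp

theorem prod_der_mul_of_left {N : ℕ} {D : Fin N → Module.End K B.carrier} {c : Fin N → ℤ}
    (hD : ∀ k, D k ∈ B.Der (c k)) {u : ℤ} {U : B.carrier} (hU : U ∈ B.deg u)
    (h : ∀ k, D k U = 0) (V : B.carrier) :
    (List.ofFn D).prod (U * V) = sg K (u * ∑ k, c k) • (U * (List.ofFn D).prod V) := by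
  induction N with
  | zero => simp [sg_zero]
  | succ N ih =>
    rw [prod_ofFn_succ, Module.End.mul_apply, ih (fun k => hD k.succ) fun k => h k.succ, map_smul,
      (hD 0).2 _ _ hU, h 0, zero_mul, zero_add, smul_smul, ← sg_add, Module.End.mul_apply,
      Fin.sum_univ_succ]
    congr 2
    ring

theorem prod_der_mul_of_right {N : ℕ} {D : Fin N → Module.End K B.carrier} {c : Fin N → ℤ}
    (hD : ∀ k, D k ∈ B.Der (c k)) {u : ℤ} {U : B.carrier} (hU : U ∈ B.deg u) {V : B.carrier}
    (h : ∀ k, D k V = 0) : (List.ofFn D).prod (U * V) = (List.ofFn D).prod U * V := by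
  induction N with
  | zero => simp
  | succ N ih =>
    rw [prod_ofFn_succ, Module.End.mul_apply, ih (fun k => hD k.succ) fun k => h k.succ,
      (hD 0).2 _ _ (prod_ofFn_der_mem (fun k => hD k.succ) hU), h 0, mul_zero, smul_zero, add_zero,
      Module.End.mul_apply]

end GCA

/-! ### Coefficients of polyvectors -/

namespace HomBasis

variable {K : Type u} [Field K] {g : CochainComplex (ModuleCat.{v} K) ℤ} (n : ℤ) (β : HomBasis g)

/-- The iterated derivative `E_{H 0} E_{H 1} ⋯`. -/
noncomputable def prodE {m : ℕ} (H : Fin m → β.I) : Module.End K (Pol (symDual g).toGCA n) :=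
  (List.ofFn fun k => β.opE n (H k)).prod

/-- The iterated derivative `F_{J 0} F_{J 1} ⋯`. -/
noncomputable def prodF {l : ℕ} (J : Fin l → β.I) : Module.End K (Pol (symDual g).toGCA n) :=
  (List.ofFn fun k => β.opF n (J k)).prod

/-- The coefficients of a polyvector. -/
noncomputable def coef {m l : ℕ} (H : Fin m → β.I) (J : Fin l → β.I) :
    Pol (symDual g).toGCA n →ₗ[K] K :=
  (polAug g n).toLinearMap ∘ₗ β.prodE n H ∘ₗ β.prodF n J

theorem coef_apply {m l : ℕ} (H : Fin m → β.I) (J : Fin l → β.I) (P : Pol (symDual g).toGCA n) :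
    β.coef n H J P = polAug g n (β.prodE n H (β.prodF n J P)) := rfl

theorem prodE_mem_deg {m : ℕ} (H : Fin m → β.I) {i : ℤ} {P : Pol (symDual g).toGCA n}
    (hP : P ∈ (polPres (symDual g).toGCA n).degPart i) :
    β.prodE n H P ∈ (polPres (symDual g).toGCA n).degPart (i + ∑ k, -(β.d (H k) + n)) :=
  GCA.prod_ofFn_der_mem (B := polGCA (symDual g).toGCA n) (fun k => β.opE_mem n (H k)) hP

theorem prodF_mem_deg {l : ℕ} (J : Fin l → β.I) {i : ℤ} {P : Pol (symDual g).toGCA n}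
    (hP : P ∈ (polPres (symDual g).toGCA n).degPart i) :
    β.prodF n J P ∈ (polPres (symDual g).toGCA n).degPart (i + ∑ k, (β.d (J k) - 1)) :=
  GCA.prod_ofFn_der_mem (B := polGCA (symDual g).toGCA n) (fun k => β.opF_mem n (J k)) hP

theorem prodF_mem_intWeight {l : ℕ} (J : Fin l → β.I) {i : ℤ} {P : Pol (symDual g).toGCA n}
    (hP : P ∈ intWeight (symDual g).toGCA n i) :
    β.prodF n J P ∈ intWeight (symDual g).toGCA n i :=
  Pol.mem_congr (S := intWeight _ n) (by ring)
    (prod_der_mem_intWeight (fun k _ _ h => β.opF_mem_intWeight n (J k) h) hP)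

/-- The degrees of the indices of a non-zero coefficient. -/
theorem degree_of_coef_ne_zero {m l : ℕ} {H : Fin m → β.I} {J : Fin l → β.I} {i : ℤ}
    {P : Pol (symDual g).toGCA n} (hP : P ∈ (polPres (symDual g).toGCA n).degPart i)
    (h : β.coef n H J P ≠ 0) :
    ∑ k, β.d (H k) + m * n = ∑ k, β.d (J k) - l + i := by
  by_contra hne
  refine h (polAug_of_ne g n (β.prodE_mem_deg n H (β.prodF_mem_deg n J hP)) ?_)
  intro h0
  apply hne
  simp only [Finset.sum_neg_distrib, Finset.sum_add_distrib, Finset.sum_sub_distrib,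
    Finset.sum_const, Finset.card_univ, Fintype.card_fin, nsmul_eq_mul, mul_one] at h0
  linarith

theorem prodE_perm {m : ℕ} (H : Fin m → β.I) (ρ : Equiv.Perm (Fin m)) :
    β.prodE n (H ∘ ρ) = sg K (koszulExp ρ fun k => β.d (H k) + n) • β.prodE n H := by
  have h := prod_perm (K := K) (fun k => β.opE n (H k)) (fun k => -(β.d (H k) + n))
    (fun _ _ => β.opE_comm n _ _) ρ
  rw [prodE, prodE]
  refine h.trans ?_
  congr 2
  simp only [koszulExp, neg_mul_neg]

theorem prodF_perm {l : ℕ} (J : Fin l → β.I) (σ : Equiv.Perm (Fin l)) :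
    β.prodF n (J ∘ σ) = sg K (koszulExp σ fun k => β.d (J k) - 1) • β.prodF n J :=
  prod_perm (K := K) (fun k => β.opF n (J k)) (fun k => β.d (J k) - 1)
    (fun _ _ => β.opF_comm n _ _) σ

theorem coef_perm {m l : ℕ} (H : Fin m → β.I) (J : Fin l → β.I) (ρ : Equiv.Perm (Fin m))
    (σ : Equiv.Perm (Fin l)) (P : Pol (symDual g).toGCA n) : β.coef n (H ∘ ρ) (J ∘ σ) P =
      sg K ((koszulExp ρ fun k => β.d (H k) + n) + koszulExp σ fun k => β.d (J k) - 1) *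
        β.coef n H J P := by
  rw [coef_apply, coef_apply, prodE_perm, prodF_perm, LinearMap.smul_apply, LinearMap.smul_apply,
    map_smul, map_smul, map_smul, sg_add, smul_eq_mul, smul_eq_mul, mul_assoc]

/-! #### The coefficients of a monomial -/

theorem fn_prod_mem_intWeight {l : ℕ} {b : Fin l → ℤ} (θ : ∀ j, (shiftedDual g).X (b j)) :
    (List.ofFn fun k => Pol.fn n (dualGen g (θ k))).prod ∈ intWeight (symDual g).toGCA n 0 := by
  induction l with
  | zero => simpa using one_mem_intWeight
  | succ l ih =>
    rw [prod_ofFn_succ]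
    have h := mul_mem_intWeight (fn_mem_intWeight (n := n) (dualGen g (θ 0))) (ih fun j => θ j.succ)
    rwa [add_zero] at h

section Monomial

variable {m l : ℕ} {a : Fin m → ℤ} {b : Fin l → ℤ} (x : ∀ k, g.X (a k))
    (θ : ∀ j, (shiftedDual g).X (b j))

theorem vf_prod_mem : (List.ofFn fun k => Pol.vf n (constDer g (x k))).prod ∈
    (polPres (symDual g).toGCA n).degPart (∑ k, (a k + n)) :=
  GCA.prod_ofFn_mem (B := polGCA (symDual g).toGCA n) fun k =>
    Pol.mem_congr (S := (polPres (symDual g).toGCA n).degPart) (by ring) (Pol.vf_mem _)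

/-- The F's kill vector fields and so pass to the functions, at the cost of a sign. The E's kill
functions and act on the vector fields only. The augmentation is multiplicative, so the coefficient
factors. -/
theorem coef_monomial {m' l' : ℕ} (H : Fin m' → β.I) (J : Fin l' → β.I) :
    β.coef n H J (monomial g n x θ) =
      sg K ((∑ k, (a k + n)) * ∑ j, (β.d (J j) - 1)) *
        (polAug g n (β.prodE n H (List.ofFn fun k => Pol.vf n (constDer g (x k))).prod) *
          polAug g n (β.prodF n J (List.ofFn fun k => Pol.fn n (dualGen g (θ k))).prod)) := by
  have hX := vf_prod_mem n x
  have h1 : β.prodF n J (monomial g n x θ) = sg K ((∑ k, (a k + n)) * ∑ j, (β.d (J j) - 1)) •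
      ((List.ofFn fun k => Pol.vf n (constDer g (x k))).prod *
        β.prodF n J (List.ofFn fun k => Pol.fn n (dualGen g (θ k))).prod) := by
    refine GCA.prod_der_mul_of_left (B := polGCA (symDual g).toGCA n)
      (fun k => β.opF_mem n (J k)) hX (fun k => ?_) _
    exact GCA.der_prod_eq_zero (B := polGCA (symDual g).toGCA n) (β.opF_mem n (J k))
      (fun k => Pol.vf_mem _) fun k => β.opF_vf n _ _
  rw [coef_apply, h1, map_smul, map_smul, smul_eq_mul, ← map_mul]
  congr 2
  refine GCA.prod_der_mul_of_right (B := polGCA (symDual g).toGCA n)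
    (fun k => β.opE_mem n (H k)) hX fun k => ?_
  have h2 := β.opE_mem_intWeight n (H k) (β.prodF_mem_intWeight n J (fn_prod_mem_intWeight n θ))
  -- A derivative by E of something of weight 0 lies in weight -1, hence is zero.
  rw [intWeight_of_neg (by norm_num)] at h2
  exact h2

theorem aug_prodF_fn (J : Fin l → β.I) :
    polAug g n (β.prodF n J (List.ofFn fun k => Pol.fn n (dualGen g (θ k))).prod) =
      ∑ σ : Equiv.Perm (Fin l), sg K (pairSum b + koszulExp σ b) *
        ∏ j, functional g (θ (σ j)) (inc g (β.x (J j))) := by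
  have h := GCA.wick (B := polGCA (symDual g).toGCA n) (fun k => β.opF_mem n (J k))
    (fun j => Pol.fn_mem (n := n) (dualGen g (θ j))) (fun k j => β.opF_fn n (J k) (θ j))
    (fun k j h => by
      by_contra h'
      exact h (functional_inc_of_ne _ _ (by omega)))
  refine (congrArg (polAug g n) h).trans ?_
  rw [map_smul, map_one, smul_eq_mul, mul_one]

theorem aug_prodE_vf (H : Fin m → β.I) :
    polAug g n (β.prodE n H (List.ofFn fun k => Pol.vf n (constDer g (x k))).prod) =
      ∑ ρ : Equiv.Perm (Fin m), sg K (pairSum (fun k => a k + n) + koszulExp ρ fun k => a k + n) *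
        ∏ k, functional g (β.θ (H k)) (inc g (x (ρ k))) := by
  have h := GCA.wick (B := polGCA (symDual g).toGCA n) (fun k => β.opE_mem n (H k))
    (z := fun k => Pol.vf n (constDer g (x k))) (b := fun k => a k + n)
    (fun k => Pol.mem_congr (S := (polPres (symDual g).toGCA n).degPart) (by ring) (Pol.vf_mem _))
    (fun k j => β.opE_vf n (H k) (x j))
    (fun k j h => by rw [β.functional_inc_ne_zero h])
  refine (congrArg (polAug g n) h).trans ?_
  rw [map_smul, map_one, smul_eq_mul, mul_one]

/-- With too few operators a coordinate survives and is killed by the augmentation; with too many,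
an operator meets a scalar. -/
theorem aug_prodF_fn_of_ne {l' : ℕ} (J : Fin l' → β.I) (hl : l' ≠ l) :
    polAug g n (β.prodF n J (List.ofFn fun k => Pol.fn n (dualGen g (θ k))).prod) = 0 := by
  have hδ : ∀ k j, functional g (θ j) (inc g (β.x (J k))) ≠ 0 → β.d (J k) - 1 = -b j := by
    intro k j h
    by_contra h'
    exact h (functional_inc_of_ne _ _ (by omega))
  rcases lt_or_gt_of_ne hl with h | h
  · exact GCA.aug_prod_der_eq_zero (B := polGCA (symDual g).toGCA n) (polAug g n)
      (fun k => β.opF_mem n (J k)) (fun j => Pol.fn_mem (n := n) (dualGen g (θ j)))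
      (fun k j => β.opF_fn n (J k) (θ j)) hδ (fun j => polAug_fn g n (θ j)) h
  · refine (congrArg (polAug g n) (GCA.prod_der_eq_zero (B := polGCA (symDual g).toGCA n)
      (fun k => β.opF_mem n (J k)) (fun j => Pol.fn_mem (n := n) (dualGen g (θ j)))
      (fun k j => β.opF_fn n (J k) (θ j)) hδ h)).trans (map_zero _)

end Monomial

/-! ### The maps associated with a polyvector -/

/-- The exponent of the sign relating coefficients and matrix entries. -/
def trExp {m l : ℕ} (H : Fin m → β.I) (J : Fin l → β.I) : ℤ :=
  n * posSum (β.d ∘ H) + posSum (β.d ∘ J) + pairSum (β.d ∘ H) + pairs l + n * pairs m +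
    (∑ k, β.d (J k)) * (∑ k, β.d (H k)) + n * m * (∑ k, β.d (J k)) + l * n * m

/-- The map with given matrix entries. -/
noncomputable def ofEnt {m l : ℕ} :
    ((Fin m → β.I) → (Fin l → β.I) → K) →ₗ[K] (TP g l →ₗ[K] TP g m) where
  toFun M := ∑ H, ∑ J, M H J • (β.coord J).smulRight (β.tv H)
  map_add' M M' := by simp only [Pi.add_apply, add_smul, Finset.sum_add_distrib]
  map_smul' c M := by
    simp only [Pi.smul_apply, smul_eq_mul, mul_smul, Finset.smul_sum, RingHom.id_apply]

theorem ent_ofEnt {m l : ℕ} (M : (Fin m → β.I) → (Fin l → β.I) → K) (H : Fin m → β.I)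
    (J : Fin l → β.I) : β.ent (β.ofEnt M) H J = M H J := by
  simp only [ent, ofEnt, LinearMap.coe_mk, AddHom.coe_mk, LinearMap.sum_apply, LinearMap.smul_apply,
    LinearMap.smulRight_apply, map_sum, map_smul, coord_tv, smul_eq_mul]
  rw [Finset.sum_eq_single H, Finset.sum_eq_single J]
  · simp
  · intro J' _ h
    simp [h]
  · intro h
    exact absurd (Finset.mem_univ _) h
  · intro H' _ h
    simp [h.symm]
  · intro h
    exact absurd (Finset.mem_univ _) h

/-- The map `g^{⊗l} → g^{⊗m}` of a polyvector of weight `m`. -/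
noncomputable def toMap (m l : ℕ) : Pol (symDual g).toGCA n →ₗ[K] (TP g l →ₗ[K] TP g m) :=
  β.ofEnt ∘ₗ LinearMap.pi fun H => LinearMap.pi fun J => sg K (β.trExp n H J) • β.coef n H J

theorem ent_toMap {m l : ℕ} (P : Pol (symDual g).toGCA n) (H : Fin m → β.I) (J : Fin l → β.I) :
    β.ent (β.toMap n m l P) H J = sg K (β.trExp n H J) * β.coef n H J P := by
  rw [toMap, LinearMap.comp_apply, ent_ofEnt]
  rfl

/-- This is the décalage identity `koszulExp_shift` solved for the position sum: permuting the
entries trades the Koszul sign in degrees shifted by k for the unshifted one times the signature to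
the power k. -/
theorem posSum_perm_sign {N : ℕ} (c : Fin N → ℤ) (σ : Equiv.Perm (Fin N)) (k : ℤ) :
    sg K (k * posSum (c ∘ σ)) = sg K (k * posSum c) *
      (sg K (koszulExp σ fun i => c i + k) * (sg K (koszulExp σ c) * permSign K k σ)) := by
  rw [permSign_eq, ← sg_add, ← sg_add, ← sg_add]
  refine sg_eq_of_zmod K ?_
  push_cast
  rw [koszulExp_shift]
  have h1 := zmod_two_mul_self
  have two : (2 : ZMod 2) = 0 := by decide
  linear_combination (-(k : ZMod 2) * posSum c - koszulExp σ c - k * koszulExp σ fun _ => 1) * two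

theorem permSign_mul_self (K : Type u) [Field K] {N : ℕ} (k : ℤ) (σ : Equiv.Perm (Fin N)) :
    permSign K k σ * permSign K k σ = 1 := by
  rw [permSign_eq, sg_mul_self]

theorem permSign_neg_one (K : Type u) [Field K] {N : ℕ} (σ : Equiv.Perm (Fin N)) :
    permSign K (-1) σ = permSign K 1 σ := by
  rw [permSign_eq, permSign_eq]
  exact sg_congr K ⟨-koszulExp σ fun _ => 1, by ring⟩

/-- Only the two position sums in `trExp` change under permutations; all other terms are symmetric.
The sums enter with factors n and 1, matching the degree shifts d + n of the f_i and, up to parity,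
d - 1 of the operators F_i. -/
theorem trExp_perm {m l : ℕ} (H : Fin m → β.I) (J : Fin l → β.I) (ρ : Equiv.Perm (Fin m))
    (σ : Equiv.Perm (Fin l)) : sg K (β.trExp n (H ∘ ρ) (J ∘ σ)) = sg K (β.trExp n H J) *
      ((sg K (koszulExp ρ fun i => β.d (H i) + n) * (sg K (koszulExp ρ (β.d ∘ H)) * permSign K n ρ)) *
      (sg K (koszulExp σ fun i => β.d (J i) - 1) *
        (sg K (koszulExp σ (β.d ∘ J)) * permSign K 1 σ))) := by
  have h1 := posSum_perm_sign (K := K) (β.d ∘ H) ρ n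
  have h2 := posSum_perm_sign (K := K) (β.d ∘ J) σ (-1)
  rw [permSign_neg_one] at h2
  have e1 : ∑ k, β.d ((H ∘ ρ) k) = ∑ k, β.d (H k) := Equiv.sum_comp ρ fun k => β.d (H k)
  have e2 : ∑ k, β.d ((J ∘ σ) k) = ∑ k, β.d (J k) := Equiv.sum_comp σ fun k => β.d (J k)
  have e3 : ∀ z : ℤ, sg K (-1 * z) = sg K z := fun z => sg_congr K ⟨-z, by ring⟩
  rw [e3, e3] at h2
  rw [trExp, trExp, e1, e2, ← Function.comp_assoc, ← Function.comp_assoc, pairSum_perm]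
  simp only [sg_add, h1, h2, Function.comp_apply, sub_eq_add_neg]
  ring

/-- The symmetry sign of maps in `homPM` for a permutation of the outputs and of the inputs. -/
def symSign {m l : ℕ} (H : Fin m → β.I) (J : Fin l → β.I) (ρ : Equiv.Perm (Fin m))
    (σ : Equiv.Perm (Fin l)) : K :=
  (sg K (koszulExp ρ (β.d ∘ H)) * permSign K n ρ) * (sg K (koszulExp σ (β.d ∘ J)) * permSign K 1 σ)

theorem symSign_mul_self {m l : ℕ} (H : Fin m → β.I) (J : Fin l → β.I) (ρ : Equiv.Perm (Fin m))
    (σ : Equiv.Perm (Fin l)) : (β.symSign n H J ρ σ * β.symSign n H J ρ σ : K) = 1 := by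
  have h1 := sg_mul_self K (koszulExp ρ (β.d ∘ H))
  have h2 := sg_mul_self K (koszulExp σ (β.d ∘ J))
  have h3 := permSign_mul_self K n ρ
  have h4 := permSign_mul_self K 1 σ
  rw [symSign]
  linear_combination (sg K (koszulExp σ (β.d ∘ J)) * sg K (koszulExp σ (β.d ∘ J)) *
    permSign K n ρ * permSign K n ρ * permSign K 1 σ * permSign K 1 σ) * h1 +
    permSign K n ρ * permSign K n ρ * permSign K 1 σ * permSign K 1 σ * h2 +
    permSign K 1 σ * permSign K 1 σ * h3 + h4

theorem mem_homPM_iff' {l m : ℕ} (L : TP g l →ₗ[K] TP g m) : L ∈ homPM g n l m ↔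
    ∀ (ρ : Equiv.Perm (Fin m)) (σ : Equiv.Perm (Fin l)) H J, β.ent L (H ∘ ρ) (J ∘ σ) = β.symSign n H J ρ σ * β.ent L H J := by
  rw [mem_homPM_iff]
  have k1 : ∀ N : ℕ, koszulExp (1 : Equiv.Perm (Fin N)) = fun _ => 0 := by
    intro N
    funext c
    refine Finset.sum_eq_zero fun i _ => Finset.sum_eq_zero fun j _ => if_neg ?_
    rintro ⟨h1, h2⟩
    exact absurd h1 (lt_asymm h2)
  have p1 : ∀ {N : ℕ} (k : ℤ), permSign K k (1 : Equiv.Perm (Fin N)) = 1 := by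
    intro N k
    rw [permSign_eq, k1, mul_zero, sg_zero]
  constructor
  · rintro ⟨h1, h2⟩ ρ σ H J
    have a1 := h1 σ (H ∘ ρ) J
    have a2 := h2 ρ H J
    have b1 := sg_mul_self K (koszulExp σ (β.d ∘ J))
    have b2 := sg_mul_self K (koszulExp ρ (β.d ∘ H))
    rw [symSign]
    linear_combination sg K (koszulExp σ (β.d ∘ J)) * a1 +
      sg K (koszulExp ρ (β.d ∘ H)) * sg K (koszulExp σ (β.d ∘ J)) * permSign K 1 σ * a2 -
      β.ent L (H ∘ ρ) (J ∘ σ) * b1 -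
      sg K (koszulExp σ (β.d ∘ J)) * permSign K 1 σ * β.ent L (H ∘ ρ) J * b2
  · intro h
    refine ⟨fun σ H J => ?_, fun ρ H J => ?_⟩
    · have := h 1 σ H J
      rw [Equiv.Perm.coe_one, Function.comp_id, symSign, k1, p1, sg_zero] at this
      have b1 := sg_mul_self K (koszulExp σ (β.d ∘ J))
      rw [this]
      linear_combination permSign K 1 σ * β.ent L H J * b1
    · have := h ρ 1 H J
      rw [Equiv.Perm.coe_one, Function.comp_id, symSign, k1, p1, sg_zero] at this
      have b1 := sg_mul_self K (koszulExp ρ (β.d ∘ H))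
      rw [this]
      linear_combination permSign K n ρ * β.ent L H J * b1

/-- Coefficients carry the Koszul signs of the operators E and F, in degrees d + n and d - 1 up to
sign. By `trExp_perm` the factor `trExp` cancels these and leaves exactly the symmetry of the maps.
-/
theorem toMap_mem (m l : ℕ) (P : Pol (symDual g).toGCA n) : β.toMap n m l P ∈ homPM g n l m := by
  rw [β.mem_homPM_iff']
  intro ρ σ H J
  rw [ent_toMap, ent_toMap, coef_perm, trExp_perm, sg_add, symSign]
  have b1 := sg_mul_self K (koszulExp ρ fun k => β.d (H k) + n)
  have b2 := sg_mul_self K (koszulExp σ fun k => β.d (J k) - 1)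
  linear_combination (sg K (β.trExp n H J) * β.coef n H J P * (sg K (koszulExp ρ (β.d ∘ H)) *
    permSign K n ρ) * (sg K (koszulExp σ (β.d ∘ J)) * permSign K 1 σ)) *
    ((sg K (koszulExp σ fun k => β.d (J k) - 1) * sg K (koszulExp σ fun k => β.d (J k) - 1)) * b1 +
      b2)

/-- The augmentation vanishes outside degree 0, so a nonzero entry must balance degree n + 2 against
the degrees of the operators; that balance is `mapDeg`. -/
theorem toMap_hasDegree (m l : ℕ) {P : Pol (symDual g).toGCA n}
    (hP : P ∈ (polPres (symDual g).toGCA n).degPart (n + 2)) :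
    HasDegree (β.toMap n m l P) (mapDeg n m l) := by
  rw [β.hasDegree_iff]
  intro H J h
  rw [ent_toMap] at h
  have := β.degree_of_coef_ne_zero n hP (right_ne_zero_of_mul h)
  rw [mapDeg]
  linarith

end HomBasis

/-! ### Reversal of the inputs, and position sums in the transfer formula. -/

section Parity

theorem koszulExp_revPerm {l : ℕ} (c : Fin l → ℤ) : koszulExp Fin.revPerm c = pairSum c := by
  rw [← pairSum_perm Fin.revPerm]
  simp [koszulExp, pairSum, Fin.rev_lt_rev]

theorem posSum_one (l : ℕ) : posSum (fun _ : Fin l => 1) = pairs l := by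
  induction l with
  | zero => rfl
  | succ l ih =>
    rw [pairs_succ, ← ih]
    simp [posSum, Fin.sum_univ_castSucc]

theorem posSum_sub {l : ℕ} (c c' : Fin l → ℤ) :
    posSum (fun k => c k - c' k) = posSum c - posSum c' := by
  simp [posSum, mul_sub]

theorem pairSum_neg {l : ℕ} (c : Fin l → ℤ) : pairSum (fun k => -c k) = pairSum c := by
  simp [pairSum]

theorem sum_mul_pos {m : ℕ} (c : Fin m → ℤ) (n r : ℤ) :
    ∑ k, c k * (((m : ℤ) - (((k : ℕ) : ℤ) + 1)) * n + r) =
      ((m - 1) * n + r) * ∑ k, c k - n * posSum c := by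
  rw [posSum, Finset.mul_sum, Finset.mul_sum, ← Finset.sum_sub_distrib]
  exact Finset.sum_congr rfl fun k _ => by ring

end Parity

/-! ### Agreement with the transfer formula on monomials. -/

namespace HomBasis

variable {K : Type u} [Field K] {g : CochainComplex (ModuleCat.{v} K) ℤ} (n : ℤ) (β : HomBasis g)

/-- This identity dictates the definition of `trExp`: it is the sign that carries the Wick signs
over to those of the transfer formula. The hypotheses on degrees hold whenever the pairings in
question are nonzero. -/
theorem monomial_sign {m l : ℕ} {a : Fin m → ℤ} {b : Fin l → ℤ} {H : Fin m → β.I} {J : Fin l → β.I}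
    {ρ : Equiv.Perm (Fin m)} {σ : Equiv.Perm (Fin l)} (hH : ∀ k, β.d (H k) = a (ρ k))
    (hJ : ∀ j, β.d (J j) = 1 - b (σ j)) :
    sg K (β.trExp n H J) * (sg K ((∑ k, (a k + n)) * ∑ j, (β.d (J j) - 1)) *
      (sg K (pairSum (fun k => a k + n) + koszulExp ρ fun k => a k + n) *
        sg K (pairSum b + koszulExp σ b))) =
    (sg K (∑ k, a k * (((m : ℤ) - (((k : ℕ) : ℤ) + 1)) * n + l)) *
      sg K (∑ j, (b j - 1) * ((l : ℤ) - (((j : ℕ) : ℤ) + 1)))) *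
      ((permSign K n ρ * sg K (koszulExp ρ a)) *
        (permSign K 1 σ * sg K (koszulExp σ fun j => b j - 1)) *
          sg K (koszulExp Fin.revPerm (β.d ∘ J))) := by
  have eH : β.d ∘ H = a ∘ ρ := funext hH
  have eJ : β.d ∘ J = fun j => 1 - (b ∘ σ) j := funext hJ
  have s1 : ∑ k, β.d (H k) = ∑ k, a k := by
    simp only [hH]; exact Equiv.sum_comp ρ a
  have s2 : ∑ k, β.d (J k) = l - ∑ k, b k := by
    simp only [hJ, Finset.sum_sub_distrib]
    rw [Equiv.sum_comp σ b]; simp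
  have s3 : ∑ j, (b j - 1) * ((l : ℤ) - (((j : ℕ) : ℤ) + 1)) =
      (l - 1) * (∑ k, b k - l) - (posSum b - pairs l) := by
    have h := sum_mul_pos (fun j => b j - 1) 1 0
    rw [posSum_sub, posSum_one] at h
    simpa using h
  -- The degrees 1 - b are those of b negated and shifted by one; `pairSum` ignores the negation and
  -- changes under the shift by an explicit amount.
  have s4 : pairSum (β.d ∘ J) = pairSum b - ((l - 1) * ∑ k, b k) + pairs l := by
    have h := pairSum_add_const (b ∘ σ) (-1)
    rw [pairSum_perm, ← pairSum_neg] at h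
    rw [eJ]
    have e : ∑ i, (b ∘ σ) i = ∑ i, b i := Equiv.sum_comp σ b
    rw [e] at h
    have e2 : (fun j => 1 - (b ∘ σ) j) = fun j => -((b ∘ σ) j + -1) := by
      funext j; ring
    rw [e2, h]
    ring
  rw [permSign_eq, permSign_eq, koszulExp_revPerm, trExp, s1, s2, s3, s4, sum_mul_pos, eJ, posSum_sub,
    posSum_one, eH, pairSum_perm, pairSum_add_const]
  simp only [← sg_add]
  refine sg_eq_of_zmod K ?_
  have k2 := koszulExp_shift σ b (-1)
  simp only [Finset.sum_add_distrib, Finset.sum_sub_distrib, s2, Finset.sum_const, Finset.card_univ,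
    Fintype.card_fin, nsmul_eq_mul, mul_one, one_mul, ← sub_eq_add_neg] at k2 ⊢
  push_cast at k2 ⊢
  rw [koszulExp_shift, k2]
  have i1 := zmod_two_mul_self (n : ZMod 2)
  have i2 := zmod_two_mul_self (m : ZMod 2)
  have i3 := zmod_two_mul_self (l : ZMod 2)
  generalize (∑ k, ((a k : ℤ) : ZMod 2)) = A
  generalize (∑ k, ((b k : ℤ) : ZMod 2)) = B
  generalize ((posSum a : ℤ) : ZMod 2) = x1
  generalize ((posSum (a ∘ ρ) : ℤ) : ZMod 2) = x2
  generalize ((posSum b : ℤ) : ZMod 2) = x3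
  generalize ((posSum (b ∘ σ) : ℤ) : ZMod 2) = x4
  generalize ((pairSum a : ℤ) : ZMod 2) = x5
  generalize ((pairSum b : ℤ) : ZMod 2) = x6
  -- With position and pair sums as indeterminates, a polynomial identity over `ZMod 2` with
  -- idempotent n, m and l remains.
  grind

theorem ent_toMap_monomial {m l : ℕ} {a : Fin m → ℤ} {b : Fin l → ℤ} (x : ∀ k, g.X (a k))
    (θ : ∀ j, (shiftedDual g).X (b j)) (H : Fin m → β.I) (J : Fin l → β.I) :
    β.ent (β.toMap n m l (monomial g n x θ)) H J =
      (sg K (∑ k, a k * (((m : ℤ) - (((k : ℕ) : ℤ) + 1)) * n + l)) *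
        sg K (∑ j, (b j - 1) * ((l : ℤ) - (((j : ℕ) : ℤ) + 1)))) *
      ∑ σ : Equiv.Perm (Fin l), ∑ ρ : Equiv.Perm (Fin m),
        ((permSign K n ρ * sg K (koszulExp ρ a)) *
          (permSign K 1 σ * sg K (koszulExp σ fun j => b j - 1)) *
          sg K (koszulExp Fin.revPerm (β.d ∘ J)) *
          ∏ j, functional g (θ (σ j)) (inc g (β.x (J j)))) *
        ∏ k, functional g (β.θ (H k)) (inc g (x (ρ k))) := by
  rw [ent_toMap, coef_monomial, aug_prodE_vf, aug_prodF_fn]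
  generalize hz : (∑ k, (a k + n)) * ∑ j, (β.d (J j) - 1) = z
  simp only [Finset.mul_sum, Finset.sum_mul]
  refine Finset.sum_congr rfl fun σ _ => Finset.sum_congr rfl fun ρ _ => ?_
  -- A vanishing pairing kills both sides; nonvanishing ones fix all the degrees that the sign
  -- comparison needs.
  by_cases h1 : ∏ j, functional g (θ (σ j)) (inc g (β.x (J j))) = 0
  · rw [h1]; ring
  by_cases h2 : ∏ k, functional g (β.θ (H k)) (inc g (x (ρ k))) = 0
  · rw [h2]; ring
  have := β.monomial_sign n (H := H) (J := J) (ρ := ρ) (σ := σ) (a := a) (b := b) (fun k => ?_) fun j => ?_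
  · rw [hz] at this
    linear_combination ((∏ j, functional g (θ (σ j)) (inc g (β.x (J j)))) *
      ∏ k, functional g (β.θ (H k)) (inc g (x (ρ k)))) * this
  · exact β.functional_inc_ne_zero (Finset.prod_ne_zero_iff.1 h2 k (Finset.mem_univ _))
  · by_contra h
    exact Finset.prod_ne_zero_iff.1 h1 j (Finset.mem_univ _) (functional_inc_of_ne _ _ h)

/-- The transfer formula on homogeneous elements. -/
theorem toMap_monomial {m l : ℕ} {a : Fin m → ℤ} {b : Fin l → ℤ} (x : ∀ k, g.X (a k))
    (θ : ∀ j, (shiftedDual g).X (b j)) (c : Fin l → ℤ) (y : ∀ j, g.X (c j)) :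
    β.toMap n m l (monomial g n x θ) (PiTensorProduct.tprod K fun j => inc g (y j)) =
      (sg K (∑ k, a k * (((m : ℤ) - (((k : ℕ) : ℤ) + 1)) * n + l)) *
        sg K (∑ j, (b j - 1) * ((l : ℤ) - (((j : ℕ) : ℤ) + 1)))) •
      ∑ σ : Equiv.Perm (Fin l), ∑ ρ : Equiv.Perm (Fin m),
        ((permSign K n ρ * sg K (koszulExp ρ a)) *
          (permSign K 1 σ * sg K (koszulExp σ fun j => b j - 1)) *
          sg K (koszulExp Fin.revPerm c) *
          ∏ j, functional g (θ (σ j)) (inc g (y j))) •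
        PiTensorProduct.tprod K fun k => inc g (x (ρ k)) := by
  refine β.coord_ext fun H => ?_
  -- Expanding each y_j in the basis reduces the formula for arbitrary homogeneous inputs to the
  -- matrix entries already known.
  have hθ : ∀ (σ : Equiv.Perm (Fin l)), ∏ j, functional g (θ (σ j)) (inc g (y j)) =
      ∑ J : Fin l → β.I, (∏ j, functional g (β.θ (J j)) (inc g (y j))) *
        ∏ j, functional g (θ (σ j)) (inc g (β.x (J j))) := by
    intro σ
    simp only [← Finset.prod_mul_distrib]
    rw [← Fintype.piFinset_univ, ← Finset.prod_univ_sum (fun _ => Finset.univ)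
      fun j i => functional g (β.θ i) (inc g (y j)) * functional g (θ (σ j)) (inc g (β.x i))]
    refine Finset.prod_congr rfl fun j _ => ?_
    conv_lhs => rw [β.expand (inc g (y j)), map_sum]
    simp only [map_smul, smul_eq_mul]
  rw [coord_map]
  simp only [map_smul, map_sum, smul_eq_mul, coord_tprod, ent_toMap_monomial, hθ]
  simp only [Finset.mul_sum, Finset.sum_mul]
  rw [Finset.sum_comm]
  refine Finset.sum_congr rfl fun σ _ => ?_
  rw [Finset.sum_comm]
  refine Finset.sum_congr rfl fun ρ _ => Finset.sum_congr rfl fun J _ => ?_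
  by_cases h : ∏ j, functional g (β.θ (J j)) (inc g (y j)) = 0
  · rw [h]; ring
  -- Only basis vectors of the degrees of the y_j contribute, so the reversal sign is the same for
  -- every surviving J.
  have e : β.d ∘ J = c := funext fun j =>
    β.functional_inc_ne_zero (Finset.prod_ne_zero_iff.1 h j (Finset.mem_univ _))
  rw [e]
  ring

theorem toMap_monomial_of_ne {m l l' : ℕ} {a : Fin m → ℤ} {b : Fin l → ℤ} (x : ∀ k, g.X (a k))
    (θ : ∀ j, (shiftedDual g).X (b j)) (h : l' ≠ l) : β.toMap n m l' (monomial g n x θ) = 0 := by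
  refine β.ent_ext fun H J => ?_
  rw [ent_toMap, coef_monomial, aug_prodF_fn_of_ne n β θ J h]
  simp [ent]

end HomBasis

theorem sum_sum_comm {A B C D M : Type*} [Fintype A] [Fintype B] [Fintype C] [Fintype D]
    [AddCommMonoid M] (F : A → B → C → D → M) :
    ∑ a, ∑ b, ∑ c, ∑ d, F a b c d = ∑ c, ∑ d, ∑ a, ∑ b, F a b c d := by
  have h := Finset.sum_comm (s := Finset.univ) (t := Finset.univ)
    (f := fun (x : A × B) (y : C × D) => F x.1 x.2 y.1 y.2)
  simpa only [Fintype.sum_prod_type] using h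

namespace HomBasis

variable {K : Type u} [Field K] {g : CochainComplex (ModuleCat.{v} K) ℤ} (n : ℤ) (β : HomBasis g)

/-! ### Symmetrized monomials -/

/-- The exponent of the normalizing sign of a monomial. -/
def monoExp {m l : ℕ} (H : Fin m → β.I) (J : Fin l → β.I) : ℤ :=
  β.trExp n H J + (∑ k, (β.d (H k) + n)) * (∑ j, (β.d (J j) - 1)) +
    pairSum (fun k => β.d (H k) + n) + pairSum fun j => 1 - β.d (J j)

/-- The monomials with a normalizing sign, which have the symmetry of the maps in `homPM`. -/
noncomputable def symMono {m l : ℕ} (H : Fin m → β.I) (J : Fin l → β.I) : Pol (symDual g).toGCA n :=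
  sg K (β.monoExp n H J) • β.mono n H J

theorem mono_perm {m l : ℕ} (H : Fin m → β.I) (J : Fin l → β.I) (ρ : Equiv.Perm (Fin m))
    (σ : Equiv.Perm (Fin l)) : β.mono n (H ∘ ρ) (J ∘ σ) =
      (sg K (koszulExp ρ fun k => β.d (H k) + n) * sg K (koszulExp σ fun j => 1 - β.d (J j))) •
        β.mono n H J := by
  have h1 := prod_perm (K := K) (fun k => β.f n (H k)) (fun k => β.d (H k) + n)
    (fun _ _ => GradedPres.mul_comm' (β.f_mem n _) (β.f_mem n _)) ρ
  have h2 := prod_perm (K := K) (fun k => β.e n (J k)) (fun k => 1 - β.d (J k))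
    (fun _ _ => GradedPres.mul_comm' (β.e_mem n _) (β.e_mem n _)) σ
  rw [mono_eq, mono_eq, ← smul_mul_smul_comm]
  exact congrArg₂ (· * ·) h1 h2

theorem koszulExp_sub_comm {l : ℕ} (σ : Equiv.Perm (Fin l)) (c c' : Fin l → ℤ) :
    (koszulExp σ fun j => c j - c' j) = koszulExp σ fun j => c' j - c j := by
  refine Finset.sum_congr rfl fun i _ => Finset.sum_congr rfl fun j _ => ?_
  split_ifs <;> ring

/-- The generators commute with the Koszul signs of their own degrees, and the `trExp` contained in
the normalizing sign converts these into the symmetry of the maps. -/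
theorem symMono_perm {m l : ℕ} (H : Fin m → β.I) (J : Fin l → β.I) (ρ : Equiv.Perm (Fin m))
    (σ : Equiv.Perm (Fin l)) : β.symMono n (H ∘ ρ) (J ∘ σ) =
      (β.symSign n H J ρ σ : K) • β.symMono n H J := by
  have e1 : ∑ k, (β.d ((H ∘ ρ) k) + n) = ∑ k, (β.d (H k) + n) :=
    Equiv.sum_comp ρ fun k => β.d (H k) + n
  have e2 : ∑ k, (β.d ((J ∘ σ) k) - 1) = ∑ k, (β.d (J k) - 1) :=
    Equiv.sum_comp σ fun k => β.d (J k) - 1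
  have e3 : pairSum (fun k => β.d ((H ∘ ρ) k) + n) = pairSum fun k => β.d (H k) + n :=
    pairSum_perm ρ fun k => β.d (H k) + n
  have e4 : pairSum (fun k => 1 - β.d ((J ∘ σ) k)) = pairSum fun k => 1 - β.d (J k) :=
    pairSum_perm σ fun k => 1 - β.d (J k)
  have b1 := sg_mul_self K (koszulExp ρ fun k => β.d (H k) + n)
  have b2 := sg_mul_self K (koszulExp σ fun k => β.d (J k) - 1)
  rw [symMono, symMono, mono_perm, monoExp, monoExp, e1, e2, e3, e4, koszulExp_sub_comm σ fun _ => 1]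
  simp only [sg_add, trExp_perm, smul_smul, symSign]
  congr 1
  linear_combination (sg K (β.trExp n H J) * sg K ((∑ k, (β.d (H k) + n)) * ∑ j, (β.d (J j) - 1)) *
    sg K (pairSum fun k => β.d (H k) + n) * sg K (pairSum fun j => 1 - β.d (J j)) *
    (sg K (koszulExp ρ (β.d ∘ H)) * permSign K n ρ) *
    (sg K (koszulExp σ (β.d ∘ J)) * permSign K 1 σ)) *
    ((sg K (koszulExp σ fun k => β.d (J k) - 1) * sg K (koszulExp σ fun k => β.d (J k) - 1)) * b1 + b2)

/-- Wick's formula on basis elements gives a sum over permutations matching the indices; the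
normalizing sign cancels everything except the symmetry sign. -/
theorem ent_toMap_symMono {m l : ℕ} (H H' : Fin m → β.I) (J J' : Fin l → β.I) :
    β.ent (β.toMap n m l (β.symMono n H J)) H' J' = ∑ ρ : Equiv.Perm (Fin m),
      ∑ σ : Equiv.Perm (Fin l), if H' = H ∘ ρ then if J' = J ∘ σ then β.symSign n H J ρ σ else 0
        else 0 := by
  rw [ent_toMap, symMono, map_smul, mono, coef_monomial, aug_prodE_vf, aug_prodF_fn]
  simp only [β.pair, Finset.prod_ite_zero, Finset.prod_const_one]
  generalize hz : (∑ k, (β.d (H k) + n)) * ∑ j, (β.d (J' j) - 1) = z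
  simp only [smul_eq_mul, Finset.mul_sum, Finset.sum_mul]
  rw [Finset.sum_comm]
  refine Finset.sum_congr rfl fun ρ _ => Finset.sum_congr rfl fun σ _ => ?_
  have q1 : (∀ k ∈ Finset.univ, H' k = H (ρ k)) ↔ H' = H ∘ ρ := by simp [funext_iff]
  have q2 : (∀ k ∈ Finset.univ, J (σ k) = J' k) ↔ J' = J ∘ σ := by simp [funext_iff, eq_comm]
  rw [if_congr q1 rfl rfl, if_congr q2 rfl rfl]
  by_cases h1 : H' = H ∘ ρ
  · by_cases h2 : J' = J ∘ σ
    · subst h1 h2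
      have e2 : ∑ k, (β.d ((J ∘ σ) k) - 1) = ∑ k, (β.d (J k) - 1) :=
        Equiv.sum_comp σ fun k => β.d (J k) - 1
      rw [e2] at hz
      rw [if_pos rfl, if_pos rfl, if_pos rfl, if_pos rfl, mul_one, mul_one, trExp_perm, symSign,
        monoExp, hz, koszulExp_sub_comm σ fun _ => 1]
      simp only [sg_add]
      have b1 := sg_mul_self K (koszulExp ρ fun k => β.d (H k) + n)
      have b2 := sg_mul_self K (koszulExp σ fun k => β.d (J k) - 1)
      have b3 := sg_mul_self K (β.trExp n H J)
      have b4 := sg_mul_self K z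
      have b5 := sg_mul_self K (pairSum fun k => β.d (H k) + n)
      have b6 := sg_mul_self K (pairSum fun j => 1 - β.d (J j))
      generalize sg K (koszulExp ρ fun k => β.d (H k) + n) = x1 at *
      generalize sg K (koszulExp σ fun k => β.d (J k) - 1) = x2 at *
      generalize sg K (β.trExp n H J) = x3 at *
      generalize sg K z = x4 at *
      generalize sg K (pairSum fun k => β.d (H k) + n) = x5 at *
      generalize sg K (pairSum fun j => 1 - β.d (J j)) = x6 at *
      linear_combination (sg K (koszulExp ρ (β.d ∘ H)) * permSign K n ρ *
        (sg K (koszulExp σ (β.d ∘ J)) * permSign K 1 σ)) *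
        (x2 * x2 * x3 * x3 * x4 * x4 * x5 * x5 * x6 * x6 * b1 + x3 * x3 * x4 * x4 * x5 * x5 * x6 * x6 * b2 +
          x4 * x4 * x5 * x5 * x6 * x6 * b3 + x5 * x5 * x6 * x6 * b4 + x6 * x6 * b5 + b6)
    · simp [h2]
  · simp [h1]

/-- The polyvector with prescribed matrix entries. -/
noncomputable def fromMap (m l : ℕ) : (TP g l →ₗ[K] TP g m) →ₗ[K] Pol (symDual g).toGCA n where
  toFun L := ∑ H, ∑ J, (((m.factorial : K) * l.factorial)⁻¹ * β.ent L H J) • β.symMono n H J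
  map_add' L L' := by simp only [ent_add, mul_add, add_smul, Finset.sum_add_distrib]
  map_smul' c L := by
    simp only [ent_smul, Finset.smul_sum, RingHom.id_apply, smul_smul, mul_left_comm c]

theorem fromMap_apply {m l : ℕ} (L : TP g l →ₗ[K] TP g m) : β.fromMap n m l L =
    ∑ H, ∑ J, (((m.factorial : K) * l.factorial)⁻¹ * β.ent L H J) • β.symMono n H J := rfl

theorem symMono_mem_weight {m l : ℕ} (H : Fin m → β.I) (J : Fin l → β.I) :
    β.symMono n H J ∈ Pol.weight (symDual g).toGCA n m :=
  Submodule.smul_mem _ _ (monomial_mem g n _ _)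

theorem fromMap_mem_weight {m l : ℕ} (L : TP g l →ₗ[K] TP g m) :
    β.fromMap n m l L ∈ Pol.weight (symDual g).toGCA n m :=
  Submodule.sum_mem _ fun H _ => Submodule.sum_mem _ fun J _ =>
    Submodule.smul_mem _ _ (β.symMono_mem_weight n H J)

theorem toMap_fromMap_of_ne {m l l' : ℕ} (h : l' ≠ l) (L : TP g l →ₗ[K] TP g m) :
    β.toMap n m l' (β.fromMap n m l L) = 0 := by
  rw [fromMap_apply, map_sum]
  refine Finset.sum_eq_zero fun H _ => ?_
  rw [map_sum]
  refine Finset.sum_eq_zero fun J _ => ?_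
  rw [map_smul, symMono, map_smul, mono, toMap_monomial_of_ne n β _ _ h, smul_zero, smul_zero]

variable [CharZero K]

theorem factorial_ne_zero (m l : ℕ) : (m.factorial : K) * l.factorial ≠ 0 :=
  mul_ne_zero (Nat.cast_ne_zero.2 m.factorial_ne_zero) (Nat.cast_ne_zero.2 l.factorial_ne_zero)

/-- By the symmetry of L each of the m! l! pairs of permutations contributes the same entry, and the
denominator, invertible in characteristic 0, turns the sum into an average. -/
theorem toMap_fromMap {m l : ℕ} {L : TP g l →ₗ[K] TP g m} (hL : L ∈ homPM g n l m) :
    β.toMap n m l (β.fromMap n m l L) = L := by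
  rw [β.mem_homPM_iff'] at hL
  refine β.ent_ext fun H' J' => ?_
  rw [fromMap_apply]
  simp only [map_sum, map_smul, ent_sum, ent_smul, ent_toMap_symMono, Finset.mul_sum]
  have step : ∀ (ρ : Equiv.Perm (Fin m)) (σ : Equiv.Perm (Fin l)), (∑ H, ∑ J,
      ((m.factorial : K) * l.factorial)⁻¹ * β.ent L H J *
        if H' = H ∘ ρ then if J' = J ∘ σ then β.symSign n H J ρ σ else 0 else 0) =
      ((m.factorial : K) * l.factorial)⁻¹ * β.ent L H' J' := by
    intro ρ σ
    rw [Finset.sum_eq_single (H' ∘ ρ.symm), Finset.sum_eq_single (J' ∘ σ.symm)]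
    · have e1 : H' = (H' ∘ ρ.symm) ∘ ρ := by funext k; simp
      have e2 : J' = (J' ∘ σ.symm) ∘ σ := by funext k; simp
      rw [if_pos e1, if_pos e2]
      conv_rhs => rw [e1, e2, hL]
      ring
    · intro J _ h
      rw [if_neg (c := J' = J ∘ σ)]
      · simp
      · rintro rfl
        apply h
        funext k; simp
    · intro h
      exact absurd (Finset.mem_univ _) h
    · intro H _ h
      refine Finset.sum_eq_zero fun J _ => ?_
      rw [if_neg, mul_zero]
      rintro rfl
      apply h
      funext k; simp
    · intro h
      exact absurd (Finset.mem_univ _) h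
  rw [sum_sum_comm]
  simp only [step, Finset.sum_const, Finset.card_univ, Fintype.card_perm, Fintype.card_fin,
    nsmul_eq_mul]
  have := mul_inv_cancel₀ (factorial_ne_zero (K := K) m l)
  linear_combination β.ent L H' J' * this

/-- The signed orbit of a monomial consists of m! l! terms that `symMono_perm` folds back into the
same element, the sign appearing twice. -/
theorem fromMap_toMap_symMono {m l : ℕ} (H : Fin m → β.I) (J : Fin l → β.I) :
    β.fromMap n m l (β.toMap n m l (β.symMono n H J)) = β.symMono n H J := by
  rw [fromMap_apply]
  simp only [ent_toMap_symMono, Finset.mul_sum, Finset.sum_smul]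
  have step : ∀ (ρ : Equiv.Perm (Fin m)) (σ : Equiv.Perm (Fin l)), (∑ H', ∑ J',
      (((m.factorial : K) * l.factorial)⁻¹ *
        if H' = H ∘ ρ then if J' = J ∘ σ then β.symSign n H J ρ σ else 0 else 0) •
          β.symMono n H' J') = ((m.factorial : K) * l.factorial)⁻¹ • β.symMono n H J := by
    intro ρ σ
    rw [Finset.sum_eq_single (H ∘ ρ), Finset.sum_eq_single (J ∘ σ)]
    · rw [if_pos rfl, if_pos rfl, symMono_perm, smul_smul, mul_assoc, symSign_mul_self, mul_one]
    · intro J' _ h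
      rw [if_pos rfl, if_neg h, mul_zero, zero_smul]
    · intro h
      exact absurd (Finset.mem_univ _) h
    · intro H' _ h
      refine Finset.sum_eq_zero fun J' _ => ?_
      rw [if_neg h, mul_zero, zero_smul]
    · intro h
      exact absurd (Finset.mem_univ _) h
  rw [sum_sum_comm]
  simp only [step, Finset.sum_const, Finset.card_univ, Fintype.card_perm, Fintype.card_fin]
  rw [← Nat.cast_smul_eq_nsmul K, ← Nat.cast_smul_eq_nsmul K, smul_smul, smul_smul]
  rw [mul_inv_cancel₀ (factorial_ne_zero (K := K) m l), one_smul]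

/-! ### The transfer isomorphism -/

/-- The inverse of the transfer isomorphism. -/
noncomputable def invTransfer (m : ℕ) :
    (DirectSum ℕ fun l => homPM g n l m) →ₗ[K] Pol.weight (symDual g).toGCA n m :=
  DirectSum.toModule K ℕ _ fun l => LinearMap.codRestrict _
    (β.fromMap n m l ∘ₗ (homPM g n l m).subtype) fun L => β.fromMap_mem_weight n L.1

theorem toMap_invTransfer {m : ℕ} (z : DirectSum ℕ fun l => homPM g n l m) (l : ℕ) :
    β.toMap n m l (β.invTransfer n m z).1 = (z l).1 := by
  induction z using DirectSum.induction_on with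
  | zero => simp
  | of l' L =>
    have h : (β.invTransfer n m (DirectSum.of (fun l => homPM g n l m) l' L)).1 =
        β.fromMap n m l' L.1 := by
      have := DirectSum.toModule_lof K l' L (φ := fun l => LinearMap.codRestrict _
        (β.fromMap n m l ∘ₗ (homPM g n l m).subtype) fun L => β.fromMap_mem_weight n L.1)
      exact congrArg Subtype.val this
    rw [h]
    by_cases hl : l = l'
    · subst hl
      rw [toMap_fromMap n β L.2, DirectSum.of_eq_same]
    · rw [toMap_fromMap_of_ne n β hl, DirectSum.of_eq_of_ne _ _ _ hl]
      rfl
  | add z z' h h' =>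
    rw [map_add, Submodule.coe_add, map_add, h, h']
    rfl

/-- Injectivity holds because `toMap` reads every component back. Surjectivity holds because
monomials span each weight and each is, up to sign, a symmetrized monomial, recovered from its own
map. -/
theorem invTransfer_bijective (m : ℕ) : Function.Bijective (β.invTransfer n m) := by
  constructor
  · intro z z' h
    refine DFinsupp.ext fun l => Subtype.ext ?_
    have := β.toMap_invTransfer n z l
    rw [h, toMap_invTransfer] at this
    exact this.symm
  · rintro ⟨P, hP⟩
    suffices h : ∃ z, (β.invTransfer n m z).1 = P by
      obtain ⟨z, hz⟩ := h
      exact ⟨z, Subtype.ext hz⟩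
    refine β.weight_induction n (p := fun P => ∃ z, (β.invTransfer n m z).1 = P) ?_ ?_ ?_ ?_ hP
    · intro l H J
      refine ⟨sg K (β.monoExp n H J) • DirectSum.lof K ℕ (fun l => homPM g n l m) l
        ⟨_, β.toMap_mem n m l (β.symMono n H J)⟩, ?_⟩
      rw [map_smul, invTransfer, DirectSum.toModule_lof]
      change sg K (β.monoExp n H J) • β.fromMap n m l (β.toMap n m l (β.symMono n H J)) = _
      rw [fromMap_toMap_symMono, symMono, smul_smul, sg_mul_self, one_smul]
    · exact ⟨0, by rw [map_zero]; rfl⟩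
    · rintro a b ⟨z, rfl⟩ ⟨z', rfl⟩
      exact ⟨z + z', by rw [map_add]; rfl⟩
    · rintro c a ⟨z, rfl⟩
      exact ⟨c • z, by rw [map_smul]; rfl⟩

/-- The transfer isomorphism. -/
noncomputable def transfer (m : ℕ) : Pol.weight (symDual g).toGCA n m ≃ₗ[K]
    DirectSum ℕ fun l => homPM g n l m :=
  (LinearEquiv.ofBijective (β.invTransfer n m) (β.invTransfer_bijective n m)).symm

theorem transfer_apply {m : ℕ} (P : Pol.weight (symDual g).toGCA n m) (l : ℕ) :
    (β.transfer n m P l).1 = β.toMap n m l P.1 := by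
  rw [← toMap_invTransfer]
  congr 2
  exact LinearEquiv.apply_symm_apply
    (LinearEquiv.ofBijective (β.invTransfer n m) (β.invTransfer_bijective n m)) P

theorem isTransfer : IsTransfer g n (β.transfer n) := by
  intro m l a b x θ
  constructor
  · intro l' h
    refine Subtype.ext ?_
    rw [transfer_apply, toMap_monomial_of_ne n β x θ h]
    rfl
  · intro c y
    rw [transfer_apply, toMap_monomial]

/-- Injectivity of the transfer in usable form: equations between polyvectors of a fixed weight may
be checked on the associated maps. -/
theorem weight_ext {m : ℕ} {P Q : Pol (symDual g).toGCA n} (hP : P ∈ Pol.weight (symDual g).toGCA n m)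
    (hQ : Q ∈ Pol.weight (symDual g).toGCA n m) (h : ∀ l, β.toMap n m l P = β.toMap n m l Q) :
    P = Q := by
  have : (⟨P, hP⟩ : Pol.weight (symDual g).toGCA n m) = ⟨Q, hQ⟩ := by
    refine (β.transfer n m).injective (DFinsupp.ext fun l => Subtype.ext ?_)
    rw [transfer_apply, transfer_apply, h]
  exact congrArg Subtype.val this

end HomBasis

/-! ### The transfer of the composition -/

/-- Selections are sorted by the number of selected elements. The attached antidiagonal retains a +
b = N, which is needed to transport maps along it. -/
theorem sum_bool_eq_sum_antidiagonal {M : Type*} [AddCommMonoid M] {N : ℕ}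
    (f : (Fin N → Bool) → M) : ∑ s, f s =
      ∑ ab ∈ (Finset.HasAntidiagonal.antidiagonal N).attach,
        ∑ s, if (∑ i, if s i then 1 else 0) = ab.1.1 then f s else 0 := by
  rw [Finset.sum_comm]
  refine Finset.sum_congr rfl fun s _ => ?_
  have hN : (∑ i : Fin N, if s i then 1 else 0) ≤ N := by
    refine (Finset.sum_le_card_nsmul _ _ 1 fun i _ => ?_).trans (by simp)
    split_ifs <;> simp
  rw [Finset.sum_attach _ fun ab : ℕ × ℕ => if (∑ i, if s i then 1 else 0) = ab.1 then f s else 0,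
    Finset.sum_eq_single (∑ i, if s i then 1 else 0, N - ∑ i, if s i then 1 else 0)]
  · rw [if_pos rfl]
  · rintro ⟨x, y⟩ hxy h
    rw [if_neg]
    rintro rfl
    apply h
    rw [Finset.HasAntidiagonal.mem_antidiagonal] at hxy
    ext
    · rfl
    · simp only; omega
  · intro h
    exact absurd (Finset.HasAntidiagonal.mem_antidiagonal.2 (Nat.add_sub_cancel' hN)) h

namespace HomBasis

variable {K : Type u} [Field K] {g : CochainComplex (ModuleCat.{v} K) ℤ} (n : ℤ) (β : HomBasis g)

/-- The Leibniz rule is applied twice, s distributing the F's and t the E's; the augmentation is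
multiplicative and splits the result. -/
theorem coef_mul {M N : ℕ} (H : Fin M → β.I) (J : Fin N → β.I) {u : ℤ}
    {U : Pol (symDual g).toGCA n} (hU : U ∈ (polPres (symDual g).toGCA n).degPart u)
    (V : Pol (symDual g).toGCA n) : β.coef n H J (U * V) =
      ∑ s : Fin N → Bool, ∑ t : Fin M → Bool,
        sg K ((selExp s fun k => β.d (J k) - 1) + u * ∑ i, if s i then 0 else β.d (J i) - 1) *
        (sg K ((selExp t fun k => -(β.d (H k) + n)) +
          (u + ∑ i, if s i then β.d (J i) - 1 else 0) * ∑ i, if t i then 0 else -(β.d (H i) + n)) *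
        (polAug g n (selProd t (fun k => β.opE n (H k)) (selProd s (fun k => β.opF n (J k)) U)) *
          polAug g n (selProd (fun i => !t i) (fun k => β.opE n (H k))
            (selProd (fun i => !s i) (fun k => β.opF n (J k)) V)))) := by
  have h1 := GCA.prod_der_mul (B := polGCA (symDual g).toGCA n) (fun k => β.opF_mem n (J k)) hU V
  have h2 : ∀ (s : Fin N → Bool) (V' : Pol (symDual g).toGCA n), _ := fun s V' =>
    GCA.prod_der_mul (B := polGCA (symDual g).toGCA n) (fun k => β.opE_mem n (H k))
      (GCA.selProd_mem (B := polGCA (symDual g).toGCA n) s (fun k => β.opF_mem n (J k)) hU) V'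
  rw [coef_apply, prodF]
  refine (congrArg (fun z => polAug g n (β.prodE n H z)) h1).trans ?_
  rw [map_sum, map_sum]
  refine Finset.sum_congr rfl fun s _ => ?_
  rw [map_smul, map_smul, prodE, smul_eq_mul]
  refine (congrArg (fun z => _ * polAug g n z) (h2 s _)).trans ?_
  rw [map_sum, Finset.mul_sum]
  refine Finset.sum_congr rfl fun t _ => ?_
  rw [map_smul, smul_eq_mul, map_mul]

theorem selProd_mem_intWeight {δ : ℤ} {N : ℕ} (s : Fin N → Bool)
    {D : Fin N → Module.End K (Pol (symDual g).toGCA n)}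
    (h : ∀ k i P, P ∈ intWeight (symDual g).toGCA n i → D k P ∈ intWeight (symDual g).toGCA n (i + δ))
    {i : ℤ} {P : Pol (symDual g).toGCA n} (hP : P ∈ intWeight (symDual g).toGCA n i) :
    selProd s D P ∈ intWeight (symDual g).toGCA n (i + (∑ k, if s k then 1 else 0 : ℕ) * δ) := by
  induction N with
  | zero => simpa [selProd] using hP
  | succ N ih =>
    obtain ⟨x, s, rfl⟩ : ∃ x s', s = Fin.cons x s' := ⟨s 0, Fin.tail s, (Fin.cons_self_tail s).symm⟩
    have := ih s fun k => h k.succ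
    rw [selProd_cons, Fin.sum_univ_succ]
    simp only [Fin.cons_zero, Fin.cons_succ]
    cases x
    · simpa using this
    · rw [if_pos rfl, if_pos rfl, Module.End.mul_apply]
      refine Pol.mem_congr (S := intWeight _ n) ?_ (h 0 _ _ this)
      push_cast; ring

/-- The product formula when the weight of the first factor is known. -/
theorem coef_mul_of_weight {p q N : ℕ} (H : Fin (p + q) → β.I) (J : Fin N → β.I) {u : ℤ}
    {U : Pol (symDual g).toGCA n} (hU : U ∈ (polPres (symDual g).toGCA n).degPart u)
    (hp : U ∈ intWeight (symDual g).toGCA n p) (V : Pol (symDual g).toGCA n) :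
    β.coef n H J (U * V) = ∑ s : Fin N → Bool, ∑ ρ ∈ shuffles p q,
        sg K ((selExp s fun k => β.d (J k) - 1) + u * ∑ i, if s i then 0 else β.d (J i) - 1) *
        (sg K ((koszulExp ρ fun k => -(β.d (H k) + n)) +
          (u + ∑ i, if s i then β.d (J i) - 1 else 0) *
            ∑ i : Fin q, -(β.d (H (ρ (Fin.natAdd p i))) + n)) *
        (polAug g n (β.prodE n (fun k => H (ρ (Fin.castAdd q k)))
            (selProd s (fun k => β.opF n (J k)) U)) *
          polAug g n (β.prodE n (fun k => H (ρ (Fin.natAdd p k)))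
            (selProd (fun i => !s i) (fun k => β.opF n (J k)) V)))) := by
  rw [β.coef_mul n H J hU]
  refine Finset.sum_congr rfl fun s _ => ?_
  have h := sum_shuffles (a := p) (b := q) fun t => 
        sg K ((selExp s fun k => β.d (J k) - 1) + u * ∑ i, if s i then 0 else β.d (J i) - 1) *
        (sg K ((selExp t fun k => -(β.d (H k) + n)) +
          (u + ∑ i, if s i then β.d (J i) - 1 else 0) * ∑ i, if t i then 0 else -(β.d (H i) + n)) *
        (polAug g n (selProd t (fun k => β.opE n (H k)) (selProd s (fun k => β.opF n (J k)) U)) *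
          polAug g n (selProd (fun i => !t i) (fun k => β.opE n (H k))
            (selProd (fun i => !s i) (fun k => β.opF n (J k)) V))))
  refine Eq.trans (Finset.sum_congr rfl fun t _ => ?_) (h.symm.trans (Finset.sum_congr rfl fun ρ hρ => ?_))
  · split_ifs with ht
    · rfl
    -- If the number of E's acting on U is not p, the first factor retains nonzero weight and the
    -- augmentation kills it.
    · have hw := selProd_mem_intWeight n t (fun k _ _ => β.opE_mem_intWeight n (H k))
        (selProd_mem_intWeight n s (fun k _ _ => β.opF_mem_intWeight n (J k)) hp)
      rw [polAug_of_weight n hw (by omega)]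
      ring
  · rw [selExp_firstBlock hρ, sum_not_firstBlock, selProd_firstBlock hρ, selProd_not_firstBlock hρ]
    rfl

/-- The contraction index is already adjacent on the right, so it becomes the last input without a
sign. -/
theorem prodF_opF {l : ℕ} (J : Fin l → β.I) (i : β.I) (P : Pol (symDual g).toGCA n) :
    β.prodF n J (β.opF n i P) = β.prodF n (Fin.snoc J i : Fin (l + 1) → β.I) P := by
  rw [prodF, prodF, prod_ofFn_succ', Module.End.mul_apply]
  simp only [Fin.snoc_castSucc, Fin.snoc_last]

/-- The contraction index has to become the first output, so its operator moves left past all F's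
and E's, with the corresponding sign. -/
theorem prodE_prodF_opE {m l : ℕ} (H : Fin m → β.I) (J : Fin l → β.I) (i : β.I)
    (P : Pol (symDual g).toGCA n) : β.prodE n H (β.prodF n J (β.opE n i P)) =
      sg K ((∑ k, (β.d (J k) - 1)) * -(β.d i + n) + (∑ k, -(β.d (H k) + n)) * -(β.d i + n)) •
        β.prodE n (Fin.cons i H : Fin (m + 1) → β.I) (β.prodF n J P) := by
  have h1 := prod_ofFn_mul_comm (K := K) (fun k => β.opF n (J k)) (fun k => β.d (J k) - 1)
    (β.opE n i) (-(β.d i + n)) fun k => β.opF_opE_comm n _ _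
  have h2 := prod_ofFn_mul_comm (K := K) (fun k => β.opE n (H k)) (fun k => -(β.d (H k) + n))
    (β.opE n i) (-(β.d i + n)) fun k => β.opE_comm n _ _
  have h1 := LinearMap.congr_fun h1 P
  have h2 := LinearMap.congr_fun h2 (β.prodF n J P)
  rw [Module.End.mul_apply, LinearMap.smul_apply, Module.End.mul_apply] at h1 h2
  have h3 : β.prodE n (Fin.cons i H : Fin (m + 1) → β.I) (β.prodF n J P) =
      β.opE n i (β.prodE n H (β.prodF n J P)) := by
    rw [prodE, prod_ofFn_succ, Module.End.mul_apply]
    rfl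
  rw [h3, sg_add, mul_smul]
  refine (congrArg (β.prodE n H) h1).trans ((map_smul _ _ _).trans ?_)
  exact congrArg _ h2

/-- On the left are the signs of the transfer, of the contraction, of distributing both families of
operators, and of moving the contraction operator to the front; on the right those of the quadratic
identity. They agree only because both coefficients have degree n + 2, which is the content of `d₁`
and `d₂`. -/
theorem comp_sign {p q a b : ℕ} {H : Fin (p + 1 + q) → β.I} {J : Fin (a + b) → β.I}
    (ρ : Equiv.Perm (Fin (p + 1 + q))) (σ : Equiv.Perm (Fin (a + b))) (i : β.I)
    {h₁ : Fin (p + 1) → β.I} {h₂ : Fin q → β.I} {j₁ : Fin a → β.I} {j₂ : Fin b → β.I}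
    (hh₁ : h₁ = fun k => H (ρ (Fin.castAdd q k))) (hh₂ : h₂ = fun k => H (ρ (Fin.natAdd (p + 1) k)))
    (hj₁ : j₁ = fun k => J (σ (Fin.castAdd b k))) (hj₂ : j₂ = fun k => J (σ (Fin.natAdd a k)))
    (d₁ : ∑ k, β.d (h₁ k) + (p + 1 : ℕ) * n = ∑ k, β.d (j₁ k) + β.d i - (a + 1 : ℕ) + (n + 2))
    (d₂ : β.d i + ∑ k, β.d (h₂ k) + (q + 1 : ℕ) * n = ∑ k, β.d (j₂ k) - b + (n + 2)) :
    sg K (β.trExp n H J) * (sg K (1 + (β.d i - 1) * n) *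
      (sg K ((koszulExp σ fun k => β.d (J k) - 1) + (n + 2 + (β.d i - 1)) * ∑ k, (β.d (j₂ k) - 1)) *
      (sg K ((koszulExp ρ fun k => -(β.d (H k) + n)) +
        (n + 2 + (β.d i - 1) + ∑ k, (β.d (j₁ k) - 1)) * ∑ k, -(β.d (h₂ k) + n)) *
      sg K ((∑ k, (β.d (j₂ k) - 1)) * -(β.d i + n) + (∑ k, -(β.d (h₂ k) + n)) * -(β.d i + n))))) =
    quadSign K n (p + 1) (a + 1) (q + 1) b * (permSign K 1 σ * permSign K n ρ *
      (sg K (koszulExp ρ (β.d ∘ H)) * (sg K (koszulExp σ (β.d ∘ J)) *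
        (sg K (mapDeg n (q + 1) b * ∑ r, β.d (j₁ r)) *
          (sg K (β.trExp n h₁ (Fin.snoc j₁ i : Fin (a + 1) → β.I)) *
            sg K (β.trExp n (Fin.cons i h₂ : Fin (q + 1) → β.I) j₂)))))) := by
  have eH : (β.d ∘ H) ∘ ρ = Fin.append (β.d ∘ h₁) (β.d ∘ h₂) := by
    funext k
    refine Fin.addCases (fun k => ?_) (fun k => ?_) k
    · rw [Fin.append_left, hh₁]; rfl
    · rw [Fin.append_right, hh₂]; rfl
  have eJ : (β.d ∘ J) ∘ σ = Fin.append (β.d ∘ j₁) (β.d ∘ j₂) := by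
    funext k
    refine Fin.addCases (fun k => ?_) (fun k => ?_) k
    · rw [Fin.append_left, hj₁]; rfl
    · rw [Fin.append_right, hj₂]; rfl
  have sH : ∑ k, β.d (H k) = ∑ k, β.d (h₁ k) + ∑ k, β.d (h₂ k) := by
    rw [← Equiv.sum_comp ρ, Fin.sum_univ_add, hh₁, hh₂]
  have sJ : ∑ k, β.d (J k) = ∑ k, β.d (j₁ k) + ∑ k, β.d (j₂ k) := by
    rw [← Equiv.sum_comp σ, Fin.sum_univ_add, hj₁, hj₂]
  have pH : pairSum (β.d ∘ H) = pairSum (β.d ∘ h₁) + pairSum (β.d ∘ h₂) +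
      (∑ k, β.d (h₁ k)) * ∑ k, β.d (h₂ k) := by
    rw [← pairSum_perm ρ, eH, pairSum_append]; rfl
  have qH : posSum ((β.d ∘ H) ∘ ρ) = posSum (β.d ∘ h₁) + posSum (β.d ∘ h₂) +
      (p + 1 : ℕ) * ∑ k, β.d (h₂ k) := by
    rw [eH, posSum_append]; rfl
  have qJ : posSum ((β.d ∘ J) ∘ σ) = posSum (β.d ∘ j₁) + posSum (β.d ∘ j₂) +
      a * ∑ k, β.d (j₂ k) := by
    rw [eJ, posSum_append]; rfl
  have cs : β.d ∘ (Fin.snoc j₁ i : Fin (a + 1) → β.I) = Fin.snoc (β.d ∘ j₁) (β.d i) :=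
    Fin.comp_snoc _ _ _
  have cc : β.d ∘ (Fin.cons i h₂ : Fin (q + 1) → β.I) = Fin.cons (β.d i) (β.d ∘ h₂) :=
    Fin.comp_cons _ _ _
  have ts : ∑ k, β.d ((Fin.snoc j₁ i : Fin (a + 1) → β.I) k) = ∑ k, β.d (j₁ k) + β.d i := by
    rw [Fin.sum_univ_castSucc]; simp
  have tc : ∑ k, β.d ((Fin.cons i h₂ : Fin (q + 1) → β.I) k) = β.d i + ∑ k, β.d (h₂ k) := by
    rw [Fin.sum_univ_succ]; simp
  have kρ : ((koszulExp ρ fun k => -(β.d (H k) + n) : ℤ) : ZMod 2) = _ :=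
    (congrArg _ (by simp only [koszulExp, neg_mul_neg]; rfl)).trans (koszulExp_shift ρ (β.d ∘ H) n)
  have kσ := koszulExp_shift σ (β.d ∘ J) (-1)
  simp only [Function.comp_apply, ← sub_eq_add_neg] at kσ
  rw [quadSign, permSign_eq, permSign_eq]
  simp only [← sg_add]
  refine sg_eq_of_zmod K ?_
  simp only [trExp, sH, sJ, pH, cs, cc, posSum_snoc, posSum_cons, pairSum_cons, ts, tc, pairs_add,
    pairs_succ, mapDeg, Finset.sum_add_distrib, Finset.sum_sub_distrib, Finset.sum_neg_distrib,
    Finset.sum_const, Finset.card_univ, Fintype.card_fin, nsmul_eq_mul, mul_one, Function.comp_apply]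
  have e₁ := congrArg (Int.cast (R := ZMod 2)) d₁
  have e₂ := congrArg (Int.cast (R := ZMod 2)) d₂
  rw [qH] at kρ
  rw [qJ] at kσ
  push_cast at kρ kσ e₁ e₂ ⊢
  rw [kρ, kσ]
  have i1 := zmod_two_mul_self (n : ZMod 2)
  have i2 := zmod_two_mul_self (p : ZMod 2)
  have i3 := zmod_two_mul_self (q : ZMod 2)
  have i4 := zmod_two_mul_self (a : ZMod 2)
  have i5 := zmod_two_mul_self (b : ZMod 2)
  have i6 := zmod_two_mul_self (β.d i : ZMod 2)
  have i7 := zmod_two_mul_self (∑ k, (β.d (j₁ k) : ZMod 2))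
  have i8 := zmod_two_mul_self (∑ k, (β.d (j₂ k) : ZMod 2))
  generalize (∑ k, (β.d (j₁ k) : ZMod 2)) = A at *
  generalize (∑ k, (β.d (j₂ k) : ZMod 2)) = B at *
  generalize (∑ k, (β.d (h₁ k) : ZMod 2)) = C at *
  generalize (∑ k, (β.d (h₂ k) : ZMod 2)) = D at *
  generalize (β.d i : ZMod 2) = t at *
  generalize (n : ZMod 2) = n' at *
  generalize (a : ZMod 2) = a' at *
  generalize (b : ZMod 2) = b' at *
  generalize (p : ZMod 2) = p' at *
  generalize (q : ZMod 2) = q' at *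
  clear kρ kσ d₁ d₂ eH eJ sH sJ pH qH qJ cs cc ts tc hh₁ hh₂ hj₁ hj₂
  generalize (koszulExp ρ (β.d ∘ H) : ZMod 2) = z1 at *
  generalize (koszulExp σ (β.d ∘ J) : ZMod 2) = z2 at *
  generalize ((koszulExp ρ fun _ => 1 : ℤ) : ZMod 2) = z3 at *
  generalize ((koszulExp σ fun _ => 1 : ℤ) : ZMod 2) = z4 at *
  generalize (posSum (β.d ∘ H) : ZMod 2) = z5 at *
  generalize (posSum (β.d ∘ J) : ZMod 2) = z6 at *
  -- Modulo 2 the degree constraints determine the output degree sums C and D from the input ones;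
  -- after substitution the identity is formal.
  have e₁' : C = A + t + a' + 1 + p' * n' := by grind
  have e₂' : D = t + q' * n' + B + b' := by grind
  clear e₁ e₂
  subst e₁' e₂'
  grind

/-- A summand of a matrix entry of the transfer of the composition. -/
noncomputable def compTerm {p q N : ℕ} (P Q : Pol (symDual g).toGCA n)
    (H : Fin (p + 1 + q) → β.I) (J : Fin N → β.I) (ρ : Equiv.Perm (Fin (p + 1 + q)))
    (s : Fin N → Bool) (i : β.I) : K :=
  sg K (β.trExp n H J) * (sg K (1 + (β.d i - 1) * n) *
    (sg K ((selExp s fun k => β.d (J k) - 1) + (n + 2 + (β.d i - 1)) *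
        ∑ i, if s i then 0 else β.d (J i) - 1) *
      (sg K ((koszulExp ρ fun k => -(β.d (H k) + n)) +
        (n + 2 + (β.d i - 1) + ∑ i, if s i then β.d (J i) - 1 else 0) *
          ∑ k : Fin q, -(β.d (H (ρ (Fin.natAdd (p + 1) k))) + n)) *
      (polAug g n (β.prodE n (fun k => H (ρ (Fin.castAdd q k)))
          (selProd s (fun k => β.opF n (J k)) (β.opF n i P))) *
        polAug g n (β.prodE n (fun k => H (ρ (Fin.natAdd (p + 1) k)))
          (selProd (fun i => !s i) (fun k => β.opF n (J k)) (β.opE n i Q)))))))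

/-- Contraction keeps the weight p + 1 of P in the first factor, so the distributions of the E's are
already shuffles; the distributions s of the F's still have arbitrary size. -/
theorem ent_toMap_comp {p q N : ℕ} {P : Pol (symDual g).toGCA n}
    (Q : Pol (symDual g).toGCA n)
    (hP : P ∈ (polPres (symDual g).toGCA n).degPart (n + 2))
    (hw : P ∈ Pol.weight (symDual g).toGCA n (p + 1)) (H : Fin (p + 1 + q) → β.I)
    (J : Fin N → β.I) :
    β.ent (β.toMap n (p + 1 + q) N (β.comp n P Q)) H J =
      ∑ s, ∑ ρ ∈ shuffles (p + 1) q, ∑ i, β.compTerm n P Q H J ρ s i := by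
  rw [← intWeight_natCast] at hw
  have hd : ∀ i, β.opF n i P ∈ (polPres (symDual g).toGCA n).degPart (n + 2 + (β.d i - 1)) :=
    fun i => (β.opF_mem n i).1 _ _ hP
  have hw' : ∀ i, β.opF n i P ∈ intWeight (symDual g).toGCA n (p + 1 : ℕ) := fun i =>
    Pol.mem_congr (S := intWeight _ n) (by ring) (β.opF_mem_intWeight n i hw)
  rw [ent_toMap, comp, map_sum, Finset.mul_sum]
  have h : ∀ i, sg K (β.trExp n H J) *
      β.coef n H J (sg K (1 + (β.d i - 1) * n) • (β.opF n i P * β.opE n i Q)) =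
        ∑ s, ∑ ρ ∈ shuffles (p + 1) q, β.compTerm n P Q H J ρ s i := fun i => by
    rw [map_smul, smul_eq_mul, β.coef_mul_of_weight n H J (hd i) (hw' i), Finset.mul_sum,
      Finset.mul_sum]
    refine Finset.sum_congr rfl fun s _ => ?_
    rw [Finset.mul_sum, Finset.mul_sum]
    rfl
  rw [Finset.sum_congr rfl fun i _ => h i, Finset.sum_comm]
  exact Finset.sum_congr rfl fun s _ => Finset.sum_comm

/-- Once s is the first block of a shuffle, the two augmentations are coefficients of P and Q
sharing the index i, hence matrix entries up to the sign settled by `comp_sign`. -/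
theorem compTerm_firstBlock {p q a b : ℕ} {P Q : Pol (symDual g).toGCA n}
    (hP : P ∈ (polPres (symDual g).toGCA n).degPart (n + 2))
    (hQ : Q ∈ (polPres (symDual g).toGCA n).degPart (n + 2)) (H : Fin (p + 1 + q) → β.I)
    (J : Fin (a + b) → β.I) (ρ : Equiv.Perm (Fin (p + 1 + q))) {σ : Equiv.Perm (Fin (a + b))}
    (hσ : σ ∈ shuffles a b) (i : β.I) :
    β.compTerm n P Q H J ρ (firstBlock σ) i =
    quadSign K n (p + 1) (a + 1) (q + 1) b * (permSign K 1 σ * permSign K n ρ *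
      (sg K (koszulExp ρ (β.d ∘ H)) * (sg K (koszulExp σ (β.d ∘ J)) *
        (sg K (mapDeg n (q + 1) b * ∑ r, β.d (J (σ (Fin.castAdd b r)))) *
        (β.ent (β.toMap n (p + 1) (a + 1) P) (fun r => H (ρ (Fin.castAdd q r)))
            (Fin.snoc (fun r => J (σ (Fin.castAdd b r))) i) *
          β.ent (β.toMap n (q + 1) b Q) (Fin.cons i fun r => H (ρ (Fin.natAdd (p + 1) r)))
            fun r => J (σ (Fin.natAdd a r))))))) := by
  rw [compTerm, selExp_firstBlock hσ, sum_not_firstBlock, sum_firstBlock, selProd_firstBlock hσ,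
    selProd_not_firstBlock hσ, ent_toMap, ent_toMap]
  have e1 : polAug g n (β.prodE n (fun k => H (ρ (Fin.castAdd q k)))
      ((List.ofFn fun k => β.opF n (J (σ (Fin.castAdd b k)))).prod (β.opF n i P))) =
      β.coef n (fun k => H (ρ (Fin.castAdd q k)))
        (Fin.snoc (fun r => J (σ (Fin.castAdd b r))) i : Fin (a + 1) → β.I) P := by
    rw [coef_apply, ← prodF_opF]; rfl
  have e2 := congrArg (polAug g n) (β.prodE_prodF_opE n (fun k => H (ρ (Fin.natAdd (p + 1) k)))
    (fun k => J (σ (Fin.natAdd a k))) i Q)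
  rw [map_smul, smul_eq_mul, ← coef_apply n β (Fin.cons i _)] at e2
  rw [e1]
  refine (congrArg (fun z => sg K _ * (sg K _ * (sg K _ * (sg K _ * (_ * z))))) e2).trans ?_
  -- Zero coefficients make the term vanish on both sides; nonzero ones supply the degree
  -- constraints of `comp_sign`.
  by_cases h1 : β.coef n (fun k => H (ρ (Fin.castAdd q k)))
      (Fin.snoc (fun r => J (σ (Fin.castAdd b r))) i : Fin (a + 1) → β.I) P = 0
  · rw [h1]; ring
  by_cases h2 : β.coef n (Fin.cons i fun k => H (ρ (Fin.natAdd (p + 1) k)) : Fin (q + 1) → β.I)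
      (fun k => J (σ (Fin.natAdd a k))) Q = 0
  · rw [h2]; ring
  have d1 := β.degree_of_coef_ne_zero n hP h1
  have d2 := β.degree_of_coef_ne_zero n hQ h2
  rw [Fin.sum_univ_castSucc (n := a)] at d1
  rw [Fin.sum_univ_succ (n := q)] at d2
  simp only [Fin.snoc_castSucc, Fin.snoc_last, Fin.cons_zero, Fin.cons_succ] at d1 d2
  have key := β.comp_sign n (H := H) (J := J) ρ σ i rfl rfl rfl rfl d1 d2
  linear_combination (β.coef n (fun k => H (ρ (Fin.castAdd q k)))
      (Fin.snoc (fun r => J (σ (Fin.castAdd b r))) i : Fin (a + 1) → β.I) P *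
    β.coef n (Fin.cons i fun k => H (ρ (Fin.natAdd (p + 1) k)) : Fin (q + 1) → β.I)
      (fun k => J (σ (Fin.natAdd a k))) Q) * key

theorem sum_shuffles_compTerm {p q a b : ℕ} {P Q : Pol (symDual g).toGCA n}
    (hP : P ∈ (polPres (symDual g).toGCA n).degPart (n + 2))
    (hQ : Q ∈ (polPres (symDual g).toGCA n).degPart (n + 2)) (H : Fin (p + 1 + q) → β.I)
    (J : Fin (a + b) → β.I) :
    ∑ σ ∈ shuffles a b, ∑ ρ ∈ shuffles (p + 1) q, ∑ i, β.compTerm n P Q H J ρ (firstBlock σ) i =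
      quadSign K n (p + 1) (a + 1) (q + 1) b *
        β.ent (shuffleComp n (mapDeg n (q + 1) b) (β.toMap n (p + 1) (a + 1) P)
          (β.toMap n (q + 1) b Q)) H J := by
  rw [ent_shuffleComp, Finset.mul_sum]
  refine Finset.sum_congr rfl fun σ hσ => ?_
  rw [Finset.mul_sum]
  refine Finset.sum_congr rfl fun ρ _ => ?_
  rw [Finset.sum_congr rfl fun i _ => β.compTerm_firstBlock n hP hQ H J ρ hσ i]
  simp only [Finset.mul_sum]

/-- The transfer of the composition of polyvectors. -/
theorem toMap_comp {p q N : ℕ} {P Q : Pol (symDual g).toGCA n}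
    (hP : P ∈ (polPres (symDual g).toGCA n).degPart (n + 2))
    (hQ : Q ∈ (polPres (symDual g).toGCA n).degPart (n + 2))
    (hw : P ∈ Pol.weight (symDual g).toGCA n (p + 1)) :
    β.toMap n (p + 1 + q) N (β.comp n P Q) =
      ∑ ab ∈ (Finset.HasAntidiagonal.antidiagonal N).attach,
        quadSign K n (p + 1) (ab.1.1 + 1) (q + 1) ab.1.2 •
          castHom (Finset.HasAntidiagonal.mem_antidiagonal.1 ab.2) rfl
            (shuffleComp n (mapDeg n (q + 1) ab.1.2) (β.toMap n (p + 1) (ab.1.1 + 1) P)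
              (β.toMap n (q + 1) ab.1.2 Q)) := by
  refine β.ent_ext fun H J => ?_
  rw [β.ent_toMap_comp n Q hP hw, ent_sum, sum_bool_eq_sum_antidiagonal]
  refine Finset.sum_congr rfl fun ab _ => ?_
  obtain ⟨⟨a, b⟩, hab⟩ := ab
  have hab' : a + b = N := Finset.HasAntidiagonal.mem_antidiagonal.1 hab
  rw [ent_smul, ent_castHom]
  subst hab'
  -- Among the selections of the F's, those of size a are the first blocks of (a, b)-shuffles.
  exact (sum_shuffles fun s => ∑ ρ ∈ shuffles (p + 1) q, ∑ i, β.compTerm n P Q H J ρ s i).symm.trans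
    (β.sum_shuffles_compTerm n hP hQ H J)

end HomBasis

/-! ### The transfer of the differential -/

theorem sum_update_fin {l : ℕ} (c : Fin l → ℤ) (k : Fin l) (x : ℤ) :
    ∑ i, Function.update c k x i = ∑ i, c i + (x - c k) := by
  rw [Finset.sum_update_of_mem (Finset.mem_univ k), ← Finset.sum_erase_add _ c (Finset.mem_univ k),
    Finset.sdiff_singleton_eq_erase]
  ring

theorem posSum_update {l : ℕ} (c : Fin l → ℤ) (k : Fin l) (x : ℤ) :
    posSum (Function.update c k x) = posSum c + ((k : ℕ) : ℤ) * (x - c k) := by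
  have h : (fun i : Fin l => ((i : ℕ) : ℤ) * Function.update c k x i) =
      Function.update (fun i : Fin l => ((i : ℕ) : ℤ) * c i) k (((k : ℕ) : ℤ) * x) := by
    funext i
    by_cases hi : i = k
    · subst hi; simp
    · simp [hi]
  rw [posSum, h, sum_update_fin, posSum]
  ring

theorem pairSum_update {l : ℕ} (c : Fin l → ℤ) (k : Fin l) (x : ℤ) :
    pairSum (Function.update c k x) = pairSum c + (x - c k) * (∑ i, c i - c k) := by
  have h1 := two_mul_pairSum (Function.update c k x)
  have h2 := two_mul_pairSum c
  have h : (fun i : Fin l => Function.update c k x i * Function.update c k x i) =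
      Function.update (fun i : Fin l => c i * c i) k (x * x) := by
    funext i
    by_cases hi : i = k
    · subst hi; simp
    · simp [hi]
  rw [h, sum_update_fin, sum_update_fin] at h1
  linarith

theorem sum_gt_eq {l : ℕ} (c : Fin l → ℤ) (k : Fin l) :
    (∑ i, if k < i then c i else 0) = ∑ i, c i - c k - ∑ i, if i < k then c i else 0 := by
  have h : c k = ∑ i, if i = k then c i else 0 := by simp
  rw [h, ← Finset.sum_sub_distrib, ← Finset.sum_sub_distrib]
  refine Finset.sum_congr rfl fun i _ => ?_
  rcases lt_trichotomy i k with h | rfl | h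
  · simp [h, h.not_gt, h.ne]
  · simp
  · simp [h, h.not_gt, h.ne']

theorem sum_lt_const {l : ℕ} (k : Fin l) (x : ℤ) :
    (∑ i : Fin l, if i < k then x else 0) = ((k : ℕ) : ℤ) * x := by
  rw [← Finset.sum_filter, Finset.sum_const, nsmul_eq_mul]
  congr 2
  rw [show (Finset.univ.filter fun i => i < k) = Finset.Iio k by ext; simp, Fin.card_Iio]

theorem prod_ofFn_update_sum {K : Type u} [Field K] {A : Type*} [Ring A] [Algebra K A] {N : ℕ}
    {ι : Type*} [Fintype ι] (a : Fin N → A) (k : Fin N) (c : ι → K) (b : ι → A) :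
    (List.ofFn (Function.update a k (∑ i, c i • b i))).prod =
      ∑ i, c i • (List.ofFn (Function.update a k (b i))).prod := by
  have h := (MultilinearMap.mkPiAlgebraFin K N A).map_update_sum Finset.univ k (fun i => c i • b i) a
  simp only [MultilinearMap.map_update_smul, MultilinearMap.mkPiAlgebraFin_apply] at h
  exact h

section Differential

variable {K : Type u} [Field K] {g : CochainComplex (ModuleCat.{v} K) ℤ} (n : ℤ)

namespace HomBasis

variable (β : HomBasis g)

/-- The differential sends coordinates to combinations of coordinates, so by the Leibniz rule its
image lies in the augmentation ideal. -/
theorem polAug_polD (β : HomBasis g) (P : Pol (symDual g).toGCA n) : polAug g n (Pol.polD (symDual g) n P) = 0 := by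
  have key : ∀ (c : ℤ) (z : Pol (symDual g).toGCA n), z ∈ (polPres (symDual g).toGCA n).degPart c →
      polAug g n z = 0 → polAug g n (Pol.polD (symDual g) n z) = 0 → ∀ a,
      polAug g n (Pol.polD (symDual g) n a) = 0 → polAug g n (Pol.polD (symDual g) n (z * a)) = 0 := by
    intro c z hz h1 h2 a ha
    rw [(polD_mem_der (g := g) n).2 c z hz a, map_add, map_mul, h2, map_smul, map_mul, h1]
    simp
  refine β.pol_ind n (p := fun P => polAug g n (Pol.polD (symDual g) n P) = 0) ?_ ?_ ?_ ?_ ?_ P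
  · rw [polD_one, map_zero]
  · intro i a ha
    refine key _ _ (GradedPres.gen_mem _) (polAug_fn g n _) ?_ a ha
    refine (congrArg (polAug g n) (β.polD_e n i)).trans ?_
    rw [map_sum]
    exact Finset.sum_eq_zero fun j _ => by rw [map_smul, e, polAug_fn, smul_zero]
  · intro i a ha
    refine key _ _ (GradedPres.gen_mem _) (polAug_vf g n _) ?_ a ha
    refine (congrArg (polAug g n) (β.polD_f n i)).trans ?_
    rw [map_sum]
    exact Finset.sum_eq_zero fun j _ => by rw [map_smul, f, polAug_vf, smul_zero]
  · intro a b ha hb; rw [map_add, map_add, ha, hb, add_zero]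
  · intro c a ha; rw [map_smul, map_smul, ha, smul_zero]

theorem prodF_polD {l : ℕ} (J : Fin l → β.I) :
    β.prodF n J * Pol.polD (symDual g) n =
      sg K (∑ k, (β.d (J k) - 1)) • (Pol.polD (symDual g) n * β.prodF n J) +
        ∑ k, ∑ i, (sg K (∑ i, if k < i then β.d (J i) - 1 else 0) *
          (sg K (β.d (J k) - 1) * β.dMat i (J k))) • β.prodF n (Function.update J k i) := by
  have h := prod_mul_eq (K := K) (fun k => β.opF n (J k))
    (fun k => ∑ i, (sg K (β.d (J k) - 1) * β.dMat i (J k)) • β.opF n i)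
    (fun k => β.d (J k) - 1) (Pol.polD (symDual g) n) (fun k => by
      rw [opF_polD, Finset.smul_sum]; simp only [smul_smul])
  refine h.trans ?_
  congr 1
  refine Finset.sum_congr rfl fun k _ => ?_
  refine (congrArg _ (prod_ofFn_update_sum (K := K) _ _ _ _)).trans ?_
  rw [Finset.smul_sum]
  refine Finset.sum_congr rfl fun i _ => ?_
  rw [smul_smul, prodF]
  congr 3
  exact (Function.comp_update (β.opF n) J k i).symm

theorem prodE_polD {m : ℕ} (H : Fin m → β.I) :
    β.prodE n H * Pol.polD (symDual g) n =
      sg K (∑ k, -(β.d (H k) + n)) • (Pol.polD (symDual g) n * β.prodE n H) +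
        ∑ k, ∑ i, (sg K (∑ i, if k < i then -(β.d (H i) + n) else 0) *
          (sg K n * β.dMat (H k) i)) • β.prodE n (Function.update H k i) := by
  have h := prod_mul_eq (K := K) (fun k => β.opE n (H k))
    (fun k => ∑ i, (sg K n * β.dMat (H k) i) • β.opE n i)
    (fun k => -(β.d (H k) + n)) (Pol.polD (symDual g) n) (fun k => by
      rw [opE_polD, Finset.smul_sum]; simp only [smul_smul])
  refine h.trans ?_
  congr 1
  refine Finset.sum_congr rfl fun k _ => ?_
  refine (congrArg _ (prod_ofFn_update_sum (K := K) _ _ _ _)).trans ?_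
  rw [Finset.smul_sum]
  refine Finset.sum_congr rfl fun i _ => ?_
  rw [smul_smul, prodE]
  congr 3
  exact (Function.comp_update (β.opE n) H k i).symm

/-- The differential is moved to the left end, where the augmentation kills it; only the commutators
remain, each replacing one index through the matrix of d. -/
theorem coef_polD {m l : ℕ} (H : Fin m → β.I) (J : Fin l → β.I) (P : Pol (symDual g).toGCA n) :
    β.coef n H J (Pol.polD (symDual g) n P) =
      sg K (∑ k, (β.d (J k) - 1)) *
        (∑ k, ∑ i, (sg K (∑ i, if k < i then -(β.d (H i) + n) else 0) *
          (sg K n * β.dMat (H k) i)) * β.coef n (Function.update H k i) J P) +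
        ∑ k, ∑ i, (sg K (∑ i, if k < i then β.d (J i) - 1 else 0) *
          (sg K (β.d (J k) - 1) * β.dMat i (J k))) * β.coef n H (Function.update J k i) P := by
  have h1 := LinearMap.congr_fun (β.prodF_polD n J) P
  have h2 := LinearMap.congr_fun (β.prodE_polD n H) (β.prodF n J P)
  simp only [LinearMap.add_apply, LinearMap.smul_apply, Module.End.mul_apply, LinearMap.sum_apply]
    at h1 h2
  rw [coef_apply, h1]
  simp only [map_add, map_smul, map_sum, h2, polAug_polD n β, smul_eq_mul, mul_zero, zero_add]
  rfl

/-- Replacing one output index changes its degree by one, so `trExp` changes by an explicit amount;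
the degree of the coefficient accounts for the rest. -/
theorem polD_sign_left {m l : ℕ} {H : Fin m → β.I} {J : Fin l → β.I} (k : Fin m) {i : β.I}
    (hd : β.d (H k) = β.d i + 1)
    (hc : ∑ r, β.d (Function.update H k i r) + m * n = ∑ r, β.d (J r) - l + (n + 2)) :
    sg K (n + 1) * (sg K (β.trExp n H J) * (sg K (∑ k, (β.d (J k) - 1)) *
      (sg K (∑ i, if k < i then -(β.d (H i) + n) else 0) * sg K n))) =
    sg K (((m : ℤ) - 1) * n + l - 1) * (sg K (∑ j, if j < k then β.d (H j) else 0) *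
      sg K (β.trExp n (Function.update H k i) J)) := by
  have e : β.d ∘ Function.update H k i = Function.update (β.d ∘ H) k (β.d i) :=
    Function.comp_update _ _ _ _
  have s : ∑ r, β.d (Function.update H k i r) = ∑ r, β.d (H r) + (β.d i - β.d (H k)) :=
    (congrArg (fun z : Fin m → ℤ => ∑ r, z r) e).trans (sum_update_fin (β.d ∘ H) k (β.d i))
  have g1 := sum_gt_eq (fun i => -(β.d (H i) + n)) k
  have g2 : (∑ i, if i < k then -(β.d (H i) + n) else 0) =
      -(∑ i, if i < k then β.d (H i) else 0) - ((k : ℕ) : ℤ) * n := by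
    rw [← sum_lt_const, ← Finset.sum_neg_distrib, ← Finset.sum_sub_distrib]
    refine Finset.sum_congr rfl fun i _ => ?_
    split_ifs <;> ring
  rw [s] at hc
  simp only [← sg_add]
  refine sg_eq_of_zmod K ?_
  rw [g1, g2, trExp, trExp, e, s, posSum_update, pairSum_update]
  simp only [Finset.sum_add_distrib, Finset.sum_sub_distrib, Finset.sum_neg_distrib,
    Finset.sum_const, Finset.card_univ, Fintype.card_fin, nsmul_eq_mul, mul_one, Function.comp_apply]
  have e₁ := congrArg (Int.cast (R := ZMod 2)) hc
  have e₂ := congrArg (Int.cast (R := ZMod 2)) hd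
  push_cast at e₁ e₂ ⊢
  have i1 := zmod_two_mul_self (n : ZMod 2)
  have i2 := zmod_two_mul_self (m : ZMod 2)
  have i3 := zmod_two_mul_self (l : ZMod 2)
  have i4 := zmod_two_mul_self (β.d i : ZMod 2)
  have i5 := zmod_two_mul_self (∑ k, (β.d (H k) : ZMod 2))
  have i6 := zmod_two_mul_self (∑ k, (β.d (J k) : ZMod 2))
  have i7 := zmod_two_mul_self ((k : ℕ) : ZMod 2)
  generalize (∑ k, (β.d (H k) : ZMod 2)) = A at *
  generalize (∑ k, (β.d (J k) : ZMod 2)) = B at *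
  generalize (β.d i : ZMod 2) = t at *
  generalize (β.d (H k) : ZMod 2) = t' at *
  generalize (n : ZMod 2) = n' at *
  generalize (m : ZMod 2) = m' at *
  generalize (l : ZMod 2) = l' at *
  generalize ((k : ℕ) : ZMod 2) = k' at *
  generalize (posSum (β.d ∘ H) : ZMod 2) = z1 at *
  generalize (posSum (β.d ∘ J) : ZMod 2) = z2 at *
  generalize (pairSum (β.d ∘ H) : ZMod 2) = z3 at *
  generalize (pairs l : ZMod 2) = z4 at *
  generalize (pairs m : ZMod 2) = z5 at *
  generalize (∑ i, ((if i < k then β.d (H i) else 0 : ℤ) : ZMod 2)) = z6 at *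
  clear g1 g2 hd hc e s
  subst e₂
  -- The degree constraint modulo 2 expresses the input degree sum through the output one.
  have e₁' : B = A + 1 + m' * n' + l' + n' := by grind
  clear e₁
  subst e₁'
  grind

theorem polD_sign_right {m l : ℕ} {H : Fin m → β.I} {J : Fin l → β.I} (k : Fin l) {i : β.I}
    (hd : β.d i = β.d (J k) + 1)
    (hc : ∑ r, β.d (H r) + m * n = ∑ r, β.d (Function.update J k i r) - l + (n + 2)) :
    sg K (n + 1) * (sg K (β.trExp n H J) * (sg K (∑ i, if k < i then β.d (J i) - 1 else 0) *
      sg K (β.d (J k) - 1))) =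
    sg K (((m : ℤ) - 1) * n + l - 1) * -(sg K (mapDeg n m l) *
      (sg K (∑ j, if j < k then β.d (J j) else 0) * sg K (β.trExp n H (Function.update J k i)))) := by
  have e : β.d ∘ Function.update J k i = Function.update (β.d ∘ J) k (β.d i) :=
    Function.comp_update _ _ _ _
  have s : ∑ r, β.d (Function.update J k i r) = ∑ r, β.d (J r) + (β.d i - β.d (J k)) :=
    (congrArg (fun z : Fin l → ℤ => ∑ r, z r) e).trans (sum_update_fin (β.d ∘ J) k (β.d i))
  have g1 := sum_gt_eq (fun i => β.d (J i) - 1) k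
  have g2 : (∑ i, if i < k then β.d (J i) - 1 else 0) =
      (∑ i, if i < k then β.d (J i) else 0) - ((k : ℕ) : ℤ) * 1 := by
    rw [← sum_lt_const, ← Finset.sum_sub_distrib]
    refine Finset.sum_congr rfl fun i _ => ?_
    split_ifs <;> ring
  rw [s] at hc
  simp only [← sg_add, neg_sg]
  refine sg_eq_of_zmod K ?_
  rw [g1, g2, trExp, trExp, e, s, posSum_update, mapDeg]
  simp only [Finset.sum_sub_distrib,
    Finset.sum_const, Finset.card_univ, Fintype.card_fin, nsmul_eq_mul, mul_one, Function.comp_apply]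
  have e₁ := congrArg (Int.cast (R := ZMod 2)) hc
  have e₂ := congrArg (Int.cast (R := ZMod 2)) hd
  push_cast at e₁ e₂ ⊢
  have i1 := zmod_two_mul_self (n : ZMod 2)
  have i2 := zmod_two_mul_self (m : ZMod 2)
  have i3 := zmod_two_mul_self (l : ZMod 2)
  have i7 := zmod_two_mul_self ((k : ℕ) : ZMod 2)
  generalize (∑ k, (β.d (H k) : ZMod 2)) = A at *
  generalize (∑ k, (β.d (J k) : ZMod 2)) = B at *
  generalize (β.d i : ZMod 2) = t at *
  generalize (β.d (J k) : ZMod 2) = t' at *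
  generalize (n : ZMod 2) = n' at *
  generalize (m : ZMod 2) = m' at *
  generalize (l : ZMod 2) = l' at *
  generalize ((k : ℕ) : ZMod 2) = k' at *
  generalize (posSum (β.d ∘ H) : ZMod 2) = z1 at *
  generalize (posSum (β.d ∘ J) : ZMod 2) = z2 at *
  generalize (pairSum (β.d ∘ H) : ZMod 2) = z3 at *
  generalize (pairs l : ZMod 2) = z4 at *
  generalize (pairs m : ZMod 2) = z5 at *
  generalize (∑ i, ((if i < k then β.d (J i) else 0 : ℤ) : ZMod 2)) = z6 at *
  clear g1 g2 hd hc e s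
  subst e₂
  have e₁' : B = A + 1 + m' * n' + l' + n' := by grind
  clear e₁
  subst e₁'
  grind

/-- Commutators with the E's give d ∘ L and those with the F's give L ∘ d, term by term, as both are
sums over the slot in which d acts. -/
theorem toMap_polD (m l : ℕ) {P : Pol (symDual g).toGCA n}
    (hP : P ∈ (polPres (symDual g).toGCA n).degPart (n + 2)) :
    β.toMap n m l (sg K (n + 1) • Pol.polD (symDual g) n P) =
      sg K (((m : ℤ) - 1) * n + l - 1) • homD (mapDeg n m l) (β.toMap n m l P) := by
  refine β.ent_ext fun H J => ?_
  rw [ent_toMap, map_smul, coef_polD, ent_smul, homD, ent_sub, ent_smul, ent_tensorD_comp,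
    ent_comp_tensorD, smul_eq_mul, mul_add, mul_add, mul_sub,
    sub_eq_add_neg (sg K _ * _), ← mul_neg]
  congr 1
  · simp only [Finset.mul_sum]
    refine Finset.sum_congr rfl fun k _ => Finset.sum_congr rfl fun i _ => ?_
    rw [ent_toMap]
    by_cases hd : β.dMat (H k) i = 0
    · rw [hd]; ring
    by_cases hc : β.coef n (Function.update H k i) J P = 0
    · rw [hc]; ring
    linear_combination (β.dMat (H k) i * β.coef n (Function.update H k i) J P) *
      β.polD_sign_left n k (β.dMat_ne_zero hd) (β.degree_of_coef_ne_zero n hP hc)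
  · simp only [Finset.mul_sum, ← Finset.sum_neg_distrib]
    refine Finset.sum_congr rfl fun k _ => Finset.sum_congr rfl fun i _ => ?_
    rw [ent_toMap]
    by_cases hd : β.dMat i (J k) = 0
    · rw [hd]; ring
    by_cases hc : β.coef n H (Function.update J k i) P = 0
    · rw [hc]; ring
    linear_combination (β.dMat i (J k) * β.coef n H (Function.update J k i) P) *
      β.polD_sign_right n k (β.dMat_ne_zero hd) (β.degree_of_coef_ne_zero n hP hc)

end HomBasis
end Differential

/-! ### Homogeneous polyvectors -/

section VectorFields

variable {K : Type u} [Field K] {A : GCA.{u, w} K} {n : ℤ}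

theorem prod_gen_of_weight_zero (l : List (PolGen A)) (hl : (l.map PolGen.wt).sum = 0) :
    ∃ a : A.deg (l.map (PolGen.dg n)).sum, (l.map (polPres A n).gen).prod = Pol.fn n a := by
  induction l with
  | nil => exact ⟨⟨1, SetLike.GradedOne.one_mem⟩, Pol.fn_one.symm⟩
  | cons x l ih =>
    cases x with
    | fn j a =>
      obtain ⟨b, hb⟩ := ih (by simpa [PolGen.wt] using hl)
      refine ⟨⟨a.1 * b.1, A.mul_mem a.2 b.2⟩, ?_⟩
      rw [List.map_cons, List.prod_cons, hb]
      exact Pol.fn_mul a b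
    | vf k D => simp [PolGen.wt] at hl

/-- A word of weight one has a single vector field; the functions around it can be absorbed by the
action of the algebra on derivations. -/
theorem exists_vf_of_weight_one (l : List (PolGen A)) (hl : (l.map PolGen.wt).sum = 1) {k : ℤ}
    (hd : (l.map (PolGen.dg n)).sum = k + (n + 1)) :
    ∃ D : A.Der k, (l.map (polPres A n).gen).prod = Pol.vf n D := by
  induction l generalizing k with
  | nil => simp at hl
  | cons x l ih =>
    have mul_vf : ∀ {j k' : ℤ} (a : A.deg j) (D : A.Der k') (c : K), j + k' = k →
        ∃ D' : A.Der k, c • (Pol.fn n a * Pol.vf n D) = Pol.vf n D' := by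
      rintro j k' a D c rfl
      refine ⟨(c * sg K (j * (n + 1))) • GCA.act a D, ?_⟩
      rw [Pol.vf_smul, Pol.vf_act, smul_smul, mul_assoc, sg_mul_self, mul_one]
    rw [List.map_cons, List.sum_cons] at hd
    rw [List.map_cons, List.prod_cons]
    cases x with
    | fn j a =>
      obtain ⟨D, hD⟩ := ih (by simpa [PolGen.wt] using hl) (k := k - j)
        (by simp only [PolGen.dg] at hd; omega)
      obtain ⟨D', hD'⟩ := mul_vf a D 1 (by ring)
      refine ⟨D', ?_⟩
      rw [hD, ← hD', one_smul]
      rfl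
    | vf j D =>
      obtain ⟨a, ha⟩ := prod_gen_of_weight_zero (n := n) l (by simpa [PolGen.wt] using hl)
      obtain ⟨D', hD'⟩ := mul_vf a D _ (by simp only [PolGen.dg] at hd; omega)
      refine ⟨D', ?_⟩
      rw [ha, ← hD']
      exact GradedPres.mul_comm' (Pol.vf_mem D) (Pol.fn_mem a)

/-- This is what produces the derivation α from the maps with one output. -/
theorem exists_vf_of_mem_piece {k i : ℤ} (hi : i = k + (n + 1)) {P : Pol A n}
    (hP : P ∈ Pol.piece A n 1 i) : ∃ D : A.Der k, P = Pol.vf n D := by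
  induction hP using Submodule.span_induction with
  | mem x h =>
    obtain ⟨l, h1, h2, rfl⟩ := h
    exact exists_vf_of_weight_one l h1 (h2.trans hi)
  | zero => exact ⟨0, Pol.vf_zero.symm⟩
  | add x y _ _ hx hy =>
    obtain ⟨D, rfl⟩ := hx
    obtain ⟨D', rfl⟩ := hy
    exact ⟨D + D', (Pol.vf_add D D').symm⟩
  | smul c x _ hx =>
    obtain ⟨D, rfl⟩ := hx
    exact ⟨c • D, (Pol.vf_smul c D).symm⟩

theorem vf_mem_piece {k i : ℤ} (hi : i = k + (n + 1)) (D : A.Der k) :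
    Pol.vf n D ∈ Pol.piece A n 1 i :=
  Submodule.subset_span ⟨[.vf k D], by simp [PolGen.wt], by simp [PolGen.dg, hi], by
    rw [List.map_singleton, List.prod_singleton]; rfl⟩

end VectorFields

/-! ### Polyvectors with prescribed maps, and the quadratic identities. -/

section Equation

variable {K : Type u} [Field K] {g : CochainComplex (ModuleCat.{v} K) ℤ} (n : ℤ)

namespace HomBasis

variable (β : HomBasis g)

theorem mono_mem_piece {m l : ℕ} (H : Fin m → β.I) (J : Fin l → β.I) {i : ℤ}
    (h : ∑ k, β.d (H k) + m * n = ∑ k, β.d (J k) - l + i) :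
    β.mono n H J ∈ Pol.piece (symDual g).toGCA n m i := by
  refine Submodule.subset_span
    ⟨List.ofFn (fun k => PolGen.vf (β.d (H k) - 1) (constDer g (β.x (H k)))) ++
      List.ofFn (fun j => PolGen.fn (1 - β.d (J j)) (dualGen g (β.θ (J j)))), ?_, ?_, ?_⟩
  · simp [List.map_ofFn, Function.comp_def, PolGen.wt]
  · simp only [List.map_append, List.map_ofFn, Function.comp_def, PolGen.dg, List.sum_append,
      List.sum_ofFn, Finset.sum_add_distrib, Finset.sum_sub_distrib, Finset.sum_const,
      Finset.card_univ, Fintype.card_fin, nsmul_eq_mul]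
    linear_combination h
  · rw [List.map_append, List.prod_append, List.map_ofFn, List.map_ofFn]
    rfl

/-- A nonzero entry of L satisfies the degree relation under which the corresponding monomial has
degree n + 2. -/
theorem fromMap_mem_piece {m l : ℕ} {L : TP g l →ₗ[K] TP g m} (hL : HasDegree L (mapDeg n m l)) :
    β.fromMap n m l L ∈ Pol.piece (symDual g).toGCA n m (n + 2) := by
  rw [β.hasDegree_iff] at hL
  refine Submodule.sum_mem _ fun H _ => Submodule.sum_mem _ fun J _ => ?_
  by_cases h : β.ent L H J = 0
  · rw [h, mul_zero, zero_smul]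
    exact Submodule.zero_mem _
  · refine Submodule.smul_mem _ _ (Submodule.smul_mem _ _ (β.mono_mem_piece n H J ?_))
    rw [hL H J h, mapDeg]
    ring

/-- By boundedness the preimages for the individual l can be summed, and distinct l do not
interfere. -/
theorem exists_toMap_eq [CharZero K] {m : ℕ} (F : ∀ l, TP g l →ₗ[K] TP g m)
    (hF : ∀ l, F l ∈ homPM g n l m) (hd : ∀ l, HasDegree (F l) (mapDeg n m l))
    (hb : ∃ N, ∀ l, N < l → F l = 0) :
    ∃ P ∈ Pol.piece (symDual g).toGCA n m (n + 2), ∀ l, β.toMap n m l P = F l := by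
  obtain ⟨N, hN⟩ := hb
  refine ⟨∑ l ∈ Finset.range (N + 1), β.fromMap n m l (F l),
    Submodule.sum_mem _ fun l _ => β.fromMap_mem_piece n (hd l), fun l => ?_⟩
  rw [map_sum]
  by_cases hl : l ∈ Finset.range (N + 1)
  · rw [Finset.sum_eq_single_of_mem l hl fun l' _ h => toMap_fromMap_of_ne n β h.symm _,
      toMap_fromMap n β (hF l)]
  · rw [hN l (by simpa using hl)]
    refine Finset.sum_eq_zero fun l' h => toMap_fromMap_of_ne n β ?_ _
    rintro rfl
    exact hl h

/-- The transfer takes values in a direct sum, so its components have finite support. -/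
theorem toMap_bounded [CharZero K] {m : ℕ} {P : Pol (symDual g).toGCA n}
    (hP : P ∈ Pol.weight (symDual g).toGCA n m) :
    ∃ N : ℕ, ∀ l, N < l → β.toMap n m l P = 0 := by
  classical
  refine ⟨(DFinsupp.support (β.transfer n m ⟨P, hP⟩)).sup id, fun l hl => ?_⟩
  by_contra h
  have hs : l ∈ DFinsupp.support (β.transfer n m ⟨P, hP⟩) := by
    rw [DFinsupp.mem_support_iff]
    intro h0
    apply h
    rw [← β.transfer_apply n ⟨P, hP⟩ l, h0]
    rfl
  exact absurd (Finset.le_sup (f := id) hs) (not_le.2 hl)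

/-! ### The Maurer–Cartan equation -/

/-- The component of weight `m` of the Maurer–Cartan equation for a formal sum of polyvectors. -/
noncomputable def mcSum (p : ℕ → Pol (symDual g).toGCA n) (m : ℕ) : Pol (symDual g).toGCA n :=
  sg K (n + 1) • Pol.polD (symDual g) n (p m) +
    ∑ kl ∈ Finset.HasAntidiagonal.antidiagonal (m + 1), β.comp n (p kl.1) (p kl.2)

theorem mcSum_mem_weight {p : ℕ → Pol (symDual g).toGCA n}
    (hp : ∀ m, p m ∈ Pol.weight (symDual g).toGCA n m) (m : ℕ) :
    β.mcSum n p m ∈ Pol.weight (symDual g).toGCA n m := by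
  simp only [← intWeight_natCast] at hp ⊢
  refine Submodule.add_mem _ (Submodule.smul_mem _ _ (polD_mem_intWeight n (hp m)))
    (Submodule.sum_mem _ fun kl h => ?_)
  refine Pol.mem_congr (S := intWeight _ n) ?_ (β.comp_mem_intWeight n (hp kl.1) (hp kl.2))
  have := Finset.HasAntidiagonal.mem_antidiagonal.1 h
  omega

theorem toMap_comp_cast {p q m N : ℕ} (hm : p + 1 + q = m) {P Q : Pol (symDual g).toGCA n}
    (hP : P ∈ Pol.piece (symDual g).toGCA n (p + 1) (n + 2))
    (hQ : Q ∈ (polPres (symDual g).toGCA n).degPart (n + 2)) :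
    β.toMap n m N (β.comp n P Q) =
      ∑ ab ∈ (Finset.HasAntidiagonal.antidiagonal N).attach,
        quadSign K n (p + 1) (ab.1.1 + 1) (q + 1) ab.1.2 •
          castHom (Finset.HasAntidiagonal.mem_antidiagonal.1 ab.2) hm
            (shuffleComp n (mapDeg n (q + 1) ab.1.2) (β.toMap n (p + 1) (ab.1.1 + 1) P)
              (β.toMap n (q + 1) ab.1.2 Q)) := by
  subst hm
  exact β.toMap_comp n (Pol.piece_le_degPart _ _ _ _ hP) hQ (Pol.piece_le_weight _ _ _ _ hP)

theorem comp_zero_left (Q : Pol (symDual g).toGCA n) : β.comp n 0 Q = 0 := by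
  simp [comp]

theorem comp_zero_right (P : Pol (symDual g).toGCA n) : β.comp n P 0 = 0 := by
  simp [comp]

theorem comp_add_left (P P' Q : Pol (symDual g).toGCA n) :
    β.comp n (P + P') Q = β.comp n P Q + β.comp n P' Q := by
  simp only [comp, map_add, add_mul, smul_add, Finset.sum_add_distrib]

theorem comp_add_right (P Q Q' : Pol (symDual g).toGCA n) :
    β.comp n P (Q + Q') = β.comp n P Q + β.comp n P Q' := by
  simp only [comp, map_add, mul_add, smul_add, Finset.sum_add_distrib]

/-- The right side is the left side of the quadratic identity for the maps of p; this is where the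
two Maurer–Cartan conditions meet. -/
theorem toMap_mcSum {p : ℕ → Pol (symDual g).toGCA n} (h0 : p 0 = 0)
    (hp : ∀ m, p m ∈ Pol.piece (symDual g).toGCA n m (n + 2)) (r l : ℕ) :
    β.toMap n (r + 1) l (β.mcSum n p (r + 1)) =
      sg K ((((r + 1 : ℕ) : ℤ) - 1) * n + l - 1) •
        homD (mapDeg n (r + 1) l) (β.toMap n (r + 1) l (p (r + 1))) +
      (∑ pq ∈ (Finset.HasAntidiagonal.antidiagonal r).attach,
        ∑ ab ∈ (Finset.HasAntidiagonal.antidiagonal l).attach,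
          quadSign K n (pq.1.1 + 1) (ab.1.1 + 1) (pq.1.2 + 1) ab.1.2 •
            castHom (Finset.HasAntidiagonal.mem_antidiagonal.1 ab.2)
              (show pq.1.1 + 1 + pq.1.2 = r + 1 by
                have := Finset.HasAntidiagonal.mem_antidiagonal.1 pq.2
                omega)
              (shuffleComp n (mapDeg n (pq.1.2 + 1) ab.1.2)
                (β.toMap n (pq.1.1 + 1) (ab.1.1 + 1) (p (pq.1.1 + 1)))
                (β.toMap n (pq.1.2 + 1) ab.1.2 (p (pq.1.2 + 1))))) := by
  rw [mcSum, map_add, toMap_polD n β _ _ (Pol.piece_le_degPart _ _ _ _ (hp (r + 1)))]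
  congr 1
  -- Since p 0 = 0, both ends of the antidiagonal of r + 2 drop out, and the rest is the
  -- antidiagonal of r with both weights raised by one.
  rw [Finset.Nat.sum_antidiagonal_succ, Finset.Nat.sum_antidiagonal_succ', h0, comp_zero_left,
    comp_zero_right, zero_add, zero_add, map_sum, ← Finset.sum_attach]
  refine Finset.sum_congr rfl fun pq _ => ?_
  exact β.toMap_comp_cast n _ (hp _) (Pol.piece_le_degPart _ _ _ _ (hp _))

theorem mcSum_zero {p : ℕ → Pol (symDual g).toGCA n} (h0 : p 0 = 0) : β.mcSum n p 0 = 0 := by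
  rw [mcSum, Finset.Nat.sum_antidiagonal_succ, h0, map_zero, smul_zero, comp_zero_left,
    Finset.Nat.antidiagonal_zero, Finset.sum_singleton, h0, comp_zero_right, add_zero, add_zero]

end HomBasis

end Equation

/-! ### Shifted Poisson structures on the deformed algebra -/

theorem ShiftedPoisson.ext_val {K : Type u} [Field K] {A : CDGA.{u, w} K} {n : ℤ} {π π' : ShiftedPoisson A n}
    (h : ∀ m, (π.π m).1 = (π'.π m).1) : π = π' := by
  obtain ⟨f, _, _, _⟩ := π
  obtain ⟨f', _, _, _⟩ := π'
  obtain rfl : f = f' := funext fun m => Subtype.ext (h m)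
  rfl

section Deform

variable {K : Type u} [Field K] [CharZero K]

/-- The differential of the polyvectors on the deformed algebra. -/
noncomputable def deformD (A : CDGA.{u, w} K) (α : A.MaurerCartan) (n : ℤ) :
    Pol A.toGCA n →ₗ[K] Pol A.toGCA n := Pol.polD (A.deform α) n

/-- The polyvectors of the deformed algebra have the same underlying algebra, and the bracket with d
+ α is additive in the vector field. -/
theorem deformD_apply (A : CDGA.{u, w} K) (α : A.MaurerCartan) (n : ℤ) (P : Pol A.toGCA n) :
    deformD A α n P = Pol.polD A n P + sg K (n + 1) • Pol.ad n (.vf 1 α.α) P := by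
  have h : deformD A α n = sg K (n + 1) • Pol.ad n (.vf 1 (A.d + α.α)) := rfl
  rw [h, Pol.polD, LinearMap.smul_apply, LinearMap.smul_apply, ← smul_add]
  congr 1
  refine Pol.ad_add (A := A.toGCA) (g := .vf 1 (A.d + α.α)) (g₁ := .vf 1 A.d) (g₂ := .vf 1 α.α) rfl rfl (fun x => ?_) P
  cases x with
  | fn j a =>
    simp only [Pol.genBracket]
    rw [← smul_add, ← Pol.fn_add]
    rfl
  | vf k D =>
    simp only [Pol.genBracket]
    rw [← Pol.vf_add]
    congr 1
    refine Subtype.ext (LinearMap.ext fun a => ?_)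
    simp only [GCA.bracket, Submodule.coe_add, LinearMap.sub_apply, LinearMap.comp_apply,
      LinearMap.add_apply, LinearMap.smul_apply, map_add, smul_add]
    abel

end Deform

/-! ### The Maurer–Cartan equation of the combined datum and the bijection. -/

section Correspondence

variable {K : Type u} [Field K] {g : CochainComplex (ModuleCat.{v} K) ℤ} {n : ℤ}

namespace HomBasis

variable (β : HomBasis g)

/-- Both arguments have shifted degree 1, and on odd elements the bracket is symmetric. -/
theorem schouten_vf (α : (symDual g).Der 1) (P : (polPres (symDual g).toGCA n).degPart (n + 2)) :
    Pol.schouten P (Pol.vf n α) = Pol.ad n (.vf 1 α) P.1 := by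
  refine (Pol.schouten_gen P (.vf 1 α)).trans ?_
  have h : sg K ((n + 2 - (n + 1)) * (PolGen.dg n (PolGen.vf 1 α) - (n + 1))) = -1 :=
    sg_odd K (by simp only [PolGen.dg]; rw [show (n + 2 - (n + 1)) * (1 + (n + 1) - (n + 1)) = 1 by ring]; decide)
  rw [h, neg_one_smul, neg_neg]

theorem ad_vf_eq_comp_add {α : (symDual g).Der 1} {P : Pol (symDual g).toGCA n}
    (hP : P ∈ (polPres (symDual g).toGCA n).degPart (n + 2)) :
    Pol.ad n (.vf 1 α) P = β.comp n P (Pol.vf n α) + β.comp n (Pol.vf n α) P := by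
  have hα : Pol.vf n α ∈ (polPres (symDual g).toGCA n).degPart (n + 2) :=
    Pol.mem_congr (S := (polPres (symDual g).toGCA n).degPart) (by ring) (Pol.vf_mem α)
  rw [← schouten_vf α ⟨P, hP⟩, β.schouten_eq_add n ⟨P, hP⟩ ⟨_, hα⟩]

variable [CharZero K]

/-- The bracket of α with itself is twice its self-composition, so the composition supplies the
factor one half. -/
theorem comp_vf_vf (α : (symDual g).Der 1) :
    β.comp n (Pol.vf n α) (Pol.vf n α) = (1 / 2 : K) • Pol.vf n (GCA.bracket α α) := by
  have hα : Pol.vf n α ∈ (polPres (symDual g).toGCA n).degPart (n + 2) :=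
    Pol.mem_congr (S := (polPres (symDual g).toGCA n).degPart) (by ring) (Pol.vf_mem α)
  have h := β.ad_vf_eq_comp_add (α := α) hα
  rw [← two_smul K] at h
  have h2 : Pol.ad n (.vf 1 α) (Pol.vf n α) = Pol.vf n (GCA.bracket α α) := Pol.ad_vf _ _
  rw [← h2, h, smul_smul, one_div, inv_mul_cancel₀ two_ne_zero, one_smul]

/-- Each bracket is a composition plus its swap, and the antidiagonal is symmetric under the swap,
so the factor one half disappears. -/
theorem half_sum_schouten (p : ∀ m, Pol.piece (symDual g).toGCA n m (n + 2)) (N : ℕ) :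
    (1 / 2 : K) • ∑ kl ∈ Finset.HasAntidiagonal.antidiagonal N,
      Pol.schouten ⟨(p kl.1).1, Pol.piece_le_degPart (symDual g).toGCA n _ _ (p kl.1).2⟩ (p kl.2).1 =
    ∑ kl ∈ Finset.HasAntidiagonal.antidiagonal N, β.comp n (p kl.1).1 (p kl.2).1 := by
  have h : ∀ kl : ℕ × ℕ, Pol.schouten
      ⟨(p kl.1).1, Pol.piece_le_degPart (symDual g).toGCA n _ _ (p kl.1).2⟩ (p kl.2).1 =
      β.comp n (p kl.1).1 (p kl.2).1 + β.comp n (p kl.2).1 (p kl.1).1 := fun kl =>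
    β.schouten_eq_add n _ ⟨(p kl.2).1, Pol.piece_le_degPart (symDual g).toGCA n _ _ (p kl.2).2⟩
  have hs : ∑ kl ∈ Finset.HasAntidiagonal.antidiagonal N, β.comp n (p kl.2).1 (p kl.1).1 =
      ∑ kl ∈ Finset.HasAntidiagonal.antidiagonal N, β.comp n (p kl.1).1 (p kl.2).1 :=
    Finset.Nat.sum_antidiagonal_swap (f := fun kl : ℕ × ℕ => β.comp n (p kl.1).1 (p kl.2).1)
  rw [Finset.sum_congr rfl fun kl _ => h kl, Finset.sum_add_distrib, hs, ← two_smul K, smul_smul,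
    one_div, inv_mul_cancel₀ two_ne_zero, one_smul]

/-- The weight `1` part of the Maurer–Cartan equation. -/
theorem mcSum_one {p : ℕ → Pol (symDual g).toGCA n} (h0 : p 0 = 0) {α : (symDual g).Der 1}
    (h1 : p 1 = Pol.vf n α) :
    β.mcSum n p 1 = Pol.vf n (GCA.bracket (symDual g).d α + (1 / 2 : K) • GCA.bracket α α) := by
  have hs : ∑ kl ∈ Finset.HasAntidiagonal.antidiagonal (1 + 1), β.comp n (p kl.1) (p kl.2) =
      β.comp n (p 1) (p 1) := by
    rw [Finset.Nat.sum_antidiagonal_succ, Finset.Nat.sum_antidiagonal_succ']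
    simp [h0, comp_zero_left, comp_zero_right]
  rw [mcSum, hs, h1, comp_vf_vf, Pol.polD_vf, smul_smul, sg_mul_self, one_smul, Pol.vf_add,
    Pol.vf_smul]

/-- The part of weight `m ≠ 1` of the Maurer–Cartan equation is the one for the polyvectors of weight
at least `2` over the deformed algebra. -/
theorem mcSum_of_ne_one (α : (symDual g).MaurerCartan)
    (π : ∀ m, Pol.piece (symDual g).toGCA n m (n + 2)) {p : ℕ → Pol (symDual g).toGCA n}
    (hp : ∀ m, p m = (π m).1 + if m = 1 then Pol.vf n α.α else 0) {m : ℕ} (hm : m ≠ 1) :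
    β.mcSum n p m = sg K (n + 1) • deformD (symDual g) α n (π m).1 +
      (1 / 2 : K) • ∑ kl ∈ Finset.HasAntidiagonal.antidiagonal (m + 1),
        Pol.schouten ⟨(π kl.1).1, Pol.piece_le_degPart (symDual g).toGCA n _ _ (π kl.1).2⟩
          (π kl.2).1 := by
  rw [half_sum_schouten β π, deformD_apply, smul_add, smul_smul, sg_mul_self, one_smul,
    β.ad_vf_eq_comp_add (Pol.piece_le_degPart _ _ _ _ (π m).2), mcSum, add_assoc]
  congr 1
  · rw [hp, if_neg hm, add_zero]
  -- As m ≠ 1, the vector field α enters only through the two distinct pairs (m, 1) and (1, m), and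
  -- the two extra terms add up to its bracket with the component of weight m.
  have h1 : ∀ kl ∈ Finset.HasAntidiagonal.antidiagonal (m + 1), β.comp n (p kl.1) (p kl.2) =
      (if kl = (m, 1) then β.comp n (π m).1 (Pol.vf n α.α) else 0) +
      (if kl = (1, m) then β.comp n (Pol.vf n α.α) (π m).1 else 0) +
        β.comp n (π kl.1).1 (π kl.2).1 := by
    rintro ⟨k, l⟩ hkl
    have hkl : k + l = m + 1 := Finset.HasAntidiagonal.mem_antidiagonal.1 hkl
    simp only [hp, Prod.mk.injEq]
    by_cases hk : k = 1
    · obtain rfl : l = m := by omega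
      rw [if_pos hk, if_neg hm, if_neg (by omega), if_pos ⟨hk, rfl⟩, add_zero, comp_add_left,
        zero_add, add_comm]
    · rw [if_neg hk, if_neg (c := k = 1 ∧ l = m) (fun h => hk h.1), add_zero, add_zero]
      by_cases hl : l = 1
      · obtain rfl : k = m := by omega
        rw [if_pos hl, if_pos ⟨rfl, hl⟩, comp_add_right, add_comm]
      · rw [if_neg hl, if_neg fun h => hl h.2, add_zero, zero_add]
  rw [Finset.sum_congr rfl h1, Finset.sum_add_distrib, Finset.sum_add_distrib,
    Finset.sum_ite_eq', Finset.sum_ite_eq', if_pos, if_pos]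
  · exact Finset.HasAntidiagonal.mem_antidiagonal.2 (add_comm _ _)
  · exact Finset.HasAntidiagonal.mem_antidiagonal.2 rfl

end HomBasis

variable [CharZero K]

namespace SemiFreePoisson

variable (c : SemiFreePoisson g n)

theorem total_zero : (c.total 0).1 = 0 := congrArg Subtype.val c.π.π_zero

theorem total_one : (c.total 1).1 = Pol.vf n c.α.α := rfl

/-- The part of weight `m` of the shifted Poisson structure. -/
def part (m : ℕ) : Pol.piece (symDual g).toGCA n m (n + 2) := c.π.π m

theorem part_one : c.part 1 = 0 := c.π.π_one

theorem total_of_ne_one {m : ℕ} (h : m ≠ 1) : (c.total m).1 = (c.part m).1 := by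
  match m, h with
  | 0, _ => rfl
  | m + 2, _ => rfl

theorem total_eq (m : ℕ) :
    (c.total m).1 = (c.part m).1 + if m = 1 then Pol.vf n c.α.α else 0 := by
  by_cases h : m = 1
  · subst h
    rw [if_pos rfl, total_one, c.part_one]
    exact (zero_add _).symm
  · rw [if_neg h, total_of_ne_one c h, add_zero]

theorem total_mem (m : ℕ) : (c.total m).1 ∈ Pol.piece (symDual g).toGCA n m (n + 2) := by
  by_cases h : m = 1
  · subst h
    exact vf_mem_piece (by ring) c.α.α
  · rw [total_of_ne_one c h]
    exact (c.part m).2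

theorem mcSum_total (c : SemiFreePoisson g n) (β : HomBasis g) (m : ℕ) : β.mcSum n (fun m => (c.total m).1) m = 0 := by
  by_cases h : m = 1
  · subst h
    rw [β.mcSum_one c.total_zero c.total_one, c.α.mc, Pol.vf_zero]
  · rw [β.mcSum_of_ne_one c.α c.part c.total_eq h]
    exact c.π.mc m

/-- The weight one part determines α because derivations embed in the polyvectors; the other parts
are those of π. -/
theorem ext_total {c c' : SemiFreePoisson g n} (h : ∀ m, (c.total (m + 1)).1 = (c'.total (m + 1)).1) :
    c = c' := by
  obtain ⟨⟨α, hα⟩, π⟩ := c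
  obtain ⟨⟨α', hα'⟩, π'⟩ := c'
  obtain rfl : α = α' := vf_injective n (h 0)
  congr 1
  refine ShiftedPoisson.ext_val fun m => ?_
  match m with
  | 0 => rw [π.π_zero, π'.π_zero]
  | 1 => rw [π.π_one, π'.π_one]
  | m + 2 => exact h (m + 1)

/-- The family of maps of a semi-free deformation with a shifted Poisson structure. -/
noncomputable def graph (β : HomBasis g) : GraphFamily g n where
  map p l := β.toMap n (p + 1) l (c.total (p + 1)).1
  symm p l := β.toMap_mem n (p + 1) l _
  degree p l := β.toMap_hasDegree n (p + 1) l (Pol.piece_le_degPart _ _ _ _ (c.total_mem _))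
  bounded p := β.toMap_bounded n (c.total (p + 1)).2
  identity r l := by
    rw [← β.toMap_mcSum n c.total_zero c.total_mem, mcSum_total, map_zero]

theorem graph_injective (β : HomBasis g) :
    Function.Injective fun c : SemiFreePoisson g n => c.graph β := by
  intro c c' h
  refine ext_total fun m => β.weight_ext n (c.total _).2 (c'.total _).2 fun l => ?_
  exact congrFun (congrFun (congrArg GraphFamily.map h) m) l

theorem graph_surjective (β : HomBasis g) :
    Function.Surjective fun c : SemiFreePoisson g n => c.graph β := by
  intro F
  -- The maps with m + 1 outputs lift to a polyvector of weight m + 1; the component of weight 0 is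
  -- set to zero below.
  choose q hq hqF using fun m => β.exists_toMap_eq n (F.map m) (F.symm m) (F.degree m) (F.bounded m)
  let p : ℕ → Pol (symDual g).toGCA n := fun m => Nat.casesOn m 0 q
  have hp : ∀ m, p m ∈ Pol.piece (symDual g).toGCA n m (n + 2) := fun m => by
    cases m with
    | zero => exact Submodule.zero_mem _
    | succ m => exact hq m
  -- The quadratic identities are the images of the Maurer–Cartan equation under the transfer, which
  -- is injective in each weight.
  have hmc : ∀ r, β.mcSum n p (r + 1) = 0 := fun r => by
    refine β.weight_ext n (β.mcSum_mem_weight n (fun m => Pol.piece_le_weight _ _ _ _ (hp m)) _)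
      (Submodule.zero_mem _) fun l => ?_
    rw [β.toMap_mcSum n rfl hp, map_zero, ← F.identity r l]
    simp only [← hqF]
    rfl
  obtain ⟨α, hα⟩ := exists_vf_of_mem_piece (k := 1) (by ring) (hp 1)
  let a : (symDual g).MaurerCartan := ⟨α, vf_injective n (by
    rw [← β.mcSum_one (p := p) rfl hα, hmc 0, Pol.vf_zero])⟩
  -- The weight one component has gone into α and is removed here, as a Poisson structure starts in
  -- weight 2.
  let π : ∀ m, Pol.piece (symDual g).toGCA n m (n + 2) := fun m =>
    if m = 1 then 0 else ⟨p m, hp m⟩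
  have hπ : ∀ m, p m = (π m).1 + if m = 1 then Pol.vf n a.α else 0 := fun m => by
    by_cases h : m = 1
    · subst h
      exact hα.trans (zero_add _).symm
    · simp only [π, if_neg h, add_zero]
  let c : SemiFreePoisson g n := ⟨a, π, rfl, rfl, fun m => by
    by_cases h : m = 1
    · subst h
      -- In weight one the Poisson equation is trivial: the pairs (0,2), (1,1) and (2,0) all contain
      -- a vanishing component.
      refine (congrArg₂ (· + ·) ?_ ?_).trans (add_zero 0)
      · exact (congrArg _ (map_zero (deformD (symDual g) a n))).trans
          (smul_zero (A := Pol (symDual g).toGCA n) _)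
      · refine (β.half_sum_schouten π _).trans ?_
        rw [Finset.Nat.sum_antidiagonal_succ, Finset.Nat.sum_antidiagonal_succ']
        simp [π, p, β.comp_zero_left, β.comp_zero_right]
        rfl
    · refine (β.mcSum_of_ne_one a π hπ h).symm.trans ?_
      match m, h with
      | 0, _ => exact β.mcSum_zero n rfl
      | m + 1, _ => exact hmc m⟩
  have hc : ∀ m, (c.total m).1 = p m := fun m => (c.total_eq m).trans (hπ m).symm
  refine ⟨c, ?_⟩
  have hm : (c.graph β).map = F.map := by
    funext r l
    exact (congrArg (β.toMap n (r + 1) l) (hc (r + 1))).trans (hqF r l)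
  -- The remaining fields of a family are propositions, so equality of the maps suffices.
  change c.graph β = F
  generalize c.graph β = G at hm
  obtain ⟨_, _, _, _, _⟩ := G
  obtain ⟨_, _, _, _, _⟩ := F
  obtain rfl := hm
  rfl

end SemiFreePoisson

end Correspondence

theorem mainTheorem1 {K : Type u} [Field K] [CharZero K]
    (g : CochainComplex (ModuleCat.{v} K) ℤ)
    (hb : ∃ N : ℤ, ∀ i : ℤ, N < |i| → Subsingleton (g.X i))
    (hf : ∀ i : ℤ, Module.Finite K (g.X i)) (n : ℤ) :
    ∃ Ψ : ∀ m : ℕ, Pol.weight (symDual g).toGCA n m ≃ₗ[K] DirectSum ℕ fun l => homPM g n l m,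
      IsTransfer g n Ψ ∧
      ∃ e : SemiFreePoisson g n ≃ GraphFamily g n,
        ∀ (c : SemiFreePoisson g n) (p l : ℕ),
          (e c).map p l = (Ψ (p + 1) (c.total (p + 1)) l).1 := by
  obtain ⟨β⟩ := exists_homBasis hb hf
  refine ⟨β.transfer n, β.isTransfer n, Equiv.ofBijective _
    ⟨SemiFreePoisson.graph_injective β, SemiFreePoisson.graph_surjective β⟩, fun c p l => ?_⟩
  exact (β.transfer_apply n (c.total (p + 1)) l).symm
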